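/- Let $\alpha,\beta,\theta,\vartheta\in(-1,\infty)$ be real numbers with $\alpha+\beta+2\theta+2\vartheta+3>0$. Let $\mathbb D$ be the open unit disk, and for $a>-1$ put $dA_a(z)=\frac{a+1}{\pi}(1-|z|^2)^a\,dx\,dy$ on $\mathbb D$ ($z=x+iy$). Let $A^2_a(\mathbb D)$ be the space of holomorphic functions $g$ on $\mathbb D$ with $$\|g\|_a^2=\int_{\mathbb D}|g|^2\,dA_a<\infty,$$ and let $A^2_{\alpha,\beta,\theta,\vartheta}(\mathbb D^2)$ be the space of holomorphic functions $f$ on the bidisk $\mathbb D^2$ with $$\|f\|^2_{\alpha,\beta,\theta,\vartheta}=\int_{\mathbb D^2}|f(z_1,z_2)|^2\,|1-\bar z_2z_1|^{2\vartheta}\,|z_1-z_2|^{2\theta}\,dA_\alpha(z_1)\,dA_\beta(z_2)<\infty.$$ For a function $g$ on $\mathbb D^2$ let $(\oslash g)(z_1)=g(z_1,z_1)$ be its restriction to the diagonal. Write $(x)_n=x(x+1)\cdots(x+n-1)$ with $(x)_0=1$, and ${}_3F_2(a_1,a_2,a_3;b_1,b_2\,|\,x)=\sum_{n\ge0}\frac{(a_1)_n(a_2)_n(a_3)_n}{(b_1)_n(b_2)_n\,n!}x^n$.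 **Theorem.** For every $f\in A^2_{\alpha,\beta,\theta,\vartheta}(\mathbb D^2)$, $$\|f\|^2_{\alpha,\beta,\theta,\vartheta}=\sum_{N=0}^{\infty}\frac1{\sigma(\alpha,\beta,\theta+N,\vartheta)}\left\|\sum_{k=0}^{N}a_{k,N}\,\partial_{z_1}^{N-k}\oslash\left[\partial_{z_1}^kf\right]\right\|^2_{\alpha+\beta+2\theta+2\vartheta+2N+2},$$ where $$\frac1{\sigma(\alpha,\beta,\theta,\vartheta)}=\frac{(\beta+1)\,\Gamma(\alpha+2)\,\Gamma(\theta+1)}{(\alpha+\beta+2\theta+2\vartheta+3)\,\Gamma(\alpha+\theta+2)}\;{}_3F_2\big(\theta+1,\ \alpha+\theta+\vartheta+2,\ \alpha+\theta+\vartheta+2;\ \alpha+\theta+2,\ \alpha+\beta+2\theta+2\vartheta+4\,\big|\,1\big)$$ and $$a_{k,N}=\frac{(-1)^{N-k}}{k!\,(N-k)!}\,\frac{(\alpha+\theta+\vartheta+k+2)_{N-k}}{(\alpha+\beta+2\theta+2\vartheta+N+k+3)_{N-k}}.$$ Here, for every $N\ge0$, the series defining the ${}_3F_2$ value in $\sigma(\alpha,\beta,\theta+N,\vartheta)$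 converges, $\sigma(\alpha,\beta,\theta+N,\vartheta)>0$, and the function inside the $N$-th norm belongs to $A^2_{\alpha+\beta+2\theta+2\vartheta+2N+2}(\mathbb D)$. -/

import Mathlib

open MeasureTheory

noncomputable section

namespace BidiskBergman

/-- The open unit disk in the complex plane. -/
def disk : Set ℂ := Metric.ball 0 1

/-- The open unit bidisk, the set of pairs with both moduli less than one. -/
def bidisk : Set (ℂ × ℂ) := disk ×ˢ disk

/-- The weighted area measure `(a + 1) (1 - |z|²)^a dx dy / π` on the unit disk. -/
def diskMeasure (a : ℝ) : Measure ℂ :=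
  (volume.restrict disk).withDensity
    (fun z => ENNReal.ofReal ((a + 1) * (1 - ‖z‖ ^ 2) ^ a / Real.pi))

/-- The squared norm of the one-variable weighted Bergman space with exponent `a`. -/
def diskNormSq (a : ℝ) (g : ℂ → ℂ) : ℝ :=
  ∫ z, ‖g z‖ ^ 2 ∂(diskMeasure a)

/-- The one-variable weighted Bergman space: holomorphic functions in the disk whose squared
modulus is integrable. Values outside the disk play no role. -/
def diskBergman (a : ℝ) : Set (ℂ → ℂ) :=
  {g | DifferentiableOn ℂ g disk ∧ Integrable (fun z => ‖g z‖ ^ 2) (diskMeasure a)}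

/-- The weight `|1 - conj z₂ * z₁|^(2ϑ) * |z₁ - z₂|^(2θ)`. -/
def bidiskWeight (θ ϑ : ℝ) (z : ℂ × ℂ) : ℝ :=
  ‖1 - (starRingEnd ℂ) z.2 * z.1‖ ^ (2 * ϑ) * ‖z.1 - z.2‖ ^ (2 * θ)

/-- The squared norm of the weighted Bergman space on the bidisk. -/
def bidiskNormSq (α β θ ϑ : ℝ) (f : ℂ × ℂ → ℂ) : ℝ :=
  ∫ z, ‖f z‖ ^ 2 * bidiskWeight θ ϑ z ∂((diskMeasure α).prod (diskMeasure β))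

/-- The weighted Bergman space on the bidisk: holomorphic functions in the bidisk of finite
norm. Values outside the bidisk play no role. -/
def bidiskBergman (α β θ ϑ : ℝ) : Set (ℂ × ℂ → ℂ) :=
  {f | DifferentiableOn ℂ f bidisk ∧
    Integrable (fun z => ‖f z‖ ^ 2 * bidiskWeight θ ϑ z)
      ((diskMeasure α).prod (diskMeasure β))}

/-- The `k`-th partial derivative with respect to the first variable. -/
def partialFst (k : ℕ) (f : ℂ × ℂ → ℂ) (z : ℂ × ℂ) : ℂ :=
  iteratedDeriv k (fun ζ => f (ζ, z.2)) z.1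

/-- Restriction to the diagonal, as a function of one variable. -/
def diagRestrict (f : ℂ × ℂ → ℂ) (z : ℂ) : ℂ := f (z, z)

/-- The Pochhammer symbol `(x)_n = x (x + 1) ⋯ (x + n - 1)`. -/
def poch (x : ℝ) (n : ℕ) : ℝ := (ascPochhammer ℝ n).eval x

/-- The `n`-th term of the series defining `₃F₂`. -/
def hyp32Term (a₁ a₂ a₃ b₁ b₂ x : ℝ) (n : ℕ) : ℝ :=
  poch a₁ n * poch a₂ n * poch a₃ n / (poch b₁ n * poch b₂ n * (n.factorial : ℝ)) * x ^ n

/-- The generalized hypergeometric function `₃F₂(a₁, a₂, a₃; b₁, b₂ | x)`, as a series. -/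
def hyp32 (a₁ a₂ a₃ b₁ b₂ x : ℝ) : ℝ := ∑' n : ℕ, hyp32Term a₁ a₂ a₃ b₁ b₂ x n

/-- The constant `σ(α, β, θ, ϑ)`, given through its reciprocal. -/
def sigma (α β θ ϑ : ℝ) : ℝ :=
  ((β + 1) * Real.Gamma (α + 2) * Real.Gamma (θ + 1) /
      ((α + β + 2 * θ + 2 * ϑ + 3) * Real.Gamma (α + θ + 2)) *
    hyp32 (θ + 1) (α + θ + ϑ + 2) (α + θ + ϑ + 2)
      (α + θ + 2) (α + β + 2 * θ + 2 * ϑ + 4) 1)⁻¹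

/-- The coefficient `a_{k,N}` (used for `k ≤ N` only). -/
def coeff (α β θ ϑ : ℝ) (k N : ℕ) : ℝ :=
  (-1) ^ (N - k) / ((k.factorial : ℝ) * ((N - k).factorial : ℝ)) *
    (poch (α + θ + ϑ + k + 2) (N - k) /
      poch (α + β + 2 * θ + 2 * ϑ + N + k + 3) (N - k))

/-- The function `∑_{k=0}^N a_{k,N} ∂^{N-k} ⊘ [∂_{z₁}^k f]` of one variable. -/
def diagTerm (α β θ ϑ : ℝ) (N : ℕ) (f : ℂ × ℂ → ℂ) (z : ℂ) : ℂ :=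
  ∑ k ∈ Finset.range (N + 1),
    (coeff α β θ ϑ k N : ℂ) * iteratedDeriv (N - k) (diagRestrict (partialFst k f)) z

end BidiskBergman

end

noncomputable section

namespace BidiskBergman

open scoped ENNReal

/-! ### Parseval's identity and rotation invariant measures -/

/-! The proof decomposes the bidisk space under the Möbius group. Put `A = α + θ + ϑ + 2`, `B = β +
θ + ϑ + 2`; then `A + B = α + β + 2θ + 2ϑ + 4`. A Möbius map acting diagonally multiplies the
weighted measure by the factor of a tensor product of discrete series of weights `A` and `B`
(`map_mobiusProd_bmeas`). Differentiating along one real one-parameter family shows that `lower = ∂₁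
+ ∂₂` and `raise = z₁²∂₁ + z₂²∂₂ + A z₁ + B z₂` are adjoint (`polyInner_raise`).

The powers `(z₁ - z₂)^M` are killed by `lower`, and their raised images `basisPoly` form an
orthogonal basis of the polynomials. The commutator `lower_raise` gives their squared norms as `n!
(A + B + 2M)_n ‖(z₁ - z₂)^M‖²`. The last factor is the total mass of the measure with `θ + M` in
place of `θ`. It equals `1 / σ` (`bmeas_univ`): moving `z₂` to the origin and expanding a binomial
series produces the `₃F₂`.

The differential operator of order `N` sends a homogeneous polynomial `p` of degree `m` to `trans N
p * z^(m - N)`. The functional `trans N` turns `raise` into multiplication by `m + A + B + N`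
(`trans_raise`, a telescoping identity for the coefficients) and takes the value `1` at `(z₁ -
z₂)^N` and `0` at the other powers. It therefore reads off, up to `(A + B + 2N)_n`, the coordinate
along the `N`-th family. As `z^n` has squared norm `n! / (A + B + 2N)_n` in the `N`-th target space,
the formula holds in each degree (`lintegral_normSq_of_isHomogeneous`).

For a general `f`, invariance under rotations makes homogeneous components orthogonal on both sides
(`RotationInvariant.lintegral_normSq_eq_tsum`), and the degrees are summed by Tonelli. This identity
holds in `[0, ∞]`; finiteness of the norm enters only at the end. -/

lemma integral_exp_int_mul_I (k : ℤ) :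
    ∫ t in (0 : ℝ)..(2 * Real.pi), Complex.exp (k * (t * Complex.I)) =
      if k = 0 then ((2 * Real.pi : ℝ) : ℂ) else 0 := by
  split_ifs with h
  · subst h; simp
  · have hk : (k * Complex.I : ℂ) ≠ 0 := by simp [h]
    have := integral_exp_mul_complex (a := 0) (b := 2 * Real.pi) hk
    have h2 : ∀ t : ℝ, (k * (t * Complex.I) : ℂ) = (k * Complex.I) * t := fun t => by ring
    simp_rw [h2, this]
    have : (k * Complex.I * ((2 * Real.pi : ℝ) : ℂ)) = k * (2 * Real.pi * Complex.I) := by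
      push_cast; ring
    rw [this, Complex.exp_int_mul_two_pi_mul_I]
    simp

lemma norm_rot (t : ℝ) : ‖Complex.exp (t * Complex.I)‖ = 1 := Complex.norm_exp_ofReal_mul_I t

/-- Absolute summability lets the square be expanded as a double series and integrated term by term;
only the diagonal terms survive. -/
lemma integral_normSq_fourierSum {c : ℕ → ℂ} (hc : Summable fun n => ‖c n‖) :
    ∫ t in (0 : ℝ)..(2 * Real.pi), ‖∑' n, c n * Complex.exp (t * Complex.I) ^ n‖ ^ 2 =
      2 * Real.pi * ∑' n, ‖c n‖ ^ 2 := by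
  set F : ℕ × ℕ → C(ℝ, ℂ) := fun p =>
    ⟨fun t => (c p.1 * Complex.exp (t * Complex.I) ^ p.1) *
      (starRingEnd ℂ) (c p.2 * Complex.exp (t * Complex.I) ^ p.2), by fun_prop⟩ with hF
  have hn : ∀ t : ℝ, ∀ n, ‖c n * Complex.exp (t * Complex.I) ^ n‖ = ‖c n‖ := by
    intro t n; rw [norm_mul, norm_pow, norm_rot, one_pow, mul_one]
  have hprod : Summable fun p : ℕ × ℕ => ‖c p.1‖ * ‖c p.2‖ :=
    hc.mul_of_nonneg hc (fun _ => norm_nonneg _) (fun _ => norm_nonneg _)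
  have hFn : ∀ p t, ‖F p t‖ = ‖c p.1‖ * ‖c p.2‖ := by
    intro p t
    simp only [hF, ContinuousMap.coe_mk]
    rw [norm_mul, RCLike.norm_conj, hn, hn]
  have key := intervalIntegral.hasSum_intervalIntegral_of_summable_norm (a := 0) (b := 2 * Real.pi)
    (f := F) (by
      refine Summable.of_nonneg_of_le (fun _ => norm_nonneg _) (fun p => ?_) hprod
      refine (ContinuousMap.norm_le _ (by positivity)).2 fun x => ?_
      simp [hFn])
  have h1 : ∀ t : ℝ, ∑' p, F p t =
      ((‖∑' n, c n * Complex.exp (t * Complex.I) ^ n‖ ^ 2 : ℝ) : ℂ) := by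
    intro t
    have hs : Summable fun n => ‖c n * Complex.exp (t * Complex.I) ^ n‖ := by simpa [hn] using hc
    have := tsum_mul_tsum_of_summable_norm hs
      (g := fun n => (starRingEnd ℂ) (c n * Complex.exp (t * Complex.I) ^ n))
      (by simpa only [RCLike.norm_conj] using hs)
    rw [← Complex.conj_tsum, Complex.mul_conj, Complex.normSq_eq_norm_sq] at this
    rw [this]
    rfl
  have h2 : ∀ p : ℕ × ℕ, ∫ t in (0 : ℝ)..(2 * Real.pi), F p t =
      if p.1 = p.2 then ((2 * Real.pi * ‖c p.1‖ ^ 2 : ℝ) : ℂ) else 0 := by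
    rintro ⟨m, n⟩
    have : ∀ t : ℝ, F (m, n) t = (c m * (starRingEnd ℂ) (c n)) *
        Complex.exp (((m : ℤ) - (n : ℤ) : ℤ) * (t * Complex.I)) := by
      intro t
      have he : (starRingEnd ℂ) (Complex.exp (t * Complex.I)) = Complex.exp (-(t * Complex.I)) := by
        rw [← Complex.exp_conj]; simp
      simp only [hF, ContinuousMap.coe_mk, map_mul, map_pow, he]
      push_cast
      rw [sub_mul, sub_eq_add_neg, Complex.exp_add, ← mul_neg (n : ℂ), Complex.exp_nat_mul,
        Complex.exp_nat_mul]
      ring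
    simp_rw [this]
    rw [intervalIntegral.integral_const_mul, integral_exp_int_mul_I]
    by_cases hmn : m = n
    · subst hmn
      simp only [sub_self, if_true]
      rw [Complex.mul_conj, Complex.normSq_eq_norm_sq]
      push_cast; ring
    · have : ((m : ℤ) - n) ≠ 0 := by omega
      simp [this, hmn]
  simp_rw [h1, h2] at key
  have key2 : HasSum (fun n : ℕ => ((2 * Real.pi * ‖c n‖ ^ 2 : ℝ) : ℂ))
      (∫ t in (0 : ℝ)..(2 * Real.pi),
        ((‖∑' n, c n * Complex.exp (t * Complex.I) ^ n‖ ^ 2 : ℝ) : ℂ)) := by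
    have hinj : Function.Injective (fun n : ℕ => (n, n)) := fun a b h => (Prod.mk.inj h).1
    refine (hinj.hasSum_iff ?_).2 key |>.congr_fun ?_
    · rintro ⟨m, n⟩ h
      have : m ≠ n := fun e => h ⟨m, by simp [e]⟩
      simp [this]
    · intro n; simp
  rw [intervalIntegral.integral_ofReal] at key2
  have key3 := (Complex.hasSum_ofReal.1 key2).tsum_eq
  rw [tsum_mul_left] at key3
  exact key3.symm

lemma lintegral_normSq_fourierSum {c : ℕ → ℂ} (hc : Summable fun n => ‖c n‖) :
    ∫⁻ t in Set.Ioc (0 : ℝ) (2 * Real.pi),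
      ENNReal.ofReal (‖∑' n, c n * Complex.exp (t * Complex.I) ^ n‖ ^ 2) =
      ENNReal.ofReal (2 * Real.pi) * ∑' n, ENNReal.ofReal (‖c n‖ ^ 2) := by
  have hcont : Continuous fun t : ℝ =>
      ‖∑' n, c n * Complex.exp (t * Complex.I) ^ n‖ ^ 2 := by
    refine ((continuous_tsum (fun n => by fun_prop) hc fun n t => ?_).norm).pow 2
    rw [norm_mul, norm_pow, norm_rot, one_pow, mul_one]
  have hsq : Summable fun n => ‖c n‖ ^ 2 := by
    have := (hc.mul_of_nonneg hc (fun _ => norm_nonneg _) (fun _ => norm_nonneg _)).comp_injective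
      (i := fun n : ℕ => (n, n)) (fun a b h => (Prod.mk.inj h).1)
    simpa [Function.comp_def, pow_two] using this
  rw [← ofReal_integral_eq_lintegral_ofReal, ← intervalIntegral.integral_of_le (by positivity),
    integral_normSq_fourierSum hc, ENNReal.ofReal_mul (by positivity),
    ENNReal.ofReal_tsum_of_nonneg (fun _ => by positivity) hsq]
  · exact (hcont.integrableOn_Icc).mono_set Set.Ioc_subset_Icc_self
  · exact Filter.Eventually.of_forall fun _ => by positivity

section Rotation

variable {E : Type*} [NormedAddCommGroup E] [NormedSpace ℂ E] [MeasurableSpace E] [BorelSpace E]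
  [SecondCountableTopology E]

/-- A measure is rotation invariant if it is preserved by multiplication with `exp (i t)`. -/
def RotationInvariant (μ : Measure E) : Prop :=
  ∀ t : ℝ, MeasurePreserving (fun z : E => Complex.exp (t * Complex.I) • z) μ μ

/-- For a rotation invariant measure the homogeneous components of a function are orthogonal. -/
lemma RotationInvariant.lintegral_normSq_eq_tsum {μ : Measure E} [SFinite μ]
    (hμ : RotationInvariant μ)
    {S : Set E} (hS : MeasurableSet S) (hSμ : ∀ᵐ z ∂μ, z ∈ S)
    (hSrot : ∀ z ∈ S, ∀ t : ℝ, Complex.exp (t * Complex.I) • z ∈ S)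
    {a : ℕ → E → ℂ} (ha : ∀ n, Measurable (a n))
    (hhom : ∀ n, ∀ z ∈ S, ∀ t : ℝ, a n (Complex.exp (t * Complex.I) • z) =
      Complex.exp (t * Complex.I) ^ n * a n z)
    {f : E → ℂ} (hf : ∀ z ∈ S, HasSum (fun n => a n z) (f z)) :
    ∫⁻ z, ENNReal.ofReal (‖f z‖ ^ 2) ∂μ = ∑' n, ∫⁻ z, ENNReal.ofReal (‖a n z‖ ^ 2) ∂μ := by
  classical
  -- Measurability of `f` is not assumed: on `S` it is a pointwise limit of measurable partial sums.
  have hind : Measurable (S.indicator f) := by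
    refine measurable_of_tendsto_metrizable (f := fun M z => S.indicator
      (fun z => ∑ n ∈ Finset.range M, a n z) z) (fun M => ?_) ?_
    · exact (Finset.measurable_fun_sum _ fun n _ => ha n).indicator hS
    · rw [tendsto_pi_nhds]
      intro z
      by_cases hz : z ∈ S
      · simpa [hz] using (hf z hz).tendsto_sum_nat
      · simp [hz]
  set G : E → ℝ≥0∞ := fun z => ENNReal.ofReal (‖S.indicator f z‖ ^ 2) with hG
  have hGm : Measurable G := (hind.norm.pow_const 2).ennreal_ofReal
  have e1 : ∫⁻ z, ENNReal.ofReal (‖f z‖ ^ 2) ∂μ = ∫⁻ z, G z ∂μ := by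
    refine lintegral_congr_ae ?_
    filter_upwards [hSμ] with z hz
    simp [hG, hz]
  have hsm : Measurable fun p : ℝ × E => Complex.exp (p.1 * Complex.I) • p.2 :=
    (by fun_prop : Continuous fun p : ℝ × E => Complex.exp (p.1 * Complex.I) • p.2).measurable
  -- Averaging over the circle changes nothing by invariance; after exchanging the integrals,
  -- Parseval applies on every orbit.
  have e2 : ENNReal.ofReal (2 * Real.pi) * ∫⁻ z, G z ∂μ =
      ∫⁻ t in Set.Ioc (0 : ℝ) (2 * Real.pi), ∫⁻ z, G (Complex.exp (t * Complex.I) • z) ∂μ := by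
    have : ∀ t : ℝ, ∫⁻ z, G (Complex.exp (t * Complex.I) • z) ∂μ = ∫⁻ z, G z ∂μ :=
      fun t => (hμ t).lintegral_comp hGm
    simp_rw [this]
    simp [mul_comm]
  have e3 : ∫⁻ t in Set.Ioc (0 : ℝ) (2 * Real.pi),
      ∫⁻ z, G (Complex.exp (t * Complex.I) • z) ∂μ =
      ∫⁻ z, (∫⁻ t in Set.Ioc (0 : ℝ) (2 * Real.pi), G (Complex.exp (t * Complex.I) • z)) ∂μ :=
    lintegral_lintegral_swap (hGm.comp hsm).aemeasurable
  have e4 : ∫⁻ z, (∫⁻ t in Set.Ioc (0 : ℝ) (2 * Real.pi),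
      G (Complex.exp (t * Complex.I) • z)) ∂μ =
      ∫⁻ z, ENNReal.ofReal (2 * Real.pi) * ∑' n, ENNReal.ofReal (‖a n z‖ ^ 2) ∂μ := by
    refine lintegral_congr_ae ?_
    filter_upwards [hSμ] with z hz
    rw [← lintegral_normSq_fourierSum (hf z hz).summable.norm]
    refine lintegral_congr fun t => ?_
    simp only [hG, Set.indicator_of_mem (hSrot z hz t)]
    rw [← (hf _ (hSrot z hz t)).tsum_eq]
    congr 3
    exact tsum_congr fun n => by rw [hhom n z hz t, mul_comm]
  have hm : ∀ n, Measurable fun z => ENNReal.ofReal (‖a n z‖ ^ 2) := fun n =>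
    ((ha n).norm.pow_const 2).ennreal_ofReal
  rw [e3, e4, lintegral_const_mul _ (Measurable.tsum hm),
    lintegral_tsum fun n => (hm n).aemeasurable] at e2
  rw [e1]
  refine (ENNReal.mul_right_inj ?_ ENNReal.ofReal_ne_top).1 e2
  simp [Real.pi_pos]

end Rotation

/-! ### Integrals over the disk -/

lemma mem_disk {z : ℂ} : z ∈ disk ↔ ‖z‖ < 1 := by simp [disk]

lemma isOpen_disk : IsOpen disk := Metric.isOpen_ball

lemma measurableSet_disk : MeasurableSet disk := isOpen_disk.measurableSet

/-- Polar coordinates followed by `t = r²`: the factor `2r` is the Jacobian `r` times the `2` left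
over from the angle `2π`. -/
lemma lintegral_disk_radial {F : ℝ → ℝ≥0∞} (hF : Measurable F) :
    ∫⁻ z in disk, F (‖z‖ ^ 2) = ENNReal.ofReal Real.pi * ∫⁻ t in Set.Ioo (0 : ℝ) 1, F t := by
  have hsq : (fun r : ℝ => r ^ 2) '' Set.Ioo (0 : ℝ) 1 = Set.Ioo (0 : ℝ) 1 := by
    ext t
    constructor
    · rintro ⟨r, ⟨h0, h1⟩, rfl⟩
      exact ⟨by positivity, by simpa using pow_lt_one₀ h0.le h1 two_ne_zero⟩
    · rintro ⟨h0, h1⟩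
      refine ⟨Real.sqrt t, ⟨Real.sqrt_pos.2 h0, ?_⟩, Real.sq_sqrt h0.le⟩
      rw [Real.sqrt_lt' one_pos]; simpa using h1
  have hsub : ∫⁻ t in Set.Ioo (0 : ℝ) 1, F t =
      ∫⁻ r in Set.Ioo (0 : ℝ) 1, ENNReal.ofReal (2 * r) * F (r ^ 2) := by
    have := lintegral_image_eq_lintegral_abs_deriv_mul (f := fun r : ℝ => r ^ 2)
      (f' := fun r => 2 * r) (s := Set.Ioo (0 : ℝ) 1) measurableSet_Ioo
      (fun x _ => by simpa using ((hasDerivAt_pow 2 x).hasDerivWithinAt))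
      (fun x hx y hy h => by
        have := (pow_left_inj₀ hx.1.le hy.1.le two_ne_zero).1 h
        exact this) F
    rw [hsq] at this
    rw [this]
    refine setLIntegral_congr_fun measurableSet_Ioo fun r hr => ?_
    rw [abs_of_pos (by linarith [hr.1])]
  rw [← lintegral_indicator measurableSet_disk, ← Complex.lintegral_comp_polarCoord_symm]
  have h1 : ∀ p ∈ polarCoord.target, ENNReal.ofReal p.1 •
      disk.indicator (fun z => F (‖z‖ ^ 2)) (Complex.polarCoord.symm p) =
      (Set.Iio (1 : ℝ)).indicator (fun r => ENNReal.ofReal r * F (r ^ 2)) p.1 := by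
    rintro ⟨r, t⟩ ⟨hr, -⟩
    have hr : 0 < r := hr
    have hn : ‖Complex.polarCoord.symm (r, t)‖ = r := by
      rw [Complex.norm_polarCoord_symm, abs_of_pos hr]
    by_cases h : r < 1
    · rw [Set.indicator_of_mem (by rw [mem_disk, hn]; exact h),
        Set.indicator_of_mem (by exact h), hn, smul_eq_mul]
    · rw [Set.indicator_of_notMem (by rw [mem_disk, hn]; exact h),
        Set.indicator_of_notMem (by exact h), smul_zero]
  have hm : Measurable fun r : ℝ =>
      (Set.Iio (1 : ℝ)).indicator (fun r => ENNReal.ofReal r * F (r ^ 2)) r :=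
    (ENNReal.measurable_ofReal.mul (hF.comp (measurable_id.pow_const 2))).indicator
      measurableSet_Iio
  rw [setLIntegral_congr_fun polarCoord.open_target.measurableSet h1, polarCoord_target,
    Measure.volume_eq_prod, ← Measure.prod_restrict, lintegral_prod _ (by
      exact (hm.comp measurable_fst).aemeasurable)]
  simp only [lintegral_const, Measure.restrict_apply, MeasurableSet.univ, Set.univ_inter,
    Real.volume_Ioo]
  rw [lintegral_mul_const _ hm, setLIntegral_indicator measurableSet_Iio, Set.inter_comm,
    Set.Ioi_inter_Iio, hsub, mul_comm, show Real.pi - -Real.pi = Real.pi * 2 by ring,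
    ENNReal.ofReal_mul Real.pi_pos.le, mul_assoc, ← lintegral_const_mul _ (by fun_prop)]
  congr 1
  refine lintegral_congr fun r => ?_
  rw [ENNReal.ofReal_mul zero_le_two, mul_assoc]

/-- This is Euler's beta integral, read off from the fact that the beta distribution has total mass
one. -/
lemma lintegral_Ioo_rpow_mul_rpow {a b : ℝ} (ha : -1 < a) (hb : -1 < b) :
    ∫⁻ t in Set.Ioo (0 : ℝ) 1, ENNReal.ofReal ((1 - t) ^ a * t ^ b) =
      ENNReal.ofReal (Real.Gamma (a + 1) * Real.Gamma (b + 1) / Real.Gamma (a + b + 2)) := by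
  have hB := ProbabilityTheory.beta_pos (α := b + 1) (β := a + 1) (by linarith) (by linarith)
  have h := ProbabilityTheory.lintegral_betaPDF_eq_one (α := b + 1) (β := a + 1)
    (by linarith) (by linarith)
  rw [ProbabilityTheory.lintegral_betaPDF] at h
  have h2 : ∀ t : ℝ, ENNReal.ofReal ((1 - t) ^ a * t ^ b) =
      ENNReal.ofReal (ProbabilityTheory.beta (b + 1) (a + 1)) *
      ENNReal.ofReal (1 / ProbabilityTheory.beta (b + 1) (a + 1) * t ^ (b + 1 - 1) *
        (1 - t) ^ (a + 1 - 1)) := by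
    intro t
    rw [← ENNReal.ofReal_mul hB.le]
    congr 1
    rw [add_sub_cancel_right, add_sub_cancel_right]
    field_simp
  simp_rw [h2]
  rw [lintegral_const_mul _ (by fun_prop), h, mul_one, ProbabilityTheory.beta]
  congr 1
  rw [show b + 1 + (a + 1) = a + b + 2 by ring]
  ring

lemma lintegral_disk_rpow {a b : ℝ} (ha : -1 < a) (hb : -1 < b) :
    ∫⁻ z in disk, ENNReal.ofReal ((1 - ‖z‖ ^ 2) ^ a * (‖z‖ ^ 2) ^ b) =
      ENNReal.ofReal
        (Real.pi * (Real.Gamma (a + 1) * Real.Gamma (b + 1) / Real.Gamma (a + b + 2))) := by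
  rw [lintegral_disk_radial (F := fun t => ENNReal.ofReal ((1 - t) ^ a * t ^ b)) (by fun_prop),
    lintegral_Ioo_rpow_mul_rpow ha hb, ENNReal.ofReal_mul Real.pi_pos.le]

/-! ### Rotation invariance -/

lemma measurePreserving_rot (t : ℝ) :
    MeasurePreserving (fun z : ℂ => Complex.exp (t * Complex.I) • z) volume volume := by
  have := (rotation (Circle.exp t)).measurePreserving
  convert! this using 1

lemma rot_mem_disk {z : ℂ} (t : ℝ) : Complex.exp (t * Complex.I) • z ∈ disk ↔ z ∈ disk := by
  rw [mem_disk, mem_disk, norm_smul, norm_rot, one_mul]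

lemma rotationInvariant_restrict_disk : RotationInvariant (volume.restrict disk) := by
  intro t
  have := (measurePreserving_rot t).restrict_preimage measurableSet_disk
  convert! this using 2
  ext z
  exact (rot_mem_disk t).symm

lemma RotationInvariant.withDensity {E : Type*} [NormedAddCommGroup E] [NormedSpace ℂ E]
    [MeasurableSpace E] [BorelSpace E] [SecondCountableTopology E] {μ : Measure E}
    (hμ : RotationInvariant μ) {K : E → ℝ≥0∞} (hK : Measurable K)
    (hrot : ∀ (t : ℝ) z, K (Complex.exp (t * Complex.I) • z) = K z) :
    RotationInvariant (μ.withDensity K) := by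
  intro t
  have hm : Measurable fun z : E => Complex.exp (t * Complex.I) • z :=
    (continuous_const_smul _).measurable
  refine ⟨hm, ?_⟩
  ext s hs
  rw [Measure.map_apply hm hs, withDensity_apply _ (hm hs), withDensity_apply _ hs,
    ← lintegral_indicator (hm hs), ← lintegral_indicator hs,
    ← (hμ t).lintegral_comp (hK.indicator hs)]
  refine lintegral_congr fun z => ?_
  by_cases hz : Complex.exp (t * Complex.I) • z ∈ s
  · rw [Set.indicator_of_mem (by exact hz), Set.indicator_of_mem hz, hrot]
  · rw [Set.indicator_of_notMem (by exact hz), Set.indicator_of_notMem hz]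

lemma RotationInvariant.prod {μ ν : Measure ℂ} [SFinite μ] [SFinite ν]
    (hμ : RotationInvariant μ) (hν : RotationInvariant ν) : RotationInvariant (μ.prod ν) :=
  fun t => (hμ t).prod (hν t)

/-! ### Möbius transformations of the disk -/

/-- The automorphism `z ↦ (z + a) / (1 + conj a * z)` of the disk. -/
def mobius (a z : ℂ) : ℂ := (z + a) / (1 + (starRingEnd ℂ) a * z)

lemma one_add_conj_mul_ne_zero {a z : ℂ} (ha : ‖a‖ < 1) (hz : ‖z‖ ≤ 1) :
    1 + (starRingEnd ℂ) a * z ≠ 0 := by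
  intro h
  have h1 : ‖(starRingEnd ℂ) a * z‖ = 1 := by
    rw [show (starRingEnd ℂ) a * z = -1 by linear_combination h]; simp
  rw [norm_mul, RCLike.norm_conj] at h1
  nlinarith [norm_nonneg a, norm_nonneg z]

lemma norm_sq_eq_ofReal (z : ℂ) : ((‖z‖ ^ 2 : ℝ) : ℂ) = z * (starRingEnd ℂ) z := by
  rw [Complex.mul_conj, Complex.normSq_eq_norm_sq]

lemma one_sub_normSq_mobius {a z : ℂ} (ha : ‖a‖ < 1) (hz : ‖z‖ ≤ 1) :
    1 - ‖mobius a z‖ ^ 2 =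
      (1 - ‖a‖ ^ 2) * (1 - ‖z‖ ^ 2) / ‖1 + (starRingEnd ℂ) a * z‖ ^ 2 := by
  have h := one_add_conj_mul_ne_zero ha hz
  have hc : (starRingEnd ℂ) (1 + (starRingEnd ℂ) a * z) ≠ 0 := (map_ne_zero _).2 h
  apply Complex.ofReal_injective
  push_cast [norm_sq_eq_ofReal]
  have e : ∀ w : ℂ, ((‖w‖ : ℝ) : ℂ) ^ 2 = w * (starRingEnd ℂ) w := fun w => by
    rw [← norm_sq_eq_ofReal]; push_cast; rfl
  simp only [e, mobius]
  simp only [map_div₀, map_add, map_mul, Complex.conj_conj, map_one] at hc ⊢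
  -- The denominator and its conjugate become independent atoms, so that `field_simp` can clear
  -- them; they are expanded again for `ring`.
  generalize hd : 1 + (starRingEnd ℂ) a * z = d at *
  generalize hd' : 1 + a * (starRingEnd ℂ) z = d' at *
  field_simp
  rw [← hd, ← hd']
  ring

lemma mobius_mem_disk {a z : ℂ} (ha : a ∈ disk) (hz : z ∈ disk) : mobius a z ∈ disk := by
  rw [mem_disk] at *
  have h := one_sub_normSq_mobius ha hz.le
  have : 0 < 1 - ‖mobius a z‖ ^ 2 := by
    rw [h]
    have := one_add_conj_mul_ne_zero ha hz.le
    have h1 : 0 < 1 - ‖a‖ ^ 2 := by nlinarith [norm_nonneg a]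
    have h2 : 0 < 1 - ‖z‖ ^ 2 := by nlinarith [norm_nonneg z]
    positivity
  by_contra! hcon
  nlinarith

lemma mobius_neg_mobius {a z : ℂ} (ha : a ∈ disk) (hz : z ∈ disk) :
    mobius (-a) (mobius a z) = z := by
  have h := one_add_conj_mul_ne_zero (mem_disk.1 ha) (mem_disk.1 hz).le
  have h2 := one_add_conj_mul_ne_zero (a := a) (z := -a) (mem_disk.1 ha)
    (by simpa using (mem_disk.1 ha).le)
  have h2' : 1 - (starRingEnd ℂ) a * a ≠ 0 := by
    intro e; apply h2; linear_combination e
  have h3 : 1 + (starRingEnd ℂ) (-a) * mobius a z =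
      (1 - (starRingEnd ℂ) a * a) / (1 + (starRingEnd ℂ) a * z) := by
    rw [mobius]
    generalize hd : 1 + (starRingEnd ℂ) a * z = d at *
    field_simp
    rw [← hd, map_neg]
    ring
  rw [mobius, h3, mobius]
  generalize hd : 1 + (starRingEnd ℂ) a * z = d at *
  generalize he : 1 - (starRingEnd ℂ) a * a = e at *
  field_simp
  rw [← hd, ← he]
  ring

lemma mobius_sub_mobius {a z w : ℂ} (ha : ‖a‖ < 1) (hz : ‖z‖ ≤ 1) (hw : ‖w‖ ≤ 1) :
    mobius a z - mobius a w = (1 - ‖a‖ ^ 2 : ℝ) * (z - w) /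
      ((1 + (starRingEnd ℂ) a * z) * (1 + (starRingEnd ℂ) a * w)) := by
  have h := one_add_conj_mul_ne_zero ha hz
  have h' := one_add_conj_mul_ne_zero ha hw
  rw [mobius, mobius, Complex.ofReal_sub, norm_sq_eq_ofReal]
  generalize hd : 1 + (starRingEnd ℂ) a * z = d at *
  generalize hd' : 1 + (starRingEnd ℂ) a * w = d' at *
  field_simp
  rw [← hd, ← hd']
  push_cast
  ring

lemma one_sub_conj_mobius_mul_mobius {a z w : ℂ} (ha : ‖a‖ < 1) (hz : ‖z‖ ≤ 1) (hw : ‖w‖ ≤ 1) :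
    1 - (starRingEnd ℂ) (mobius a w) * mobius a z =
      (1 - ‖a‖ ^ 2 : ℝ) * (1 - (starRingEnd ℂ) w * z) /
      ((1 + (starRingEnd ℂ) a * z) * (starRingEnd ℂ) (1 + (starRingEnd ℂ) a * w)) := by
  have h := one_add_conj_mul_ne_zero ha hz
  have h' : (starRingEnd ℂ) (1 + (starRingEnd ℂ) a * w) ≠ 0 :=
    (map_ne_zero _).2 (one_add_conj_mul_ne_zero ha hw)
  rw [mobius, mobius, Complex.ofReal_sub, norm_sq_eq_ofReal]
  simp only [map_div₀, map_add, map_mul, Complex.conj_conj, map_one] at h' ⊢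
  generalize hd : 1 + (starRingEnd ℂ) a * z = d at *
  generalize hd' : 1 + a * (starRingEnd ℂ) w = d' at *
  field_simp
  rw [← hd, ← hd']
  push_cast
  ring

lemma hasDerivAt_mobius {a z : ℂ} (ha : ‖a‖ < 1) (hz : ‖z‖ ≤ 1) :
    HasDerivAt (mobius a) ((1 - ‖a‖ ^ 2 : ℝ) / (1 + (starRingEnd ℂ) a * z) ^ 2) z := by
  have h := one_add_conj_mul_ne_zero ha hz
  have h1 : HasDerivAt (fun z : ℂ => z + a) 1 z := (hasDerivAt_id z).add_const a
  have h2 : HasDerivAt (fun z : ℂ => 1 + (starRingEnd ℂ) a * z) ((starRingEnd ℂ) a) z := by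
    simpa using ((hasDerivAt_id z).const_mul ((starRingEnd ℂ) a)).const_add 1
  convert! h1.div h2 h using 1
  rw [Complex.ofReal_sub, norm_sq_eq_ofReal]
  push_cast
  ring

lemma mobius_image_disk {a : ℂ} (ha : a ∈ disk) : mobius a '' disk = disk := by
  have hna : -a ∈ disk := by rw [mem_disk] at *; simpa using ha
  ext z
  constructor
  · rintro ⟨w, hw, rfl⟩; exact mobius_mem_disk ha hw
  · intro hz
    exact ⟨mobius (-a) z, mobius_mem_disk hna hz, by simpa using mobius_neg_mobius hna hz⟩

/-- The determinant of multiplication by `c` over `ℝ` is the algebra norm of `c`. -/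
lemma abs_det_smulRight_restrictScalars (c : ℂ) :
    |((ContinuousLinearMap.toSpanSingleton ℂ c).restrictScalars ℝ : ℂ →L[ℝ] ℂ).det| = ‖c‖ ^ 2 := by
  have h : (((ContinuousLinearMap.toSpanSingleton ℂ c).restrictScalars ℝ : ℂ →L[ℝ] ℂ) :
      ℂ →ₗ[ℝ] ℂ) = Algebra.lmul ℝ ℂ c := by
    ext
    simp [mul_comm]
  rw [ContinuousLinearMap.det, h, ← Algebra.norm_apply, Algebra.norm_complex_eq]
  simp [Complex.normSq_eq_norm_sq]

lemma lintegral_disk_mobius {a : ℂ} (ha : a ∈ disk) (F : ℂ → ℝ≥0∞) :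
    ∫⁻ z in disk, F z = ∫⁻ z in disk,
      ENNReal.ofReal ((1 - ‖a‖ ^ 2) ^ 2 / ‖1 + (starRingEnd ℂ) a * z‖ ^ 4) * F (mobius a z) := by
  have hinj : Set.InjOn (mobius a) disk := fun z hz w hw h => by
    rw [← mobius_neg_mobius ha hz, h, mobius_neg_mobius ha hw]
  have := lintegral_image_eq_lintegral_abs_det_fderiv_mul volume measurableSet_disk
    (f := mobius a) (fun z hz => ((hasDerivAt_mobius (mem_disk.1 ha)
      (mem_disk.1 hz).le).hasFDerivAt.restrictScalars ℝ).hasFDerivWithinAt) hinj F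
  rw [mobius_image_disk ha] at this
  rw [this]
  refine lintegral_congr fun z => ?_
  rw [abs_det_smulRight_restrictScalars, norm_div, Complex.norm_real, norm_pow, div_pow,
    Real.norm_eq_abs, sq_abs, ← pow_mul]

/-! ### The hypergeometric series -/

lemma poch_zero (x : ℝ) : poch x 0 = 1 := by simp [poch]

lemma poch_succ (x : ℝ) (n : ℕ) : poch x (n + 1) = poch x n * (x + n) := by
  simp [poch, ascPochhammer_succ_eval]

lemma poch_succ_left (x : ℝ) (n : ℕ) : poch x (n + 1) = x * poch (x + 1) n := by
  induction n with
  | zero => simp [poch_succ, poch_zero]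
  | succ n ih => rw [poch_succ, ih, poch_succ]; push_cast; ring

lemma poch_pos {x : ℝ} (hx : 0 < x) (n : ℕ) : 0 < poch x n := ascPochhammer_pos n x hx

lemma Gamma_add_nat {x : ℝ} (hx : 0 < x) (n : ℕ) :
    Real.Gamma (x + n) = poch x n * Real.Gamma x := by
  induction n with
  | zero => simp [poch_zero]
  | succ n ih =>
    have : x + n ≠ 0 := by positivity
    rw [Nat.cast_succ, ← add_assoc, Real.Gamma_add_one this, ih, poch_succ]
    ring

/-- The term ratio is stated without division because terms may vanish when `A` is a nonpositive
integer. -/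
lemma hyp32Term_succ {a A b₁ b₂ : ℝ} (h₁ : 0 < b₁) (h₂ : 0 < b₂) (n : ℕ) :
    hyp32Term a A A b₁ b₂ 1 (n + 1) * ((b₁ + n) * (b₂ + n) * (n + 1)) =
      hyp32Term a A A b₁ b₂ 1 n * ((a + n) * (A + n) ^ 2) := by
  have := (poch_pos h₁ n).ne'
  have := (poch_pos h₂ n).ne'
  have : b₁ + n ≠ 0 := by positivity
  have : b₂ + n ≠ 0 := by positivity
  have : ((n.factorial : ℕ) : ℝ) ≠ 0 := by positivity
  simp only [hyp32Term, poch_succ, one_pow, Nat.factorial_succ]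
  push_cast
  field_simp

/-- The sign of `A` is unrestricted: its Pochhammer symbol enters squared. -/
lemma hyp32Term_nonneg {a A b₁ b₂ : ℝ} (ha : 0 < a) (h₁ : 0 < b₁) (h₂ : 0 < b₂) (n : ℕ) :
    0 ≤ hyp32Term a A A b₁ b₂ 1 n := by
  have := poch_pos ha n
  have := poch_pos h₁ n
  have := poch_pos h₂ n
  rw [hyp32Term, mul_assoc (poch a n), one_pow, mul_one]
  have := mul_self_nonneg (poch A n)
  positivity

lemma eventually_cubic_nonneg {δ : ℝ} (hδ : 0 < δ) (q r c : ℝ) :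
    ∀ᶠ n : ℕ in Filter.atTop, 0 ≤ δ * (n : ℝ) ^ 3 + q * (n : ℝ) ^ 2 + r * n + c := by
  have h : Filter.Tendsto (fun n : ℕ => (n : ℝ)) Filter.atTop Filter.atTop :=
    tendsto_natCast_atTop_atTop
  filter_upwards [h.eventually_ge_atTop 1,
    h.eventually_ge_atTop ((|q| + |r| + |c|) / δ)] with n h1 h2
  rw [div_le_iff₀ hδ] at h2
  set x : ℝ := (n : ℝ)
  have hx2 : 0 ≤ x ^ 2 := by positivity
  have e1 : (|q| + |r| + |c|) * x ^ 2 ≤ δ * x ^ 3 := by nlinarith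
  have e2 : x ≤ x ^ 2 := by nlinarith
  have e3 : 1 ≤ x ^ 2 := by nlinarith
  have e4 : -|q| * x ^ 2 ≤ q * x ^ 2 := by nlinarith [neg_abs_le q]
  have e5 : -|r| * x ^ 2 ≤ r * x := by nlinarith [neg_abs_le r, abs_nonneg r]
  have e6 : -|c| * x ^ 2 ≤ c := by nlinarith [neg_abs_le c, abs_nonneg c]
  nlinarith

/-- Convergence of `₃F₂(a, A, A; b₁, b₂ | 1)` by Raabe's test. -/
lemma summable_hyp32Term {a A b₁ b₂ : ℝ} (ha : 0 < a) (h₁ : 0 < b₁) (h₂ : 0 < b₂)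
    (h : a + 2 * A < b₁ + b₂) : Summable (hyp32Term a A A b₁ b₂ 1) := by
  set T := hyp32Term a A A b₁ b₂ 1 with hT
  have hT0 : ∀ n, 0 ≤ T n := hyp32Term_nonneg ha h₁ h₂
  -- Half of the parametric excess. In the comparison below the quartic terms cancel and the cubic
  -- coefficient is the excess minus `ε`, which is `ε > 0`.
  set ε : ℝ := (b₁ + b₂ - a - 2 * A) / 2 with hε
  have hε0 : 0 < ε := by rw [hε]; linarith
  have hev : ∀ᶠ n : ℕ in Filter.atTop,
      (n : ℝ) * ((a + n) * (A + n) ^ 2) ≤ (n - 1 - ε) * ((b₁ + n) * (b₂ + n) * (n + 1)) := by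
    filter_upwards [eventually_cubic_nonneg hε0
      (b₁ * b₂ - ε * (b₁ + b₂) - 1 - ε - A ^ 2 - 2 * a * A)
      (-ε * b₁ * b₂ - (1 + ε) * (b₁ + b₂) - a * A ^ 2) (-(1 + ε) * b₁ * b₂)] with n hn
    have hb : b₁ + b₂ = 2 * ε + a + 2 * A := by rw [hε]; ring
    have hid : ((n : ℝ) - 1 - ε) * ((b₁ + n) * (b₂ + n) * (n + 1)) -
      (n : ℝ) * ((a + n) * (A + n) ^ 2) =
      (b₁ + b₂ - a - 2 * A - ε) * (n : ℝ) ^ 3 +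
        (b₁ * b₂ - ε * (b₁ + b₂) - 1 - ε - A ^ 2 - 2 * a * A) * (n : ℝ) ^ 2 +
        (-ε * b₁ * b₂ - (1 + ε) * (b₁ + b₂) - a * A ^ 2) * n + (-(1 + ε) * b₁ * b₂) := by ring
    have : b₁ + b₂ - a - 2 * A - ε = ε := by rw [hε]; ring
    rw [this] at hid
    linarith
  obtain ⟨n₀, hn₀⟩ := Filter.eventually_atTop.1 (hev.and (Filter.eventually_ge_atTop 1))
  -- Raabe's inequality in telescoping form; `n₀ ≥ 1` makes the boundary term dropped later
  -- nonnegative.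
  have hstep : ∀ n, n₀ ≤ n → ε * T n ≤ ((n : ℝ) - 1) * T n - ((n + 1 : ℕ) - 1 : ℝ) * T (n + 1) := by
    intro n hn
    have hpos : 0 < (b₁ + n) * (b₂ + n) * ((n : ℝ) + 1) := by positivity
    have e := hyp32Term_succ (a := a) (A := A) h₁ h₂ n
    rw [← hT] at e
    have h3 := mul_le_mul_of_nonneg_left (hn₀ n hn).1 (hT0 n)
    have h4 : (n : ℝ) * T (n + 1) ≤ (n - 1 - ε) * T n := by
      refine le_of_mul_le_mul_right ?_ hpos
      calc (n : ℝ) * T (n + 1) * ((b₁ + n) * (b₂ + n) * ((n : ℝ) + 1))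
          = n * (T n * ((a + n) * (A + n) ^ 2)) := by rw [← e]; ring
        _ ≤ _ := by linarith
    push_cast
    linarith
  rw [← summable_nat_add_iff n₀]
  have hbound : ∀ M, ∑ k ∈ Finset.range M, ε * T (k + n₀) ≤
      ((n₀ : ℝ) - 1) * T n₀ - ((M + n₀ : ℕ) - 1 : ℝ) * T (M + n₀) := by
    intro M
    induction M with
    | zero => simp
    | succ M ih =>
      rw [Finset.sum_range_succ]
      have := hstep (M + n₀) (by omega)
      rw [show M + 1 + n₀ = M + n₀ + 1 by ring]
      linarith
  have := summable_of_sum_range_le (f := fun k => ε * T (k + n₀))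
    (fun k => mul_nonneg hε0.le (hT0 _)) (c := ((n₀ : ℝ) - 1) * T n₀) (fun M => by
      have h1 : (1 : ℝ) ≤ ((M + n₀ : ℕ) : ℝ) := by
        exact_mod_cast (hn₀ (M + n₀) (by omega)).2
      have := mul_nonneg (sub_nonneg.2 h1) (hT0 (M + n₀))
      linarith [hbound M])
  exact (summable_mul_left_iff hε0.ne').1 this

lemma hyp32_pos {a A b₁ b₂ : ℝ} (ha : 0 < a) (h₁ : 0 < b₁) (h₂ : 0 < b₂)
    (h : a + 2 * A < b₁ + b₂) : 0 < hyp32 a A A b₁ b₂ 1 := by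
  have h0 : hyp32Term a A A b₁ b₂ 1 0 = 1 := by simp [hyp32Term, poch_zero]
  exact (summable_hyp32Term ha h₁ h₂ h).tsum_pos (hyp32Term_nonneg ha h₁ h₂) 0
    (by rw [h0]; exact one_pos)

section Params

variable {α β θ ϑ : ℝ}

/-- The excess of the lower over the upper parameters is `β + 1`. -/
lemma summable_sigma (hα : -1 < α) (hβ : -1 < β) (hθ : -1 < θ)
    (hsum : 0 < α + β + 2 * θ + 2 * ϑ + 3) :
    Summable (hyp32Term (θ + 1) (α + θ + ϑ + 2) (α + θ + ϑ + 2)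
      (α + θ + 2) (α + β + 2 * θ + 2 * ϑ + 4) 1) :=
  summable_hyp32Term (by linarith) (by linarith) (by linarith) (by linarith)

lemma sigma_pos (hα : -1 < α) (hβ : -1 < β) (hθ : -1 < θ)
    (hsum : 0 < α + β + 2 * θ + 2 * ϑ + 3) : 0 < sigma α β θ ϑ := by
  have h := hyp32_pos (a := θ + 1) (A := α + θ + ϑ + 2) (b₁ := α + θ + 2)
    (b₂ := α + β + 2 * θ + 2 * ϑ + 4) (by linarith) (by linarith) (by linarith) (by linarith)
  have h1 := Real.Gamma_pos_of_pos (show 0 < α + 2 by linarith)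
  have h2 := Real.Gamma_pos_of_pos (show 0 < θ + 1 by linarith)
  have h3 := Real.Gamma_pos_of_pos (show 0 < α + θ + 2 by linarith)
  have h4 : 0 < β + 1 := by linarith
  rw [sigma, inv_pos]
  positivity

end Params

/-! ### The binomial series -/

lemma norm_choose_neg (A : ℝ) (n : ℕ) :
    ‖Ring.choose (-(A : ℂ)) n‖ = |poch A n| / n.factorial := by
  have h1 : (n.factorial : ℂ) * Ring.multichoose (A : ℂ) n = (poch A n : ℂ) := by
    have := Ring.factorial_nsmul_multichoose_eq_ascPochhammer (A : ℂ) n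
    rw [nsmul_eq_mul] at this
    rw [this, Polynomial.ascPochhammer_smeval_eq_eval, poch]
    rw [← ascPochhammer_map (Complex.ofRealHom), Polynomial.eval_map,
      ← Complex.ofRealHom_eq_coe A, Polynomial.eval₂_at_apply]
    rfl
  have h2 : ‖Ring.choose (-(A : ℂ)) n‖ = ‖Ring.multichoose (A : ℂ) n‖ := by
    rw [Ring.choose_neg']
    rcases Int.units_eq_one_or (Int.negOnePow n) with h | h <;> simp [h]
  have h3 := congrArg norm h1
  rw [norm_mul, Complex.norm_real, Complex.norm_natCast, Real.norm_eq_abs] at h3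
  rw [h2, ← h3]
  field_simp

lemma hasSum_one_add_cpow (a : ℂ) {x : ℂ} (hx : ‖x‖ < 1) :
    HasSum (fun n => Ring.choose a n * x ^ n) ((1 + x) ^ a) := by
  have := (Complex.one_add_cpow_hasFPowerSeriesOnBall_zero (a := a)).hasSum (y := x) (by
    simpa [Metric.mem_eball, edist_zero_right, enorm_eq_nnnorm, ← NNReal.coe_lt_coe] using hx)
  rw [zero_add] at this
  refine this.congr_fun fun n => ?_
  rw [binomialSeries_apply, List.ofFn_const, List.prod_replicate, smul_eq_mul]

/-! ### The weighted measure on the bidisk -/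

/-- The density of the weighted measure on the bidisk. -/
def wtd (α β θ ϑ : ℝ) (z : ℂ × ℂ) : ℝ≥0∞ :=
  ENNReal.ofReal ((α + 1) * (1 - ‖z.1‖ ^ 2) ^ α / Real.pi) *
    ENNReal.ofReal ((β + 1) * (1 - ‖z.2‖ ^ 2) ^ β / Real.pi) *
    ENNReal.ofReal (bidiskWeight θ ϑ z)

/-- Lebesgue measure on the bidisk. -/
def bvol : Measure (ℂ × ℂ) := (volume.restrict disk).prod (volume.restrict disk)

instance : SFinite bvol := by unfold bvol; infer_instance

/-- The measure that defines the norm on the bidisk. -/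
def bmeas (α β θ ϑ : ℝ) : Measure (ℂ × ℂ) := bvol.withDensity (wtd α β θ ϑ)

lemma measurable_bidiskWeight (θ ϑ : ℝ) : Measurable (bidiskWeight θ ϑ) := by
  unfold bidiskWeight
  have h1 : Measurable fun z : ℂ × ℂ => ‖1 - (starRingEnd ℂ) z.2 * z.1‖ :=
    (by fun_prop : Continuous fun z : ℂ × ℂ => ‖1 - (starRingEnd ℂ) z.2 * z.1‖).measurable
  have h2 : Measurable fun z : ℂ × ℂ => ‖z.1 - z.2‖ := by fun_prop
  exact (h1.pow_const _).mul (h2.pow_const _)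

lemma measurable_diskDensity (a : ℝ) :
    Measurable fun z : ℂ => ENNReal.ofReal ((a + 1) * (1 - ‖z‖ ^ 2) ^ a / Real.pi) := by
  fun_prop

lemma measurable_wtd (α β θ ϑ : ℝ) : Measurable (wtd α β θ ϑ) :=
  (((measurable_diskDensity α).comp measurable_fst).mul
    ((measurable_diskDensity β).comp measurable_snd)).mul
    (measurable_bidiskWeight θ ϑ).ennreal_ofReal

instance (α β θ ϑ : ℝ) : SFinite (bmeas α β θ ϑ) := by unfold bmeas; infer_instance

instance (a : ℝ) : SFinite (diskMeasure a) := by unfold diskMeasure; infer_instance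

lemma diskMeasure_prod_withDensity (α β θ ϑ : ℝ) :
    ((diskMeasure α).prod (diskMeasure β)).withDensity
      (fun z => ENNReal.ofReal (bidiskWeight θ ϑ z)) = bmeas α β θ ϑ := by
  rw [diskMeasure, diskMeasure, prod_withDensity (measurable_diskDensity α)
    (measurable_diskDensity β), bmeas, bvol, ← withDensity_mul]
  · rfl
  · exact ((measurable_diskDensity α).comp measurable_fst).mul
      ((measurable_diskDensity β).comp measurable_snd)
  · exact (measurable_bidiskWeight θ ϑ).ennreal_ofReal

lemma measurableSet_bidisk : MeasurableSet bidisk := measurableSet_disk.prod measurableSet_disk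

lemma ae_bvol_mem_bidisk : ∀ᵐ z ∂bvol, z ∈ bidisk := by
  rw [bvol, Measure.prod_restrict]
  exact ae_restrict_mem measurableSet_bidisk

lemma bmeas_absolutelyContinuous (α β θ ϑ : ℝ) : bmeas α β θ ϑ ≪ bvol :=
  withDensity_absolutelyContinuous _ _

lemma ae_bmeas_mem_bidisk (α β θ ϑ : ℝ) : ∀ᵐ z ∂bmeas α β θ ϑ, z ∈ bidisk :=
  (bmeas_absolutelyContinuous α β θ ϑ).ae_le ae_bvol_mem_bidisk

lemma rotationInvariant_diskMeasure (a : ℝ) : RotationInvariant (diskMeasure a) :=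
  rotationInvariant_restrict_disk.withDensity (measurable_diskDensity a) fun t z => by
    rw [norm_smul, norm_rot, one_mul]

/-- Both variables turn by the same angle, so `conj z₂ * z₁` and `|z₁ - z₂|` do not change. -/
lemma rotationInvariant_bmeas (α β θ ϑ : ℝ) : RotationInvariant (bmeas α β θ ϑ) := by
  refine (rotationInvariant_restrict_disk.prod rotationInvariant_restrict_disk).withDensity
    (measurable_wtd α β θ ϑ) fun t z => ?_
  have h1 : (starRingEnd ℂ) (Complex.exp (t * Complex.I) • z.2) * (Complex.exp (t * Complex.I) • z.1)
      = (starRingEnd ℂ) z.2 * z.1 := by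
    have := norm_sq_eq_ofReal (Complex.exp (t * Complex.I))
    rw [norm_rot] at this
    simp only [smul_eq_mul, map_mul]
    push_cast at this
    linear_combination (-(starRingEnd ℂ) z.2 * z.1) * this
  simp only [wtd, bidiskWeight, Prod.smul_fst, Prod.smul_snd, h1]
  rw [← smul_sub, norm_smul, norm_smul, norm_smul, norm_rot, one_mul, one_mul, one_mul]

lemma lintegral_diskMeasure_pow {a : ℝ} (ha : -1 < a) (n : ℕ) :
    ∫⁻ z, ENNReal.ofReal (‖z ^ n‖ ^ 2) ∂diskMeasure a =
      ENNReal.ofReal (n.factorial / poch (a + 2) n) := by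
  rw [diskMeasure, lintegral_withDensity_eq_lintegral_mul _ (measurable_diskDensity a)
    (by fun_prop)]
  have h1 : ∀ z ∈ disk, ((fun z : ℂ => ENNReal.ofReal ((a + 1) * (1 - ‖z‖ ^ 2) ^ a / Real.pi)) *
      (fun z : ℂ => ENNReal.ofReal (‖z ^ n‖ ^ 2)) : ℂ → ℝ≥0∞) z =
      ENNReal.ofReal ((a + 1) / Real.pi) *
        ENNReal.ofReal ((1 - ‖z‖ ^ 2) ^ a * (‖z‖ ^ 2) ^ (n : ℝ)) := by
    intro z hz
    have hz := mem_disk.1 hz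
    have : 0 ≤ (1 - ‖z‖ ^ 2) ^ a := Real.rpow_nonneg (by nlinarith [norm_nonneg z]) _
    have : 0 ≤ a + 1 := by linarith
    rw [Pi.mul_apply, ← ENNReal.ofReal_mul (by positivity), ← ENNReal.ofReal_mul (by positivity),
      Real.rpow_natCast, norm_pow]
    congr 1
    rw [← pow_mul, ← pow_mul, mul_comm n 2]
    ring
  have hn : -1 < (n : ℝ) := by have : (0 : ℝ) ≤ n := n.cast_nonneg; linarith
  have ha1 : 0 < a + 1 := by linarith
  have ha2 : 0 < a + 2 := by linarith
  rw [setLIntegral_congr_fun measurableSet_disk h1, lintegral_const_mul _ (by fun_prop),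
    lintegral_disk_rpow ha hn, ← ENNReal.ofReal_mul (by positivity)]
  congr 1
  have hp := Real.pi_pos.ne'
  have hg := (Real.Gamma_pos_of_pos ha1).ne'
  have hpo := (poch_pos ha2 n).ne'
  rw [show a + n + 2 = a + 2 + n by ring, Gamma_add_nat ha2, Real.Gamma_nat_eq_factorial,
    show a + 2 = a + 1 + 1 by ring, Real.Gamma_add_one ha1.ne'] at *
  field_simp

/-! ### The total mass of the weighted measure -/

/-- Exponent bookkeeping for `wtd_mobius`, with `x = 1 - |a|²`, `y = 1 - |w|²`, `d = |1 + conj a *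
w|` and `ρ = |w|`. -/
lemma rpow_weight_identity {x y d ρ : ℝ} (hx : 0 < x) (hy : 0 < y) (hd : 0 < d) (hρ : 0 ≤ ρ)
    (α β θ ϑ : ℝ) :
    x ^ 2 / d ^ 4 * ((x * y / d ^ 2) ^ α * x ^ β * ((x / d) ^ (2 * ϑ) * (x * ρ / d) ^ (2 * θ))) =
      x ^ (α + β + 2 * θ + 2 * ϑ + 2) * (y ^ α * (ρ ^ 2) ^ θ * (d ^ (-(α + θ + ϑ + 2))) ^ 2) := by
  have e1 : (x * y / d ^ 2) ^ α = x ^ α * y ^ α * d ^ (-(2 * α)) := by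
    rw [Real.div_rpow (by positivity) (by positivity), Real.mul_rpow hx.le hy.le,
      ← Real.rpow_natCast d 2, ← Real.rpow_mul hd.le, Real.rpow_neg hd.le, div_eq_mul_inv]
    norm_num
  have e2 : (x / d) ^ (2 * ϑ) = x ^ (2 * ϑ) * d ^ (-(2 * ϑ)) := by
    rw [Real.div_rpow hx.le hd.le, Real.rpow_neg hd.le, div_eq_mul_inv]
  have e3 : (x * ρ / d) ^ (2 * θ) = x ^ (2 * θ) * (ρ ^ 2) ^ θ * d ^ (-(2 * θ)) := by
    rw [Real.div_rpow (by positivity) hd.le, Real.mul_rpow hx.le hρ, Real.rpow_neg hd.le,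
      div_eq_mul_inv, ← Real.rpow_natCast ρ 2, ← Real.rpow_mul hρ]
    norm_num
  have e4 : x ^ (α + β + 2 * θ + 2 * ϑ + 2) =
      x ^ α * x ^ β * x ^ (2 * θ) * x ^ (2 * ϑ) * x ^ 2 := by
    rw [Real.rpow_add hx, Real.rpow_add hx, Real.rpow_add hx, Real.rpow_add hx]
    norm_num
  have e5 : (d ^ (-(α + θ + ϑ + 2))) ^ 2 =
      d ^ (-(2 * α)) * d ^ (-(2 * θ)) * d ^ (-(2 * ϑ)) / d ^ 4 := by
    rw [← Real.rpow_natCast _ 2, ← Real.rpow_mul hd.le, ← Real.rpow_natCast d 4,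
      ← Real.rpow_add hd, ← Real.rpow_add hd, ← Real.rpow_sub hd]
    congr 1
    push_cast
    ring
  rw [e1, e2, e3, e4, e5]
  ring

lemma one_sub_normSq_pos {z : ℂ} (hz : z ∈ disk) : 0 < 1 - ‖z‖ ^ 2 := by
  have := mem_disk.1 hz
  nlinarith [norm_nonneg z]

/-- With the second variable fixed at `a`, the substitution `z₁ = mobius a w` turns the singular
factor `|z₁ - a|` into a multiple of `|w| / |1 + conj a * w|`. What remains is a radial weight times
the squared modulus of a holomorphic power. -/
lemma wtd_mobius {α β : ℝ} (hα : -1 < α) (hβ : -1 < β) (θ ϑ : ℝ) {a w : ℂ} (ha : a ∈ disk)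
    (hw : w ∈ disk) :
    ENNReal.ofReal ((1 - ‖a‖ ^ 2) ^ 2 / ‖1 + (starRingEnd ℂ) a * w‖ ^ 4) *
        wtd α β θ ϑ (mobius a w, a) =
      ENNReal.ofReal ((α + 1) * (β + 1) / Real.pi ^ 2 *
          (1 - ‖a‖ ^ 2) ^ (α + β + 2 * θ + 2 * ϑ + 2)) *
        (ENNReal.ofReal ((1 - ‖w‖ ^ 2) ^ α * (‖w‖ ^ 2) ^ θ) *
          ENNReal.ofReal (‖(1 + (starRingEnd ℂ) a * w) ^ (-((α + θ + ϑ + 2 : ℝ) : ℂ))‖ ^ 2)) := by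
  have ha' := mem_disk.1 ha
  have hw' := mem_disk.1 hw
  have hx := one_sub_normSq_pos ha
  have hy := one_sub_normSq_pos hw
  have hd : 0 < ‖1 + (starRingEnd ℂ) a * w‖ := norm_pos_iff.2 (one_add_conj_mul_ne_zero ha' hw'.le)
  -- The point `a` is the image of `0`, so the two-point identities specialise to distances from
  -- `a`.
  have h0 : mobius a 0 = a := by simp [mobius]
  have e1 := one_sub_normSq_mobius ha' hw'.le
  have e2 : ‖mobius a w - a‖ = (1 - ‖a‖ ^ 2) * ‖w‖ / ‖1 + (starRingEnd ℂ) a * w‖ := by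
    have := mobius_sub_mobius ha' hw'.le (w := 0) (by simp)
    rw [h0] at this
    rw [this, norm_div, norm_mul, Complex.norm_real, Real.norm_of_nonneg hx.le]
    simp
  have e3 : ‖1 - (starRingEnd ℂ) a * mobius a w‖ =
      (1 - ‖a‖ ^ 2) / ‖1 + (starRingEnd ℂ) a * w‖ := by
    have := one_sub_conj_mobius_mul_mobius ha' hw'.le (w := 0) (by simp)
    rw [h0] at this
    rw [this, norm_div, norm_mul, Complex.norm_real, Real.norm_of_nonneg hx.le]
    simp
  have e4 : ‖(1 + (starRingEnd ℂ) a * w) ^ (-((α + θ + ϑ + 2 : ℝ) : ℂ))‖ =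
      ‖1 + (starRingEnd ℂ) a * w‖ ^ (-(α + θ + ϑ + 2)) := by
    rw [← Complex.ofReal_neg, Complex.norm_cpow_real]
  have hid := rpow_weight_identity hx hy hd (norm_nonneg w) α β θ ϑ
  have hα1 : 0 < α + 1 := by linarith
  have hβ1 : 0 < β + 1 := by linarith
  simp only [wtd, bidiskWeight]
  rw [e1, e2, e3, e4, ← ENNReal.ofReal_mul (by positivity), ← ENNReal.ofReal_mul (by positivity),
    ← ENNReal.ofReal_mul (by positivity), ← ENNReal.ofReal_mul (by positivity),
    ← ENNReal.ofReal_mul (by positivity)]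
  congr 1
  have hp := Real.pi_pos.ne'
  calc _ = (α + 1) * (β + 1) / Real.pi ^ 2 * (_) := ?_
    _ = _ := by rw [mul_assoc, ← hid]
  ring

/-- The terms of the binomial series in `conj a * w` are orthogonal for the radial weight, and each
contributes a beta integral. -/
lemma lintegral_normSq_one_add_cpow {α θ : ℝ} (hα : -1 < α) (hθ : -1 < θ) (A : ℝ) {a : ℂ}
    (ha : a ∈ disk) :
    ∫⁻ w in disk, ENNReal.ofReal ((1 - ‖w‖ ^ 2) ^ α * (‖w‖ ^ 2) ^ θ) *
        ENNReal.ofReal (‖(1 + (starRingEnd ℂ) a * w) ^ (-(A : ℂ))‖ ^ 2) =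
      ∑' n : ℕ, ENNReal.ofReal ((poch A n / n.factorial) ^ 2 *
        (Real.pi * (Real.Gamma (α + 1) * Real.Gamma (θ + n + 1) / Real.Gamma (α + (θ + n) + 2)))) *
        ENNReal.ofReal ((‖a‖ ^ 2) ^ n) := by
  have hKm : Measurable fun w : ℂ => ENNReal.ofReal ((1 - ‖w‖ ^ 2) ^ α * (‖w‖ ^ 2) ^ θ) := by
    fun_prop
  set μ := (volume.restrict disk).withDensity
    fun w : ℂ => ENNReal.ofReal ((1 - ‖w‖ ^ 2) ^ α * (‖w‖ ^ 2) ^ θ) with hμ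
  have hrot : RotationInvariant μ := rotationInvariant_restrict_disk.withDensity hKm
    fun t z => by rw [norm_smul, norm_rot, one_mul]
  have hcm : Measurable fun w : ℂ =>
      ENNReal.ofReal (‖(1 + (starRingEnd ℂ) a * w) ^ (-(A : ℂ))‖ ^ 2) := by fun_prop
  have h1 := lintegral_withDensity_eq_lintegral_mul (volume.restrict disk) hKm hcm
  have hlt : ∀ z ∈ disk, ‖(starRingEnd ℂ) a * z‖ < 1 := by
    intro z hz
    rw [norm_mul, RCLike.norm_conj]
    have := mem_disk.1 ha
    have := mem_disk.1 hz
    nlinarith [norm_nonneg a, norm_nonneg z]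
  have h2 := hrot.lintegral_normSq_eq_tsum measurableSet_disk
    ((withDensity_absolutelyContinuous _ _).ae_le (ae_restrict_mem measurableSet_disk))
    (fun z hz t => (rot_mem_disk t).2 hz)
    (a := fun n z => Ring.choose (-(A : ℂ)) n * ((starRingEnd ℂ) a * z) ^ n)
    (fun n => by fun_prop) (fun n z _ t => by simp only [smul_eq_mul]; ring)
    (f := fun z => (1 + (starRingEnd ℂ) a * z) ^ (-(A : ℂ)))
    (fun z hz => hasSum_one_add_cpow _ (hlt z hz))
  have h3 : ∀ n : ℕ, ∫⁻ z, ENNReal.ofReal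
      (‖Ring.choose (-(A : ℂ)) n * ((starRingEnd ℂ) a * z) ^ n‖ ^ 2) ∂μ =
      ENNReal.ofReal ((poch A n / n.factorial) ^ 2 *
        (Real.pi * (Real.Gamma (α + 1) * Real.Gamma (θ + n + 1) / Real.Gamma (α + (θ + n) + 2)))) *
        ENNReal.ofReal ((‖a‖ ^ 2) ^ n) := by
    intro n
    have hn : (0 : ℝ) ≤ n := n.cast_nonneg
    rw [hμ, lintegral_withDensity_eq_lintegral_mul _ hKm (by fun_prop)]
    have h4 : ∀ᵐ z ∂volume.restrict disk,
        ((fun w : ℂ => ENNReal.ofReal ((1 - ‖w‖ ^ 2) ^ α * (‖w‖ ^ 2) ^ θ)) *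
          (fun z : ℂ => ENNReal.ofReal
            (‖Ring.choose (-(A : ℂ)) n * ((starRingEnd ℂ) a * z) ^ n‖ ^ 2)) : ℂ → ℝ≥0∞) z =
        ENNReal.ofReal ((poch A n / n.factorial) ^ 2 * (‖a‖ ^ 2) ^ n) *
          ENNReal.ofReal ((1 - ‖z‖ ^ 2) ^ α * (‖z‖ ^ 2) ^ (θ + n)) := by
      -- Splitting the real power `θ + n` needs a positive base.
      have hne : ∀ᵐ z ∂volume.restrict disk, z ≠ (0 : ℂ) :=
        ae_restrict_of_ae (by simp [ae_iff])
      filter_upwards [hne, ae_restrict_mem measurableSet_disk] with z hz0 hz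
      have hy := one_sub_normSq_pos hz
      have hzn : 0 < ‖z‖ ^ 2 := by positivity
      rw [Pi.mul_apply, ← ENNReal.ofReal_mul (by positivity), ← ENNReal.ofReal_mul (by positivity),
        Real.rpow_add hzn, Real.rpow_natCast, norm_mul, norm_choose_neg, norm_pow, norm_mul,
        RCLike.norm_conj, mul_pow, div_pow, sq_abs, div_pow]
      congr 1
      ring
    rw [lintegral_congr_ae h4, lintegral_const_mul _ (by fun_prop),
      lintegral_disk_rpow hα (by linarith), ← ENNReal.ofReal_mul (by positivity),
      ← ENNReal.ofReal_mul]
    · congr 1; ring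
    · have := Real.Gamma_pos_of_pos (show 0 < α + 1 by linarith)
      have := Real.Gamma_pos_of_pos (show 0 < θ + n + 1 by linarith)
      have := Real.Gamma_pos_of_pos (show 0 < α + (θ + n) + 2 by linarith)
      positivity
  exact h1.symm.trans (h2.trans (tsum_congr h3))

/-- The total mass of the weighted measure on the bidisk is `1 / σ`. -/
lemma bmeas_univ {α β θ ϑ : ℝ} (hα : -1 < α) (hβ : -1 < β) (hθ : -1 < θ)
    (hsum : 0 < α + β + 2 * θ + 2 * ϑ + 3) :
    bmeas α β θ ϑ Set.univ = ENNReal.ofReal (1 / sigma α β θ ϑ) := by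
  set s := α + β + 2 * θ + 2 * ϑ + 4 with hs
  set A := α + θ + ϑ + 2 with hA
  have hα1 : 0 < α + 1 := by linarith
  have hβ1 : 0 < β + 1 := by linarith
  have hG1 := Real.Gamma_pos_of_pos hα1
  have hs1 : 0 < s - 1 := by linarith
  have hG2 := Real.Gamma_pos_of_pos hs1
  have hG3 := Real.Gamma_pos_of_pos (show 0 < θ + 1 by linarith)
  have hG4 := Real.Gamma_pos_of_pos (show 0 < α + θ + 2 by linarith)
  have hp := Real.pi_pos
  rw [bmeas, withDensity_apply _ MeasurableSet.univ, Measure.restrict_univ, bvol,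
    lintegral_prod_symm _ (measurable_wtd α β θ ϑ).aemeasurable]
  -- The inner integral is a power series in `|a|²` times `(1 - |a|²)^(s - 2)`; integrating it
  -- termwise in `a` gives the `₃F₂` terms.
  have h1 : ∀ a ∈ disk, ∫⁻ z in disk, wtd α β θ ϑ (z, a) =
      ∑' n : ℕ, ENNReal.ofReal ((α + 1) * (β + 1) / Real.pi ^ 2 * ((poch A n / n.factorial) ^ 2 *
        (Real.pi * (Real.Gamma (α + 1) * Real.Gamma (θ + n + 1) /
          Real.Gamma (α + (θ + n) + 2))))) *
        ENNReal.ofReal ((1 - ‖a‖ ^ 2) ^ (s - 2) * (‖a‖ ^ 2) ^ (n : ℝ)) := by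
    intro a ha
    have hx := one_sub_normSq_pos ha
    rw [lintegral_disk_mobius ha, setLIntegral_congr_fun measurableSet_disk
      (fun w hw => wtd_mobius hα hβ θ ϑ ha hw), lintegral_const_mul _ (by fun_prop),
      lintegral_normSq_one_add_cpow hα hθ _ ha, ← ENNReal.tsum_mul_left]
    refine tsum_congr fun n => ?_
    have hn : (0 : ℝ) ≤ n := n.cast_nonneg
    have := Real.Gamma_pos_of_pos (show 0 < θ + n + 1 by linarith)
    have := Real.Gamma_pos_of_pos (show 0 < α + (θ + n) + 2 by linarith)
    rw [← ENNReal.ofReal_mul (by positivity), ← ENNReal.ofReal_mul (by positivity),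
      ← ENNReal.ofReal_mul (by positivity), Real.rpow_natCast,
      show α + β + 2 * θ + 2 * ϑ + 2 = s - 2 by rw [hs]; ring]
    congr 1
    ring
  rw [setLIntegral_congr_fun measurableSet_disk h1, lintegral_tsum (fun n => by fun_prop)]
  have h2 : ∀ n : ℕ, ∫⁻ a in disk, ENNReal.ofReal ((α + 1) * (β + 1) / Real.pi ^ 2 *
        ((poch A n / n.factorial) ^ 2 *
        (Real.pi * (Real.Gamma (α + 1) * Real.Gamma (θ + n + 1) /
          Real.Gamma (α + (θ + n) + 2))))) *
        ENNReal.ofReal ((1 - ‖a‖ ^ 2) ^ (s - 2) * (‖a‖ ^ 2) ^ (n : ℝ)) =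
      ENNReal.ofReal ((β + 1) * Real.Gamma (α + 2) * Real.Gamma (θ + 1) /
        ((s - 1) * Real.Gamma (α + θ + 2)) *
        hyp32Term (θ + 1) A A (α + θ + 2) s 1 n) := by
    intro n
    have hn : (0 : ℝ) ≤ n := n.cast_nonneg
    have := Real.Gamma_pos_of_pos (show 0 < θ + n + 1 by linarith)
    have := Real.Gamma_pos_of_pos (show 0 < α + (θ + n) + 2 by linarith)
    rw [lintegral_const_mul _ (by fun_prop), lintegral_disk_rpow (by linarith) (by linarith),
      ← ENNReal.ofReal_mul (by positivity)]
    congr 1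
    rw [show θ + n + 1 = θ + 1 + n by ring, show α + (θ + n) + 2 = α + θ + 2 + n by ring,
      show s - 2 + n + 2 = s + n by ring, show s - 2 + 1 = s - 1 by ring,
      Gamma_add_nat (by linarith), Gamma_add_nat (by linarith), Gamma_add_nat (by linarith),
      Real.Gamma_nat_eq_factorial, show s = s - 1 + 1 by ring, Real.Gamma_add_one hs1.ne',
      show α + 2 = α + 1 + 1 by ring, Real.Gamma_add_one hα1.ne', hyp32Term, one_pow,
      show s - 1 + 1 = s by ring]
    have p1 := (poch_pos (show 0 < α + θ + 2 by linarith) n).ne'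
    have p2 := (poch_pos (show 0 < s by linarith) n).ne'
    field_simp
  simp_rw [h2]
  rw [← ENNReal.ofReal_tsum_of_nonneg, tsum_mul_left]
  · congr 1
    rw [sigma, one_div, inv_inv, hyp32, show α + β + 2 * θ + 2 * ϑ + 3 = s - 1 by rw [hs]; ring]
  · intro n
    have := hyp32Term_nonneg (a := θ + 1) (A := A) (b₁ := α + θ + 2) (b₂ := s) (by linarith)
      (by linarith) (by linarith) n
    have := Real.Gamma_pos_of_pos (show 0 < α + 2 by linarith)
    positivity
  · exact (summable_sigma hα hβ hθ hsum).mul_left _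

/-! ### Möbius covariance of the weighted measure on the bidisk -/

lemma measurable_mobius (a : ℂ) : Measurable (mobius a) := by
  unfold mobius; fun_prop

/-- A Möbius transformation acting diagonally on the bidisk. -/
def mobiusProd (a : ℂ) (z : ℂ × ℂ) : ℂ × ℂ := (mobius a z.1, mobius a z.2)

lemma measurable_mobiusProd (a : ℂ) : Measurable (mobiusProd a) :=
  ((measurable_mobius a).comp measurable_fst).prodMk ((measurable_mobius a).comp measurable_snd)

/-- The Jacobian of a Möbius transformation. -/
def mobiusJac (a z : ℂ) : ℝ≥0∞ :=
  ENNReal.ofReal ((1 - ‖a‖ ^ 2) ^ 2 / ‖1 + (starRingEnd ℂ) a * z‖ ^ 4)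

lemma measurable_mobiusJac (a : ℂ) : Measurable (mobiusJac a) := by
  unfold mobiusJac; fun_prop

/-- The change of variables is recast as a push-forward, a form that passes to product measures. -/
lemma map_mobius_withDensity {a : ℂ} (ha : a ∈ disk) :
    ((volume.restrict disk).withDensity (mobiusJac a)).map (mobius a) = volume.restrict disk := by
  ext S hS
  rw [Measure.map_apply (measurable_mobius a) hS,
    withDensity_apply _ ((measurable_mobius a) hS), ← lintegral_indicator_one hS,
    lintegral_disk_mobius ha, ← lintegral_indicator ((measurable_mobius a) hS)]
  refine lintegral_congr fun z => ?_
  by_cases hz : mobius a z ∈ S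
  · rw [Set.indicator_of_mem (by exact hz), Set.indicator_of_mem hz, Pi.one_apply, mul_one]
    rfl
  · rw [Set.indicator_of_notMem (by exact hz), Set.indicator_of_notMem hz, mul_zero]

lemma map_mobiusProd_withDensity {a : ℂ} (ha : a ∈ disk) :
    (bvol.withDensity fun z => mobiusJac a z.1 * mobiusJac a z.2).map (mobiusProd a) = bvol := by
  have hsf : SFinite ((volume.restrict disk).withDensity (mobiusJac a)) := inferInstance
  have h := Measure.map_prod_map ((volume.restrict disk).withDensity (mobiusJac a))
    ((volume.restrict disk).withDensity (mobiusJac a)) (measurable_mobius a) (measurable_mobius a)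
  rw [map_mobius_withDensity ha, prod_withDensity (measurable_mobiusJac a)
    (measurable_mobiusJac a)] at h
  exact h.symm

/-- The factor by which a Möbius transformation changes the weighted measure. -/
def mobiusFactor (A B : ℝ) (a : ℂ) (z : ℂ × ℂ) : ℝ :=
  (1 - ‖a‖ ^ 2) ^ (A + B) *
    ((‖1 + (starRingEnd ℂ) a * z.1‖ ^ 2) ^ (-A) * (‖1 + (starRingEnd ℂ) a * z.2‖ ^ 2) ^ (-B))

lemma measurable_mobiusFactor (A B : ℝ) (a : ℂ) : Measurable (mobiusFactor A B a) := by
  unfold mobiusFactor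
  fun_prop

/-- Exponent bookkeeping for `wtd_mobiusProd`: `x = 1 - |a|²`, `yᵢ = 1 - |zᵢ|²`, `dᵢ = |1 + conj a *
zᵢ|`, `u = |1 - conj z₂ * z₁|`, `v = |z₁ - z₂|`. -/
lemma rpow_mobius_identity {x y₁ y₂ d₁ d₂ u v : ℝ} (hx : 0 < x) (hy₁ : 0 < y₁) (hy₂ : 0 < y₂)
    (hd₁ : 0 < d₁) (hd₂ : 0 < d₂) (hu : 0 ≤ u) (hv : 0 ≤ v) (α β θ ϑ : ℝ) :
    x ^ 2 / d₁ ^ 4 * (x ^ 2 / d₂ ^ 4) * ((x * y₁ / d₁ ^ 2) ^ α * (x * y₂ / d₂ ^ 2) ^ β *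
        ((x * u / (d₁ * d₂)) ^ (2 * ϑ) * (x * v / (d₁ * d₂)) ^ (2 * θ))) =
      x ^ (α + θ + ϑ + 2 + (β + θ + ϑ + 2)) * ((d₁ ^ 2) ^ (-(α + θ + ϑ + 2)) *
        (d₂ ^ 2) ^ (-(β + θ + ϑ + 2))) * (y₁ ^ α * y₂ ^ β * (u ^ (2 * ϑ) * v ^ (2 * θ))) := by
  have e1 : ∀ (y d γ : ℝ), 0 < y → 0 < d → (x * y / d ^ 2) ^ γ = x ^ γ * y ^ γ * d ^ (-(2 * γ)) := by
    intro y d γ hy hd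
    rw [Real.div_rpow (by positivity) (by positivity), Real.mul_rpow hx.le hy.le,
      ← Real.rpow_natCast d 2, ← Real.rpow_mul hd.le, Real.rpow_neg hd.le, div_eq_mul_inv]
    norm_num
  have e2 : ∀ (w γ : ℝ), 0 ≤ w → (x * w / (d₁ * d₂)) ^ (2 * γ) =
      x ^ (2 * γ) * w ^ (2 * γ) * (d₁ ^ (-(2 * γ)) * d₂ ^ (-(2 * γ))) := by
    intro w γ hw
    rw [Real.div_rpow (by positivity) (by positivity), Real.mul_rpow hx.le hw,
      Real.mul_rpow hd₁.le hd₂.le, Real.rpow_neg hd₁.le, Real.rpow_neg hd₂.le, div_eq_mul_inv,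
      mul_inv]
  have e3 : ∀ d γ : ℝ, 0 < d → (d ^ 2) ^ (-(γ + θ + ϑ + 2)) =
      d ^ (-(2 * γ)) * d ^ (-(2 * θ)) * d ^ (-(2 * ϑ)) / d ^ 4 := by
    intro d γ hd
    rw [← Real.rpow_natCast d 2, ← Real.rpow_mul hd.le, ← Real.rpow_natCast d 4,
      ← Real.rpow_add hd, ← Real.rpow_add hd, ← Real.rpow_sub hd]
    congr 1
    push_cast
    ring
  have e4 : x ^ (α + θ + ϑ + 2 + (β + θ + ϑ + 2)) =
      x ^ α * x ^ β * x ^ (2 * θ) * x ^ (2 * ϑ) * x ^ 4 := by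
    rw [← Real.rpow_natCast x 4, ← Real.rpow_add hx, ← Real.rpow_add hx, ← Real.rpow_add hx,
      ← Real.rpow_add hx]
    congr 1
    push_cast
    ring
  rw [e1 y₁ d₁ α hy₁ hd₁, e1 y₂ d₂ β hy₂ hd₂, e2 u ϑ hu, e2 v θ hv, e3 d₁ α hd₁, e3 d₂ β hd₂, e4]
  ring

lemma wtd_mobiusProd {α β : ℝ} (hα : -1 < α) (hβ : -1 < β) (θ ϑ : ℝ) {a : ℂ} (ha : a ∈ disk)
    {z : ℂ × ℂ} (hz : z ∈ bidisk) :
    mobiusJac a z.1 * mobiusJac a z.2 * wtd α β θ ϑ (mobiusProd a z) =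
      ENNReal.ofReal (mobiusFactor (α + θ + ϑ + 2) (β + θ + ϑ + 2) a z) * wtd α β θ ϑ z := by
  obtain ⟨z₁, z₂⟩ := z
  obtain ⟨hz₁, hz₂⟩ : z₁ ∈ disk ∧ z₂ ∈ disk := hz
  have ha' := mem_disk.1 ha
  have h1 := mem_disk.1 hz₁
  have h2 := mem_disk.1 hz₂
  have hx := one_sub_normSq_pos ha
  have hy₁ := one_sub_normSq_pos hz₁
  have hy₂ := one_sub_normSq_pos hz₂
  have hd₁ : 0 < ‖1 + (starRingEnd ℂ) a * z₁‖ := norm_pos_iff.2 (one_add_conj_mul_ne_zero ha' h1.le)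
  have hd₂ : 0 < ‖1 + (starRingEnd ℂ) a * z₂‖ := norm_pos_iff.2 (one_add_conj_mul_ne_zero ha' h2.le)
  have hα1 : 0 < α + 1 := by linarith
  have hβ1 : 0 < β + 1 := by linarith
  have hid := rpow_mobius_identity hx hy₁ hy₂ hd₁ hd₂
    (norm_nonneg (1 - (starRingEnd ℂ) z₂ * z₁)) (norm_nonneg (z₁ - z₂)) α β θ ϑ
  have e2 : ‖mobius a z₁ - mobius a z₂‖ = (1 - ‖a‖ ^ 2) * ‖z₁ - z₂‖ /
      (‖1 + (starRingEnd ℂ) a * z₁‖ * ‖1 + (starRingEnd ℂ) a * z₂‖) := by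
    rw [mobius_sub_mobius ha' h1.le h2.le, norm_div, norm_mul, norm_mul, Complex.norm_real,
      Real.norm_of_nonneg hx.le]
  have e3 : ‖1 - (starRingEnd ℂ) (mobius a z₂) * mobius a z₁‖ =
      (1 - ‖a‖ ^ 2) * ‖1 - (starRingEnd ℂ) z₂ * z₁‖ /
      (‖1 + (starRingEnd ℂ) a * z₁‖ * ‖1 + (starRingEnd ℂ) a * z₂‖) := by
    rw [one_sub_conj_mobius_mul_mobius ha' h1.le h2.le, norm_div, norm_mul, norm_mul,
      Complex.norm_real, Real.norm_of_nonneg hx.le, RCLike.norm_conj]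
  simp only [wtd, bidiskWeight, mobiusProd, mobiusJac, mobiusFactor]
  rw [e2, e3, one_sub_normSq_mobius ha' h1.le, one_sub_normSq_mobius ha' h2.le,
    ← ENNReal.ofReal_mul (by positivity), ← ENNReal.ofReal_mul (by positivity),
    ← ENNReal.ofReal_mul (by positivity), ← ENNReal.ofReal_mul (by positivity),
    ← ENNReal.ofReal_mul (by positivity), ← ENNReal.ofReal_mul (by positivity),
    ← ENNReal.ofReal_mul (by positivity)]
  congr 1
  calc _ = (α + 1) * (β + 1) / Real.pi ^ 2 * (_) := ?_
    _ = _ := congrArg _ hid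
    _ = _ := by ring
  ring

/-- The two Jacobians move Lebesgue measure and `wtd_mobiusProd` moves the density. This covariance
is the source of the adjointness of `raise` and `lower`. -/
lemma map_mobiusProd_bmeas {α β : ℝ} (hα : -1 < α) (hβ : -1 < β) (θ ϑ : ℝ) {a : ℂ}
    (ha : a ∈ disk) :
    ((bmeas α β θ ϑ).withDensity fun z =>
        ENNReal.ofReal (mobiusFactor (α + θ + ϑ + 2) (β + θ + ϑ + 2) a z)).map (mobiusProd a) =
      bmeas α β θ ϑ := by
  have hFm := (measurable_mobiusFactor (α + θ + ϑ + 2) (β + θ + ϑ + 2) a).ennreal_ofReal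
  have hJm : Measurable fun z : ℂ × ℂ => mobiusJac a z.1 * mobiusJac a z.2 :=
    ((measurable_mobiusJac a).comp measurable_fst).mul
      ((measurable_mobiusJac a).comp measurable_snd)
  have hwm := measurable_wtd α β θ ϑ
  have hΦ := measurable_mobiusProd a
  ext S hS
  rw [Measure.map_apply hΦ hS, withDensity_apply _ (hΦ hS), ← lintegral_indicator (hΦ hS), bmeas,
    lintegral_withDensity_eq_lintegral_mul _ hwm (hFm.indicator (hΦ hS)),
    withDensity_apply _ hS, ← lintegral_indicator hS]
  conv_rhs => rw [← map_mobiusProd_withDensity ha]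
  rw [lintegral_map (hwm.indicator hS) hΦ]
  refine Eq.trans ?_
    (lintegral_withDensity_eq_lintegral_mul _ hJm ((hwm.indicator hS).comp hΦ)).symm
  refine lintegral_congr_ae ?_
  filter_upwards [ae_bvol_mem_bidisk] with z hz
  simp only [Pi.mul_apply, Function.comp_apply]
  by_cases h : mobiusProd a z ∈ S
  · rw [Set.indicator_of_mem (by exact h), Set.indicator_of_mem h, wtd_mobiusProd hα hβ θ ϑ ha hz,
      mul_comm]
  · rw [Set.indicator_of_notMem (by exact h), Set.indicator_of_notMem h, mul_zero, mul_zero]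

lemma mobiusFactor_nonneg (A B : ℝ) {a : ℂ} (ha : a ∈ disk) (z : ℂ × ℂ) :
    0 ≤ mobiusFactor A B a z := by
  have := (one_sub_normSq_pos ha).le
  unfold mobiusFactor
  positivity

lemma integral_mobiusProd_bmeas {α β : ℝ} (hα : -1 < α) (hβ : -1 < β) (θ ϑ : ℝ) {a : ℂ}
    (ha : a ∈ disk) {F : ℂ × ℂ → ℂ} (hF : Continuous F) :
    ∫ z, F z ∂bmeas α β θ ϑ =
      ∫ z, mobiusFactor (α + θ + ϑ + 2) (β + θ + ϑ + 2) a z • F (mobiusProd a z)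
        ∂bmeas α β θ ϑ := by
  conv_lhs => rw [← map_mobiusProd_bmeas hα hβ θ ϑ ha]
  rw [integral_map (measurable_mobiusProd a).aemeasurable hF.aestronglyMeasurable,
    integral_withDensity_eq_integral_toReal_smul
      (measurable_mobiusFactor _ _ a).ennreal_ofReal (by simp)]
  simp_rw [ENNReal.toReal_ofReal (mobiusFactor_nonneg _ _ ha _)]

open MvPolynomial (pderiv X C)

/-! ### Polynomials in two variables -/

/-- Evaluation of a polynomial in two variables at a point of `ℂ × ℂ`. -/
def evalAt (p : MvPolynomial (Fin 2) ℂ) (z : ℂ × ℂ) : ℂ := MvPolynomial.eval ![z.1, z.2] p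

lemma continuous_evalAt (p : MvPolynomial (Fin 2) ℂ) : Continuous (evalAt p) := by
  unfold evalAt
  refine (MvPolynomial.continuous_eval p).comp (continuous_pi fun i => ?_)
  fin_cases i
  · exact continuous_fst
  · exact continuous_snd

@[simp] lemma evalAt_add (p q : MvPolynomial (Fin 2) ℂ) (z : ℂ × ℂ) :
    evalAt (p + q) z = evalAt p z + evalAt q z := map_add _ _ _

@[simp] lemma evalAt_sub (p q : MvPolynomial (Fin 2) ℂ) (z : ℂ × ℂ) :
    evalAt (p - q) z = evalAt p z - evalAt q z := map_sub _ _ _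

@[simp] lemma evalAt_mul (p q : MvPolynomial (Fin 2) ℂ) (z : ℂ × ℂ) :
    evalAt (p * q) z = evalAt p z * evalAt q z := map_mul _ _ _

@[simp] lemma evalAt_pow (p : MvPolynomial (Fin 2) ℂ) (n : ℕ) (z : ℂ × ℂ) :
    evalAt (p ^ n) z = evalAt p z ^ n := map_pow _ _ _

@[simp] lemma evalAt_C (c : ℂ) (z : ℂ × ℂ) : evalAt (C c) z = c := MvPolynomial.eval_C _

@[simp] lemma evalAt_X_zero (z : ℂ × ℂ) : evalAt (X 0) z = z.1 := by simp [evalAt]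

@[simp] lemma evalAt_X_one (z : ℂ × ℂ) : evalAt (X 1) z = z.2 := by simp [evalAt]

@[simp] lemma evalAt_zero (z : ℂ × ℂ) : evalAt 0 z = 0 := map_zero _

@[simp] lemma evalAt_smul (c : ℂ) (p : MvPolynomial (Fin 2) ℂ) (z : ℂ × ℂ) :
    evalAt (c • p) z = c * evalAt p z := MvPolynomial.smul_eval _ _ _

lemma evalAt_sum {ι : Type*} (s : Finset ι) (p : ι → MvPolynomial (Fin 2) ℂ) (z : ℂ × ℂ) :
    evalAt (∑ i ∈ s, p i) z = ∑ i ∈ s, evalAt (p i) z := map_sum _ _ _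

lemma evalAt_monomial (s : Fin 2 →₀ ℕ) (c : ℂ) (z : ℂ × ℂ) :
    evalAt (MvPolynomial.monomial s c) z = c * (z.1 ^ s 0 * z.2 ^ s 1) := by
  rw [evalAt, MvPolynomial.eval_monomial, Finsupp.prod_fintype _ _ (by simp), Fin.prod_univ_two]
  simp

lemma hasDerivAt_evalAt {u v : ℝ → ℂ} {u' v' : ℂ} {t : ℝ} (hu : HasDerivAt u u' t)
    (hv : HasDerivAt v v' t) (p : MvPolynomial (Fin 2) ℂ) :
    HasDerivAt (fun t => evalAt p (u t, v t))
      (evalAt (pderiv 0 p) (u t, v t) * u' + evalAt (pderiv 1 p) (u t, v t) * v') t := by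
  induction p using MvPolynomial.induction_on with
  | C c => simpa using hasDerivAt_const t c
  | add p q hp hq =>
    simp only [evalAt_add, map_add]
    convert! hp.add hq using 1
    ring
  | mul_X p i hp =>
    fin_cases i
    · simp only [Fin.zero_eta, evalAt_mul, evalAt_X_zero, Derivation.leibniz, smul_eq_mul,
        MvPolynomial.pderiv_X_self, MvPolynomial.pderiv_X_of_ne (show (0 : Fin 2) ≠ 1 by simp),
        evalAt_add, mul_one, mul_zero, evalAt_zero]
      convert! hp.mul hu using 1
      ring
    · simp only [Fin.mk_one, evalAt_mul, evalAt_X_one, Derivation.leibniz, smul_eq_mul,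
        MvPolynomial.pderiv_X_self, MvPolynomial.pderiv_X_of_ne (show (1 : Fin 2) ≠ 0 by simp),
        evalAt_add, mul_one, mul_zero, evalAt_zero]
      convert! hp.mul hv using 1
      ring

lemma evalAt_smul_of_isHomogeneous {p : MvPolynomial (Fin 2) ℂ} {m : ℕ} (hp : p.IsHomogeneous m)
    (c : ℂ) (z : ℂ × ℂ) : evalAt p (c • z) = c ^ m * evalAt p z := by
  rw [p.as_sum, evalAt_sum, evalAt_sum, Finset.mul_sum]
  refine Finset.sum_congr rfl fun s hs => ?_
  have hdeg := hp (MvPolynomial.mem_support_iff.1 hs)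
  rw [Finsupp.weight_apply, Finsupp.sum_fintype _ _ (by simp), Fin.sum_univ_two] at hdeg
  simp only [Pi.one_apply, smul_eq_mul, mul_one] at hdeg
  rw [evalAt_monomial, evalAt_monomial, ← hdeg, pow_add, Prod.smul_fst, Prod.smul_snd,
    smul_eq_mul, smul_eq_mul, mul_pow, mul_pow]
  ring

/-! ### The inner product on polynomials -/

/-- The inner product of two polynomials in the weighted space on the bidisk. -/
def polyInner (μ : Measure (ℂ × ℂ)) (p q : MvPolynomial (Fin 2) ℂ) : ℂ :=
  ∫ z, evalAt p z * (starRingEnd ℂ) (evalAt q z) ∂μ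

lemma isFiniteMeasure_bmeas {α β θ ϑ : ℝ} (hα : -1 < α) (hβ : -1 < β) (hθ : -1 < θ)
    (hsum : 0 < α + β + 2 * θ + 2 * ϑ + 3) : IsFiniteMeasure (bmeas α β θ ϑ) :=
  ⟨by rw [bmeas_univ hα hβ hθ hsum]; exact ENNReal.ofReal_lt_top⟩

lemma bidisk_subset_closedBall : bidisk ⊆ Metric.closedBall (0 : ℂ × ℂ) 1 := by
  rintro z ⟨h1, h2⟩
  rw [mem_closedBall_zero_iff, Prod.norm_def]
  exact max_le (mem_disk.1 h1).le (mem_disk.1 h2).le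

lemma integrable_bmeas_of_continuous {α β θ ϑ : ℝ} [IsFiniteMeasure (bmeas α β θ ϑ)]
    {F : ℂ × ℂ → ℂ} (hF : Continuous F) : Integrable F (bmeas α β θ ϑ) := by
  obtain ⟨M, hM⟩ := (isCompact_closedBall (0 : ℂ × ℂ) 1).exists_bound_of_continuousOn
    hF.continuousOn
  refine Integrable.of_bound hF.aestronglyMeasurable M ?_
  filter_upwards [ae_bmeas_mem_bidisk α β θ ϑ] with z hz
  exact hM z (bidisk_subset_closedBall hz)

lemma continuous_evalAt_mul_conj (p q : MvPolynomial (Fin 2) ℂ) :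
    Continuous fun z => evalAt p z * (starRingEnd ℂ) (evalAt q z) :=
  (continuous_evalAt p).mul (Complex.continuous_conj.comp (continuous_evalAt q))

section Inner

variable {α β θ ϑ : ℝ} [IsFiniteMeasure (bmeas α β θ ϑ)]

lemma polyInner_add_left (p₁ p₂ q : MvPolynomial (Fin 2) ℂ) :
    polyInner (bmeas α β θ ϑ) (p₁ + p₂) q =
      polyInner (bmeas α β θ ϑ) p₁ q + polyInner (bmeas α β θ ϑ) p₂ q := by
  simp only [polyInner, evalAt_add, add_mul]
  exact integral_add (integrable_bmeas_of_continuous (continuous_evalAt_mul_conj _ _))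
    (integrable_bmeas_of_continuous (continuous_evalAt_mul_conj _ _))

lemma polyInner_sub_left (p₁ p₂ q : MvPolynomial (Fin 2) ℂ) :
    polyInner (bmeas α β θ ϑ) (p₁ - p₂) q =
      polyInner (bmeas α β θ ϑ) p₁ q - polyInner (bmeas α β θ ϑ) p₂ q := by
  simp only [polyInner, evalAt_sub, sub_mul]
  exact integral_sub (integrable_bmeas_of_continuous (continuous_evalAt_mul_conj _ _))
    (integrable_bmeas_of_continuous (continuous_evalAt_mul_conj _ _))

omit [IsFiniteMeasure (bmeas α β θ ϑ)] in
lemma polyInner_conj (p q : MvPolynomial (Fin 2) ℂ) :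
    (starRingEnd ℂ) (polyInner (bmeas α β θ ϑ) p q) = polyInner (bmeas α β θ ϑ) q p := by
  rw [polyInner, ← integral_conj, polyInner]
  simp only [map_mul, Complex.conj_conj, mul_comm]

lemma polyInner_sub_right (p q₁ q₂ : MvPolynomial (Fin 2) ℂ) :
    polyInner (bmeas α β θ ϑ) p (q₁ - q₂) =
      polyInner (bmeas α β θ ϑ) p q₁ - polyInner (bmeas α β θ ϑ) p q₂ := by
  rw [← polyInner_conj, polyInner_sub_left, map_sub, polyInner_conj, polyInner_conj]

omit [IsFiniteMeasure (bmeas α β θ ϑ)] in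
lemma polyInner_smul_left (c : ℂ) (p q : MvPolynomial (Fin 2) ℂ) :
    polyInner (bmeas α β θ ϑ) (c • p) q = c * polyInner (bmeas α β θ ϑ) p q := by
  simp only [polyInner, evalAt_smul, mul_assoc]
  exact integral_const_mul _ _

omit [IsFiniteMeasure (bmeas α β θ ϑ)] in
lemma polyInner_smul_right (c : ℂ) (p q : MvPolynomial (Fin 2) ℂ) :
    polyInner (bmeas α β θ ϑ) p (c • q) = (starRingEnd ℂ) c * polyInner (bmeas α β θ ϑ) p q := by
  rw [← polyInner_conj, polyInner_smul_left, map_mul, polyInner_conj]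

omit [IsFiniteMeasure (bmeas α β θ ϑ)] in
/-- Homogeneous polynomials of different degrees are orthogonal. -/
lemma polyInner_eq_zero_of_isHomogeneous {p q : MvPolynomial (Fin 2) ℂ} {m n : ℕ}
    (hp : p.IsHomogeneous m) (hq : q.IsHomogeneous n) (hmn : m ≠ n) :
    polyInner (bmeas α β θ ϑ) p q = 0 := by
  have hne : ((m : ℝ) - n) ≠ 0 := sub_ne_zero.2 (by exact_mod_cast hmn)
  -- Rotation by this angle multiplies the integrand by `-1`, so the inner product equals its own
  -- negative.
  set t : ℝ := Real.pi / (m - n) with ht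
  set e := Complex.exp (t * Complex.I) with he
  have h1 : e ^ m * (starRingEnd ℂ) e ^ n = -1 := by
    have : (starRingEnd ℂ) e = Complex.exp (-(t * Complex.I)) := by
      rw [he, ← Complex.exp_conj]; simp
    rw [this, he, ← Complex.exp_nat_mul, ← Complex.exp_nat_mul, ← Complex.exp_add,
      ← Complex.exp_pi_mul_I]
    congr 1
    have : ((m : ℂ) - n) * t = Real.pi := by
      rw [ht]; push_cast; field_simp [show ((m : ℂ) - n) ≠ 0 by exact_mod_cast hne]
    linear_combination Complex.I * this
  have hmp := rotationInvariant_bmeas α β θ ϑ t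
  have hc := continuous_evalAt_mul_conj p q
  have h2 : ∫ z, evalAt p (e • z) * (starRingEnd ℂ) (evalAt q (e • z)) ∂bmeas α β θ ϑ =
      polyInner (bmeas α β θ ϑ) p q := by
    rw [polyInner]
    conv_rhs => rw [← hmp.map_eq]
    rw [integral_map hmp.measurable.aemeasurable hc.aestronglyMeasurable]
  have h3 : ∀ z : ℂ × ℂ, evalAt p (e • z) * (starRingEnd ℂ) (evalAt q (e • z)) =
      -1 * (evalAt p z * (starRingEnd ℂ) (evalAt q z)) := by
    intro z
    rw [evalAt_smul_of_isHomogeneous hp, evalAt_smul_of_isHomogeneous hq, map_mul, map_pow, ← h1]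
    ring
  simp_rw [h3] at h2
  rw [integral_const_mul] at h2
  have h4 : -1 * polyInner (bmeas α β θ ϑ) p q = polyInner (bmeas α β θ ϑ) p q := h2
  linear_combination (-1 / 2 : ℂ) * h4

end Inner

/-! ### The lowering and raising operators -/

/-- The lowering operator `∂₁ + ∂₂`. -/
def lower : MvPolynomial (Fin 2) ℂ →ₗ[ℂ] MvPolynomial (Fin 2) ℂ :=
  (pderiv 0 : Derivation ℂ (MvPolynomial (Fin 2) ℂ) (MvPolynomial (Fin 2) ℂ)).toLinearMap +
    (pderiv 1 : Derivation ℂ (MvPolynomial (Fin 2) ℂ) (MvPolynomial (Fin 2) ℂ)).toLinearMap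

/-- The raising operator `z₁² ∂₁ + z₂² ∂₂ + A z₁ + B z₂`. -/
def raise (A B : ℝ) : MvPolynomial (Fin 2) ℂ →ₗ[ℂ] MvPolynomial (Fin 2) ℂ :=
  LinearMap.mulLeft ℂ (X 0 ^ 2) ∘ₗ
    (pderiv 0 : Derivation ℂ (MvPolynomial (Fin 2) ℂ) (MvPolynomial (Fin 2) ℂ)).toLinearMap +
  LinearMap.mulLeft ℂ (X 1 ^ 2) ∘ₗ
    (pderiv 1 : Derivation ℂ (MvPolynomial (Fin 2) ℂ) (MvPolynomial (Fin 2) ℂ)).toLinearMap +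
  LinearMap.mulLeft ℂ (C (A : ℂ) * X 0 + C (B : ℂ) * X 1)

lemma lower_apply (p : MvPolynomial (Fin 2) ℂ) : lower p = pderiv 0 p + pderiv 1 p := rfl

lemma raise_apply (A B : ℝ) (p : MvPolynomial (Fin 2) ℂ) :
    raise A B p = X 0 ^ 2 * pderiv 0 p + X 1 ^ 2 * pderiv 1 p +
      (C (A : ℂ) * X 0 + C (B : ℂ) * X 1) * p := rfl

lemma isHomogeneous_lower {p : MvPolynomial (Fin 2) ℂ} {m : ℕ} (hp : p.IsHomogeneous m) :
    (lower p).IsHomogeneous (m - 1) :=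
  hp.pderiv.add hp.pderiv

lemma isHomogeneous_raise (A B : ℝ) {p : MvPolynomial (Fin 2) ℂ} {m : ℕ}
    (hp : p.IsHomogeneous m) : (raise A B p).IsHomogeneous (m + 1) := by
  have h0 : (X 0 : MvPolynomial (Fin 2) ℂ).IsHomogeneous 1 := MvPolynomial.isHomogeneous_X _ _
  have h1 : (X 1 : MvPolynomial (Fin 2) ℂ).IsHomogeneous 1 := MvPolynomial.isHomogeneous_X _ _
  have key : ∀ i : Fin 2, (X i ^ 2 * pderiv i p).IsHomogeneous (m + 1) := by
    intro i
    -- In degree `0` the truncated degree `m - 1` of the derivative would be off by one, but the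
    -- derivative vanishes.
    rcases m with _ | m
    · have : pderiv i p = 0 := by
        rw [← MvPolynomial.totalDegree_zero_iff_isHomogeneous,
          MvPolynomial.totalDegree_eq_zero_iff_eq_C] at hp
        rw [hp, MvPolynomial.pderiv_C]
      rw [this, mul_zero]
      exact MvPolynomial.isHomogeneous_zero _ _ _
    · have := ((MvPolynomial.isHomogeneous_X ℂ i).pow 2).mul (hp.pderiv (i := i))
      convert! this using 1
      omega
  have hl : (C (A : ℂ) * X 0 + C (B : ℂ) * X 1 : MvPolynomial (Fin 2) ℂ).IsHomogeneous 1 :=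
    (h0.C_mul _).add (h1.C_mul _)
  have := hl.mul hp
  rw [add_comm 1 m] at this
  exact ((key 0).add (key 1)).add this

/-! ### Differentiating the Möbius covariance along real parameters -/

lemma hasDerivAt_mobius_param {t : ℝ} {z : ℂ} (ht : |t| < 1) (hz : ‖z‖ ≤ 1) :
    HasDerivAt (fun t : ℝ => mobius t z) ((1 - z ^ 2) / (1 + t * z) ^ 2) t := by
  have h := one_add_conj_mul_ne_zero (a := t) (z := z) (by simpa using ht) hz
  simp only [mobius, Complex.conj_ofReal] at h ⊢
  have h0 : HasDerivAt (fun t : ℝ => (t : ℂ)) 1 t := Complex.ofRealCLM.hasDerivAt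
  have h1 : HasDerivAt (fun t : ℝ => z + (t : ℂ)) 1 t := h0.const_add z
  have h2 : HasDerivAt (fun t : ℝ => 1 + (t : ℂ) * z) z t := by
    simpa using (h0.mul_const z).const_add 1
  convert! h1.div h2 h using 1
  ring

lemma hasDerivAt_weight_param {t : ℝ} {z : ℂ} (ht : |t| < 1) (hz : ‖z‖ ≤ 1) (A : ℝ) :
    HasDerivAt (fun t : ℝ => (‖1 + (t : ℂ) * z‖ ^ 2) ^ (-A))
      ((2 * z.re + 2 * t * ‖z‖ ^ 2) * (-A) * (‖1 + (t : ℂ) * z‖ ^ 2) ^ (-A - 1)) t := by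
  have h := one_add_conj_mul_ne_zero (a := t) (z := z) (by simpa using ht) hz
  rw [Complex.conj_ofReal] at h
  have hN : ∀ t : ℝ, ‖1 + (t : ℂ) * z‖ ^ 2 = 1 + 2 * t * z.re + t ^ 2 * ‖z‖ ^ 2 := by
    intro t
    rw [← Complex.normSq_eq_norm_sq, ← Complex.normSq_eq_norm_sq, Complex.normSq_apply,
      Complex.normSq_apply]
    simp
    ring
  have h1 : HasDerivAt (fun t : ℝ => ‖1 + (t : ℂ) * z‖ ^ 2) (2 * z.re + 2 * t * ‖z‖ ^ 2) t := by
    simp_rw [hN]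
    have e1 := ((hasDerivAt_id t).const_mul 2).mul_const z.re
    have e2 := (hasDerivAt_pow 2 t).mul_const (‖z‖ ^ 2)
    convert! (e1.const_add 1).add e2 using 1
    simp
  exact h1.rpow_const (Or.inl (by positivity))

section Derivative

variable (A B : ℝ) (p q : MvPolynomial (Fin 2) ℂ)

/-- A polynomial composed with a Möbius transformation. -/
def mobiusEval (p : MvPolynomial (Fin 2) ℂ) (t : ℝ) (z : ℂ × ℂ) : ℂ :=
  evalAt p (mobius t z.1, mobius t z.2)

/-- The derivative of `mobiusEval` with respect to the parameter. -/
def mobiusEvalDeriv (p : MvPolynomial (Fin 2) ℂ) (t : ℝ) (z : ℂ × ℂ) : ℂ :=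
  mobiusEval (pderiv 0 p) t z * ((1 - z.1 ^ 2) / (1 + t * z.1) ^ 2) +
    mobiusEval (pderiv 1 p) t z * ((1 - z.2 ^ 2) / (1 + t * z.2) ^ 2)

/-- The weight factor of a Möbius transformation with real parameter. -/
def paramWeight (t : ℝ) (z : ℂ × ℂ) : ℝ :=
  (‖1 + (t : ℂ) * z.1‖ ^ 2) ^ (-A) * (‖1 + (t : ℂ) * z.2‖ ^ 2) ^ (-B)

/-- The derivative of `paramWeight` with respect to the parameter. -/
def paramWeightDeriv (t : ℝ) (z : ℂ × ℂ) : ℝ :=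
  (2 * z.1.re + 2 * t * ‖z.1‖ ^ 2) * (-A) * (‖1 + (t : ℂ) * z.1‖ ^ 2) ^ (-A - 1) *
      (‖1 + (t : ℂ) * z.2‖ ^ 2) ^ (-B) +
    (‖1 + (t : ℂ) * z.1‖ ^ 2) ^ (-A) *
      ((2 * z.2.re + 2 * t * ‖z.2‖ ^ 2) * (-B) * (‖1 + (t : ℂ) * z.2‖ ^ 2) ^ (-B - 1))

/-- The transformed integrand of the inner product. -/
def paramIntegrand (t : ℝ) (z : ℂ × ℂ) : ℂ :=
  (paramWeight A B t z : ℂ) * (mobiusEval p t z * (starRingEnd ℂ) (mobiusEval q t z))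

/-- The derivative of `paramIntegrand` with respect to the parameter. -/
def paramIntegrandDeriv (t : ℝ) (z : ℂ × ℂ) : ℂ :=
  (paramWeightDeriv A B t z : ℂ) * (mobiusEval p t z * (starRingEnd ℂ) (mobiusEval q t z)) +
    (paramWeight A B t z : ℂ) * (mobiusEvalDeriv p t z * (starRingEnd ℂ) (mobiusEval q t z) +
      mobiusEval p t z * (starRingEnd ℂ) (mobiusEvalDeriv q t z))

lemma hasDerivAt_paramIntegrand {t : ℝ} {z : ℂ × ℂ} (ht : |t| < 1)
    (hz : z ∈ Metric.closedBall (0 : ℂ × ℂ) 1) :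
    HasDerivAt (fun t => paramIntegrand A B p q t z) (paramIntegrandDeriv A B p q t z) t := by
  rw [mem_closedBall_zero_iff, Prod.norm_def, max_le_iff] at hz
  have hp := hasDerivAt_evalAt (hasDerivAt_mobius_param ht hz.1) (hasDerivAt_mobius_param ht hz.2) p
  have hq := hasDerivAt_evalAt (hasDerivAt_mobius_param ht hz.1) (hasDerivAt_mobius_param ht hz.2) q
  have hw := (hasDerivAt_weight_param ht hz.1 A).mul (hasDerivAt_weight_param ht hz.2 B)
  exact hw.ofReal_comp.mul (hp.mul hq.star)

/-- Joint continuity on a compact set supplies the uniform bounds for differentiating under the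
integral. The radius `1 / 2` could be any number in `(0, 1)`: it keeps `1 + t z` away from zero on
the closed bidisk. -/
lemma continuousOn_paramIntegrand :
    ContinuousOn (fun x : ℝ × (ℂ × ℂ) => paramIntegrand A B p q x.1 x.2)
      (Metric.closedBall (0 : ℝ) (1 / 2) ×ˢ Metric.closedBall (0 : ℂ × ℂ) 1) ∧
    ContinuousOn (fun x : ℝ × (ℂ × ℂ) => paramIntegrandDeriv A B p q x.1 x.2)
      (Metric.closedBall (0 : ℝ) (1 / 2) ×ˢ Metric.closedBall (0 : ℂ × ℂ) 1) := by
  set K := Metric.closedBall (0 : ℝ) (1 / 2) ×ˢ Metric.closedBall (0 : ℂ × ℂ) 1 with hK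
  have hne : ∀ x ∈ K, (1 + (x.1 : ℂ) * x.2.1 ≠ 0) ∧ (1 + (x.1 : ℂ) * x.2.2 ≠ 0) := by
    rintro ⟨t, z⟩ ⟨ht, hz⟩
    rw [mem_closedBall_zero_iff, Prod.norm_def, max_le_iff] at hz
    rw [mem_closedBall_zero_iff, Real.norm_eq_abs] at ht
    have ht' : ‖(t : ℂ)‖ < 1 := by
      rw [Complex.norm_real, Real.norm_eq_abs]
      dsimp only at ht
      linarith
    have h1 := one_add_conj_mul_ne_zero ht' hz.1
    have h2 := one_add_conj_mul_ne_zero ht' hz.2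
    rw [Complex.conj_ofReal] at h1 h2
    exact ⟨h1, h2⟩
  have c1 : ContinuousOn (fun x : ℝ × (ℂ × ℂ) => mobius x.1 x.2.1) K := by
    simp only [mobius, Complex.conj_ofReal]
    exact ContinuousOn.div (by fun_prop) (by fun_prop) fun x hx => (hne x hx).1
  have c2 : ContinuousOn (fun x : ℝ × (ℂ × ℂ) => mobius x.1 x.2.2) K := by
    simp only [mobius, Complex.conj_ofReal]
    exact ContinuousOn.div (by fun_prop) (by fun_prop) fun x hx => (hne x hx).2
  have ce : ∀ p, ContinuousOn (fun x : ℝ × (ℂ × ℂ) => mobiusEval p x.1 x.2) K := fun p =>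
    (continuous_evalAt p).comp_continuousOn (c1.prodMk c2)
  have ced : ∀ p, ContinuousOn (fun x : ℝ × (ℂ × ℂ) => mobiusEvalDeriv p x.1 x.2) K := fun p =>
    ((ce _).mul (ContinuousOn.div (by fun_prop) (by fun_prop)
      fun x hx => pow_ne_zero 2 (hne x hx).1)).add
    ((ce _).mul (ContinuousOn.div (by fun_prop) (by fun_prop)
      fun x hx => pow_ne_zero 2 (hne x hx).2))
  have cr1 : ∀ γ : ℝ, ContinuousOn
      (fun x : ℝ × (ℂ × ℂ) => (‖1 + (x.1 : ℂ) * x.2.1‖ ^ 2) ^ γ) K := fun γ =>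
    ContinuousOn.rpow_const (by fun_prop) fun x hx => Or.inl (by have := (hne x hx).1; positivity)
  have cr2 : ∀ γ : ℝ, ContinuousOn
      (fun x : ℝ × (ℂ × ℂ) => (‖1 + (x.1 : ℂ) * x.2.2‖ ^ 2) ^ γ) K := fun γ =>
    ContinuousOn.rpow_const (by fun_prop) fun x hx => Or.inl (by have := (hne x hx).2; positivity)
  have cw : ContinuousOn (fun x : ℝ × (ℂ × ℂ) => ((paramWeight A B x.1 x.2 : ℝ) : ℂ)) K :=
    Complex.continuous_ofReal.comp_continuousOn ((cr1 _).mul (cr2 _))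
  have cre1 : Continuous fun x : ℝ × (ℂ × ℂ) => 2 * x.2.1.re + 2 * x.1 * ‖x.2.1‖ ^ 2 :=
    by fun_prop
  have cre2 : Continuous fun x : ℝ × (ℂ × ℂ) => 2 * x.2.2.re + 2 * x.1 * ‖x.2.2‖ ^ 2 :=
    by fun_prop
  have cwd : ContinuousOn (fun x : ℝ × (ℂ × ℂ) => ((paramWeightDeriv A B x.1 x.2 : ℝ) : ℂ)) K :=
    Complex.continuous_ofReal.comp_continuousOn
      ((((cre1.continuousOn.mul continuousOn_const).mul (cr1 _)).mul (cr2 _)).add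
        ((cr1 _).mul ((cre2.continuousOn.mul continuousOn_const).mul (cr2 _))))
  have cc : ∀ {g : ℝ × (ℂ × ℂ) → ℂ}, ContinuousOn g K →
      ContinuousOn (fun x => (starRingEnd ℂ) (g x)) K := fun hg =>
    Complex.continuous_conj.comp_continuousOn hg
  exact ⟨cw.mul ((ce p).mul (cc (ce q))), (cwd.mul ((ce p).mul (cc (ce q)))).add
    (cw.mul (((ced p).mul (cc (ce q))).add ((ce p).mul (cc (ced q)))))⟩

variable {A B}

/-- The scalar part of the covariance factor is moved to the right, where the only dependence on `t`
is through `1 - t²`. -/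
lemma integral_paramIntegrand {α β θ ϑ : ℝ} (hα : -1 < α) (hβ : -1 < β) {t : ℝ} (ht : |t| < 1) :
    ∫ z, paramIntegrand (α + θ + ϑ + 2) (β + θ + ϑ + 2) p q t z ∂bmeas α β θ ϑ =
      (((1 - t ^ 2) ^ (-(α + θ + ϑ + 2 + (β + θ + ϑ + 2))) : ℝ) : ℂ) *
        polyInner (bmeas α β θ ϑ) p q := by
  have ht' : (t : ℂ) ∈ disk := by rw [mem_disk]; simpa using ht
  have hpos : 0 < 1 - t ^ 2 := by
    have := one_sub_normSq_pos ht'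
    simpa using this
  rw [polyInner, integral_mobiusProd_bmeas hα hβ θ ϑ ht' (continuous_evalAt_mul_conj p q),
    ← integral_const_mul]
  congr 1
  ext z
  rw [mobiusFactor, Complex.norm_real, Real.norm_eq_abs, sq_abs, Complex.conj_ofReal,
    Complex.real_smul, Complex.ofReal_mul, mul_assoc, ← mul_assoc, ← Complex.ofReal_mul,
    ← Real.rpow_add hpos, neg_add_cancel, Real.rpow_zero, Complex.ofReal_one, one_mul]
  rfl

/-- A power of `1 - t²` has derivative zero at `t = 0`, so differentiating `integral_paramIntegrand`
there gives zero. -/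
lemma integral_paramIntegrandDeriv_zero {α β θ ϑ : ℝ} (hα : -1 < α) (hβ : -1 < β)
    [IsFiniteMeasure (bmeas α β θ ϑ)] :
    ∫ z, paramIntegrandDeriv (α + θ + ϑ + 2) (β + θ + ϑ + 2) p q 0 z ∂bmeas α β θ ϑ = 0 := by
  set A := α + θ + ϑ + 2
  set B := β + θ + ϑ + 2
  obtain ⟨hc, hc'⟩ := continuousOn_paramIntegrand A B p q
  have hK : IsCompact (Metric.closedBall (0 : ℝ) (1 / 2) ×ˢ Metric.closedBall (0 : ℂ × ℂ) 1) :=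
    (isCompact_closedBall _ _).prod (isCompact_closedBall _ _)
  obtain ⟨M, hM⟩ := hK.exists_bound_of_continuousOn hc
  obtain ⟨M', hM'⟩ := hK.exists_bound_of_continuousOn hc'
  have hmeas : ∀ {F : ℝ × (ℂ × ℂ) → ℂ}, ContinuousOn F
      (Metric.closedBall (0 : ℝ) (1 / 2) ×ˢ Metric.closedBall (0 : ℂ × ℂ) 1) →
      ∀ t ∈ Metric.closedBall (0 : ℝ) (1 / 2),
      AEStronglyMeasurable (fun z => F (t, z)) (bmeas α β θ ϑ) := by
    intro F hF t ht
    have h1 : ContinuousOn (fun z => F (t, z)) bidisk :=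
      hF.comp (by fun_prop) fun z hz => ⟨ht, bidisk_subset_closedBall hz⟩
    have h2 := h1.aestronglyMeasurable (μ := bmeas α β θ ϑ) measurableSet_bidisk
    rwa [Measure.restrict_eq_self_of_ae_mem (ae_bmeas_mem_bidisk α β θ ϑ)] at h2
  have h0 : (0 : ℝ) ∈ Metric.closedBall (0 : ℝ) (1 / 2) := by simp
  have hlt : ∀ t ∈ Metric.ball (0 : ℝ) (1 / 2), |t| < 1 := fun t ht => by
    rw [mem_ball_zero_iff, Real.norm_eq_abs] at ht
    linarith
  have key := hasDerivAt_integral_of_dominated_loc_of_deriv_le (μ := bmeas α β θ ϑ)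
    (F := paramIntegrand A B p q) (F' := paramIntegrandDeriv A B p q) (x₀ := 0)
    (bound := fun _ => M') (Metric.ball_mem_nhds (0 : ℝ) (show (0 : ℝ) < 1 / 2 by norm_num))
    (by
      filter_upwards [Metric.closedBall_mem_nhds (0 : ℝ) (show (0 : ℝ) < 1 / 2 by norm_num)]
        with t ht using hmeas hc t ht)
    (by
      refine Integrable.of_bound (hmeas hc 0 h0) M ?_
      filter_upwards [ae_bmeas_mem_bidisk α β θ ϑ] with z hz
      exact hM (0, z) ⟨h0, bidisk_subset_closedBall hz⟩)
    (hmeas hc' 0 h0)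
    (by
      filter_upwards [ae_bmeas_mem_bidisk α β θ ϑ] with z hz t ht
      exact hM' (t, z) ⟨Metric.ball_subset_closedBall ht, bidisk_subset_closedBall hz⟩)
    (integrable_const _)
    (by
      filter_upwards [ae_bmeas_mem_bidisk α β θ ϑ] with z hz t ht
      exact hasDerivAt_paramIntegrand A B p q (hlt t ht) (bidisk_subset_closedBall hz))
  have h2 : HasDerivAt (fun t : ℝ => (((1 - t ^ 2) ^ (-(A + B)) : ℝ) : ℂ) *
      polyInner (bmeas α β θ ϑ) p q) 0 0 := by
    have e1 : HasDerivAt (fun t : ℝ => 1 - t ^ 2) 0 0 := by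
      simpa using ((hasDerivAt_pow 2 (0 : ℝ)).const_sub 1)
    have e2 := (e1.rpow_const (p := -(A + B)) (Or.inl (by norm_num))).ofReal_comp.mul_const
      (polyInner (bmeas α β θ ϑ) p q)
    simpa using e2
  refine key.2.unique (h2.congr_of_eventuallyEq ?_)
  filter_upwards [Metric.ball_mem_nhds (0 : ℝ) (show (0 : ℝ) < 1 / 2 by norm_num)] with t ht
  exact integral_paramIntegrand p q hα hβ (hlt t ht)

lemma mobiusEval_zero (z : ℂ × ℂ) : mobiusEval p 0 z = evalAt p z := by
  simp [mobiusEval, mobius]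

/-- At `t = 0` the flow has velocity `1 - z²`, whose two parts enter `lower` and `raise`. The
derivative `-2A Re z₁` of the weight splits as `-A z₁`, charged to `p`, and `-A conj z₁`, charged to
`q`; likewise for `B` and `z₂`. -/
lemma paramIntegrandDeriv_zero (z : ℂ × ℂ) :
    paramIntegrandDeriv A B p q 0 z =
      evalAt (lower p - raise A B p) z * (starRingEnd ℂ) (evalAt q z) +
        evalAt p z * (starRingEnd ℂ) (evalAt (lower q - raise A B q) z) := by
  have hre : ∀ w : ℂ, ((w.re : ℝ) : ℂ) * 2 = w + (starRingEnd ℂ) w := fun w => by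
    rw [Complex.add_conj]; push_cast; ring
  simp only [paramIntegrandDeriv, paramWeight, paramWeightDeriv, mobiusEvalDeriv, mobiusEval_zero,
    lower_apply, raise_apply, evalAt_sub, evalAt_add, evalAt_mul, evalAt_pow, evalAt_C,
    evalAt_X_zero, evalAt_X_one, map_add, map_sub, map_mul, map_pow, Complex.conj_ofReal]
  simp only [Complex.ofReal_zero, zero_mul, add_zero, norm_one, one_pow, Real.one_rpow, mul_one,
    mul_zero, div_one, one_mul, map_sub, map_one, map_pow, Complex.ofReal_add, Complex.ofReal_mul,
    Complex.ofReal_neg, Complex.ofReal_one, Complex.ofReal_ofNat]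
  linear_combination (-(A : ℂ) * (evalAt p z * (starRingEnd ℂ) (evalAt q z))) * hre z.1 +
    (-(B : ℂ) * (evalAt p z * (starRingEnd ℂ) (evalAt q z))) * hre z.2

/-- The raising operator is adjoint to the lowering operator. -/
lemma polyInner_raise {α β θ ϑ : ℝ} (hα : -1 < α) (hβ : -1 < β)
    [IsFiniteMeasure (bmeas α β θ ϑ)] {p q : MvPolynomial (Fin 2) ℂ} {m : ℕ}
    (hp : p.IsHomogeneous m) (hq : q.IsHomogeneous (m + 1)) :
    polyInner (bmeas α β θ ϑ) (raise (α + θ + ϑ + 2) (β + θ + ϑ + 2) p) q =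
      polyInner (bmeas α β θ ϑ) p (lower q) := by
  have h := integral_paramIntegrandDeriv_zero (α := α) (β := β) (θ := θ) (ϑ := ϑ) p q hα hβ
  simp_rw [paramIntegrandDeriv_zero] at h
  rw [integral_add (integrable_bmeas_of_continuous (continuous_evalAt_mul_conj _ _))
    (integrable_bmeas_of_continuous (continuous_evalAt_mul_conj _ _))] at h
  change polyInner (bmeas α β θ ϑ) _ _ + polyInner (bmeas α β θ ϑ) _ _ = 0 at h
  -- Of the four terms of `⟨(L - R)p, q⟩ + ⟨p, (L - R)q⟩ = 0`, only `⟨Rp, q⟩` and `⟨p, Lq⟩` pair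
  -- equal degrees.
  rw [polyInner_sub_left, polyInner_sub_right,
    polyInner_eq_zero_of_isHomogeneous (isHomogeneous_lower hp) hq (by omega),
    polyInner_eq_zero_of_isHomogeneous hp (isHomogeneous_raise _ _ hq) (by omega)] at h
  linear_combination -h

end Derivative

/-! ### The transvectant coefficients -/

/-- The falling factorial `x (x - 1) ⋯ (x - k + 1)`. -/
def fall (x : ℝ) (k : ℕ) : ℝ := (descPochhammer ℝ k).eval x

lemma fall_zero (x : ℝ) : fall x 0 = 1 := by simp [fall]

lemma fall_succ (x : ℝ) (k : ℕ) : fall x (k + 1) = fall x k * (x - k) := by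
  rw [fall, descPochhammer_succ_right]; simp [fall]

lemma fall_succ_left (x : ℝ) (k : ℕ) : fall (x + 1) (k + 1) = (x + 1) * fall x k := by
  induction k with
  | zero => simp [fall_succ, fall_zero]
  | succ k ih => rw [fall_succ, ih, fall_succ]; push_cast; ring

lemma fall_natCast (n k : ℕ) : fall n k = n.descFactorial k :=
  descPochhammer_eval_eq_descFactorial ℝ n k

/-- This ratio of consecutive coefficients is what makes the sum in `transSymbol_raise` telescope.
-/
lemma coeff_recursion {α β θ ϑ : ℝ} (hsum : 0 < α + β + 2 * θ + 2 * ϑ + 3) {K N : ℕ}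
    (hKN : K < N) :
    coeff α β θ ϑ K N * ((N - K : ℝ) * (α + β + 2 * θ + 2 * ϑ + N + K + 3)) =
      -((K + 1) * (α + θ + ϑ + K + 2)) * coeff α β θ ϑ (K + 1) N := by
  obtain ⟨l, rfl⟩ := Nat.exists_eq_add_of_lt hKN
  have h1 : K + l + 1 - K = l + 1 := by omega
  have h2 : K + l + 1 - (K + 1) = l := by omega
  have hpos : 0 < α + β + 2 * θ + 2 * ϑ + (K + l + 1 : ℕ) + K + 3 := by
    have h3 : (0 : ℝ) ≤ (K + l + 1 : ℕ) := Nat.cast_nonneg _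
    have h4 : (0 : ℝ) ≤ K := Nat.cast_nonneg _
    linarith
  have hp := (poch_pos (show 0 < α + β + 2 * θ + 2 * ϑ + (K + l + 1 : ℕ) + K + 3 + 1 by
    linarith) l).ne'
  have hne := hpos.ne'
  have hl : ((l.factorial : ℕ) : ℝ) ≠ 0 := by positivity
  have hK : ((K.factorial : ℕ) : ℝ) ≠ 0 := by positivity
  have hl' : (l : ℝ) + 1 ≠ 0 := by positivity
  have hK' : (K : ℝ) + 1 ≠ 0 := by positivity
  rw [coeff, coeff, h1, h2, poch_succ_left, poch_succ_left, Nat.factorial_succ,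
    Nat.factorial_succ,
    show α + θ + ϑ + (K + 1 : ℕ) + 2 = α + θ + ϑ + K + 2 + 1 by push_cast; ring,
    show α + β + 2 * θ + 2 * ϑ + (K + l + 1 : ℕ) + (K + 1 : ℕ) + 3 =
      α + β + 2 * θ + 2 * ϑ + (K + l + 1 : ℕ) + K + 3 + 1 by push_cast; ring]
  generalize poch (α + β + 2 * θ + 2 * ϑ + (K + l + 1 : ℕ) + K + 3 + 1) l = P at *
  generalize poch (α + θ + ϑ + K + 2 + 1) l = P' at *
  generalize hD : α + β + 2 * θ + 2 * ϑ + (K + l + 1 : ℕ) + K + 3 = D at *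
  push_cast
  field_simp
  ring

/-- The transvectant symbol as a polynomial in the first exponent and the total degree. -/
def transSymbol (α β θ ϑ : ℝ) (N : ℕ) (x n : ℝ) : ℝ :=
  ∑ k ∈ Finset.range (N + 1), coeff α β θ ϑ k N * (fall x k * fall (n - k) (N - k))

/-- The intertwining relation on monomials, with `x` the exponent of `z₁` and `n` the total degree.
Real arguments avoid truncated subtraction of exponents. -/
lemma transSymbol_raise {α β θ ϑ : ℝ} (hsum : 0 < α + β + 2 * θ + 2 * ϑ + 3) (N : ℕ) (x n : ℝ) :
    (x + (α + θ + ϑ + 2)) * transSymbol α β θ ϑ N (x + 1) (n + 1) +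
        (n - x + (β + θ + ϑ + 2)) * transSymbol α β θ ϑ N x (n + 1) =
      (n + (α + β + 2 * θ + 2 * ϑ + 4) + N) * transSymbol α β θ ϑ N x n := by
  -- Closed form of the partial sums. The factor `N - K` kills it at `K = N`, where the truncated `N
  -- - K - 1` is therefore harmless.
  have key : ∀ K ≤ N, ∑ k ∈ Finset.range (K + 1),
      ((x + (α + θ + ϑ + 2)) * (coeff α β θ ϑ k N * (fall (x + 1) k * fall (n + 1 - k) (N - k))) +
        (n - x + (β + θ + ϑ + 2)) * (coeff α β θ ϑ k N * (fall x k * fall (n + 1 - k) (N - k))) -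
        (n + (α + β + 2 * θ + 2 * ϑ + 4) + N) *
          (coeff α β θ ϑ k N * (fall x k * fall (n - k) (N - k)))) =
      coeff α β θ ϑ K N * ((N - K : ℝ) * (α + β + 2 * θ + 2 * ϑ + N + K + 3)) *
        (fall x K * fall (n - K) (N - K - 1)) := by
    intro K
    induction K with
    | zero =>
      intro _
      rw [Finset.sum_range_one, Nat.cast_zero, sub_zero, sub_zero, fall_zero, fall_zero]
      rcases N with _ | M
      · simp only [Nat.sub_zero, fall_zero, Nat.cast_zero]
        ring
      · rw [Nat.sub_zero, Nat.add_sub_cancel, fall_succ_left n M, fall_succ n M]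
        push_cast
        ring
    | succ K ih =>
      intro hK
      rw [Finset.sum_range_succ, ih (by omega), coeff_recursion hsum (by omega)]
      obtain ⟨L, rfl⟩ := Nat.exists_eq_add_of_le hK
      have h1 : K + 1 + L - K - 1 = L := by omega
      have h2 : K + 1 + L - (K + 1) = L := by omega
      rw [h1, h2, fall_succ_left, fall_succ x K,
        show n + 1 - (K + 1 : ℕ) = n - (K + 1 : ℕ) + 1 by ring,
        show n - (K : ℝ) = n - (K + 1 : ℕ) + 1 by push_cast; ring]
      rcases L with _ | l
      · simp only [fall_zero]
        push_cast
        ring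
      · rw [fall_succ_left, fall_succ, Nat.add_sub_cancel]
        push_cast
        ring
  have h := key N le_rfl
  rw [sub_self, zero_mul, mul_zero, zero_mul, Finset.sum_sub_distrib, Finset.sum_add_distrib,
    ← Finset.mul_sum, ← Finset.mul_sum, ← Finset.mul_sum, sub_eq_zero] at h
  simp only [transSymbol]
  exact h

/-- The value of the transvectant on the monomial `z₁ ^ i * z₂ ^ j`. -/
def transMonomial (α β θ ϑ : ℝ) (N i j : ℕ) : ℝ :=
  ∑ k ∈ Finset.range (N + 1),
    coeff α β θ ϑ k N * ((i.descFactorial k : ℝ) * ((i + j - k).descFactorial (N - k) : ℝ))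

lemma transMonomial_eq (α β θ ϑ : ℝ) (N i j : ℕ) :
    transMonomial α β θ ϑ N i j = transSymbol α β θ ϑ N i (i + j) := by
  refine Finset.sum_congr rfl fun k _ => ?_
  rw [fall_natCast]
  -- For `k > i` the first falling factorial vanishes, so the truncation in `i + j - k` is never
  -- seen.
  by_cases hk : k ≤ i
  · rw [← fall_natCast (i + j - k), Nat.cast_sub (by omega)]
    push_cast
    rfl
  · rw [Nat.descFactorial_of_lt (by omega)]
    simp

lemma transMonomial_raise {α β θ ϑ : ℝ} (hsum : 0 < α + β + 2 * θ + 2 * ϑ + 3) (N i j : ℕ) :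
    (i + (α + θ + ϑ + 2)) * transMonomial α β θ ϑ N (i + 1) j +
        (j + (β + θ + ϑ + 2)) * transMonomial α β θ ϑ N i (j + 1) =
      (i + j + (α + β + 2 * θ + 2 * ϑ + 4) + N) * transMonomial α β θ ϑ N i j := by
  have h := transSymbol_raise (α := α) (β := β) (θ := θ) (ϑ := ϑ) hsum N i (i + j)
  rw [transMonomial_eq, transMonomial_eq, transMonomial_eq, ← h]
  push_cast
  rw [show (i : ℝ) + 1 + j = i + j + 1 by ring, show (i : ℝ) + (j + 1) = i + j + 1 by ring,
    show (i : ℝ) + j - i = j by ring]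

/-- The coefficient functional of the transvectant of order `N` on polynomials. -/
def trans (α β θ ϑ : ℝ) (N : ℕ) : MvPolynomial (Fin 2) ℂ →ₗ[ℂ] ℂ :=
  (MvPolynomial.basisMonomials (Fin 2) ℂ).constr ℂ
    fun s => (transMonomial α β θ ϑ N (s 0) (s 1) : ℂ)

lemma trans_monomial (α β θ ϑ : ℝ) (N : ℕ) (s : Fin 2 →₀ ℕ) (c : ℂ) :
    trans α β θ ϑ N (MvPolynomial.monomial s c) =
      c * (transMonomial α β θ ϑ N (s 0) (s 1) : ℂ) := by
  have h : MvPolynomial.monomial s c = c • MvPolynomial.basisMonomials (Fin 2) ℂ s := by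
    rw [MvPolynomial.coe_basisMonomials, MvPolynomial.smul_monomial, smul_eq_mul, mul_one]
  rw [h, map_smul, trans, Module.Basis.constr_basis, smul_eq_mul]

lemma monomial_eq_mul (s : Fin 2 →₀ ℕ) (c : ℂ) :
    (MvPolynomial.monomial s c : MvPolynomial (Fin 2) ℂ) = c • (X 0 ^ s 0 * X 1 ^ s 1) := by
  rw [MvPolynomial.monomial_eq, Finsupp.prod_fintype _ _ (by simp), Fin.prod_univ_two,
    MvPolynomial.C_mul']

lemma trans_X_pow_mul (α β θ ϑ : ℝ) (N i j : ℕ) :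
    trans α β θ ϑ N (X 0 ^ i * X 1 ^ j) = (transMonomial α β θ ϑ N i j : ℂ) := by
  have h := monomial_eq_mul (Finsupp.equivFunOnFinite.symm ![i, j]) 1
  rw [one_smul] at h
  simp only [Finsupp.equivFunOnFinite_symm_apply_apply, Matrix.cons_val_zero,
    Matrix.cons_val_one] at h
  rw [← h, trans_monomial]
  simp

lemma isHomogeneous_induction {P : MvPolynomial (Fin 2) ℂ → Prop} {m : ℕ}
    (hmon : ∀ i j : ℕ, i + j = m → P (X 0 ^ i * X 1 ^ j)) (hsmul : ∀ (c : ℂ) p, P p → P (c • p))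
    (hadd : ∀ p q, P p → P q → P (p + q)) (h0 : P 0) {p : MvPolynomial (Fin 2) ℂ}
    (hp : p.IsHomogeneous m) : P p := by
  rw [p.as_sum]
  refine Finset.sum_induction _ P hadd h0 fun s hs => ?_
  rw [monomial_eq_mul]
  refine hsmul _ _ (hmon _ _ ?_)
  have hdeg := hp (MvPolynomial.mem_support_iff.1 hs)
  rw [Finsupp.weight_apply, Finsupp.sum_fintype _ _ (by simp), Fin.sum_univ_two] at hdeg
  simpa using hdeg

lemma pderiv_zero_X_pow_mul (i j : ℕ) :
    pderiv 0 (X 0 ^ i * X 1 ^ j : MvPolynomial (Fin 2) ℂ) =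
      (i : ℂ) • (X 0 ^ (i - 1) * X 1 ^ j) := by
  rw [MvPolynomial.pderiv_mul, MvPolynomial.pderiv_pow, MvPolynomial.pderiv_pow,
    MvPolynomial.pderiv_X_self, MvPolynomial.pderiv_X_of_ne (by simp), MvPolynomial.smul_eq_C_mul,
    map_natCast]
  ring

lemma pderiv_one_X_pow_mul (i j : ℕ) :
    pderiv 1 (X 0 ^ i * X 1 ^ j : MvPolynomial (Fin 2) ℂ) =
      (j : ℂ) • (X 0 ^ i * X 1 ^ (j - 1)) := by
  rw [MvPolynomial.pderiv_mul, MvPolynomial.pderiv_pow, MvPolynomial.pderiv_pow,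
    MvPolynomial.pderiv_X_self, MvPolynomial.pderiv_X_of_ne (by simp), MvPolynomial.smul_eq_C_mul,
    map_natCast]
  ring

lemma raise_X_pow_mul (A B : ℝ) (i j : ℕ) :
    raise A B (X 0 ^ i * X 1 ^ j) = ((i : ℂ) + A) • (X 0 ^ (i + 1) * X 1 ^ j) +
      ((j : ℂ) + B) • (X 0 ^ i * X 1 ^ (j + 1)) := by
  have e : ∀ (k : ℕ) (v : MvPolynomial (Fin 2) ℂ), (k : ℂ) • (v ^ 2 * v ^ (k - 1)) =
      (k : ℂ) • v ^ (k + 1) := by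
    intro k v
    rcases k with _ | k
    · simp
    · rw [Nat.add_sub_cancel, ← pow_add, add_comm 2 k]
  rw [raise_apply, pderiv_zero_X_pow_mul, pderiv_one_X_pow_mul, mul_smul_comm, mul_smul_comm,
    ← mul_assoc, ← smul_mul_assoc, e, mul_left_comm (X 1 ^ 2), ← mul_smul_comm, e]
  simp only [MvPolynomial.smul_eq_C_mul, map_add]
  ring

/-- By linearity this reduces to monomials, where it is `transMonomial_raise`. -/
lemma trans_raise {α β θ ϑ : ℝ} (hsum : 0 < α + β + 2 * θ + 2 * ϑ + 3) (N : ℕ)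
    {p : MvPolynomial (Fin 2) ℂ} {m : ℕ} (hp : p.IsHomogeneous m) :
    trans α β θ ϑ N (raise (α + θ + ϑ + 2) (β + θ + ϑ + 2) p) =
      ((m + (α + β + 2 * θ + 2 * ϑ + 4) + N : ℝ) : ℂ) * trans α β θ ϑ N p := by
  refine isHomogeneous_induction (P := fun p =>
    trans α β θ ϑ N (raise (α + θ + ϑ + 2) (β + θ + ϑ + 2) p) =
      ((m + (α + β + 2 * θ + 2 * ϑ + 4) + N : ℝ) : ℂ) * trans α β θ ϑ N p)
    (fun i j hij => ?_) (fun c p h => ?_) (fun p q h1 h2 => ?_) (by simp) hp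
  · rw [raise_X_pow_mul, map_add, map_smul, map_smul, trans_X_pow_mul, trans_X_pow_mul,
      trans_X_pow_mul, smul_eq_mul, smul_eq_mul, ← hij]
    have := congrArg (fun x : ℝ => (x : ℂ)) (transMonomial_raise hsum N i j)
    push_cast at this ⊢
    linear_combination this
  · rw [map_smul, map_smul, map_smul, h, smul_eq_mul, smul_eq_mul]; ring
  · rw [map_add, map_add, map_add, h1, h2, mul_add]

/-! ### Lowest weight vectors -/

/-- General `u` and `v` cover both the monomials and the powers of `X 0 - X 1`. -/
lemma iterate_pderiv_zero_pow_mul {u v : MvPolynomial (Fin 2) ℂ} (hu : pderiv 0 u = 1)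
    (hv : pderiv 0 v = 0) (M k : ℕ) :
    (pderiv 0)^[k] (u ^ M * v) = (M.descFactorial k : ℂ) • (u ^ (M - k) * v) := by
  induction k with
  | zero => simp
  | succ k ih =>
    rw [Function.iterate_succ_apply', ih, Derivation.map_smul, MvPolynomial.pderiv_mul,
      MvPolynomial.pderiv_pow, hu, hv, Nat.descFactorial_succ, mul_zero, add_zero, mul_one,
      Nat.sub_sub]
    push_cast
    rw [mul_comm ((M - k : ℕ) : ℂ), mul_smul]
    congr 1
    rw [MvPolynomial.smul_eq_C_mul, map_natCast, mul_assoc]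

lemma iterate_pderiv_add (k : ℕ) (p q : MvPolynomial (Fin 2) ℂ) :
    (pderiv 0)^[k] (p + q) = (pderiv 0)^[k] p + (pderiv 0)^[k] q := by
  induction k with
  | zero => rfl
  | succ k ih => rw [Function.iterate_succ_apply', ih, map_add, Function.iterate_succ_apply',
      Function.iterate_succ_apply']

lemma iterate_pderiv_smul (k : ℕ) (c : ℂ) (p : MvPolynomial (Fin 2) ℂ) :
    (pderiv 0)^[k] (c • p) = c • (pderiv 0)^[k] p := by
  induction k with
  | zero => rfl
  | succ k ih => rw [Function.iterate_succ_apply', ih, Derivation.map_smul,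
      Function.iterate_succ_apply']

/-- A homogeneous polynomial of degree `d` restricts to the diagonal as its value at `(1, 1)` times
`z^d`. This form evaluates `(z₁ - z₂)^M` without expanding it. -/
lemma trans_eq_sum (α β θ ϑ : ℝ) (N : ℕ) {p : MvPolynomial (Fin 2) ℂ} {m : ℕ}
    (hp : p.IsHomogeneous m) :
    trans α β θ ϑ N p = ∑ k ∈ Finset.range (N + 1),
      (coeff α β θ ϑ k N : ℂ) * (((m - k).descFactorial (N - k) : ℂ) *
        evalAt ((pderiv 0)^[k] p) (1, 1)) := by
  refine isHomogeneous_induction (P := fun p =>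
    trans α β θ ϑ N p = ∑ k ∈ Finset.range (N + 1),
      (coeff α β θ ϑ k N : ℂ) * (((m - k).descFactorial (N - k) : ℂ) *
        evalAt ((pderiv 0)^[k] p) (1, 1)))
    (fun i j hij => ?_) (fun c p h => ?_) (fun p q h1 h2 => ?_) ?_ hp
  · rw [trans_X_pow_mul, transMonomial, Complex.ofReal_sum]
    refine Finset.sum_congr rfl fun k _ => ?_
    rw [iterate_pderiv_zero_pow_mul (MvPolynomial.pderiv_X_self 0)
      (by rw [MvPolynomial.pderiv_pow, MvPolynomial.pderiv_X_of_ne (by simp), mul_zero]), hij]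
    simp only [evalAt_smul, evalAt_mul, evalAt_pow, evalAt_X_zero, evalAt_X_one, one_pow]
    push_cast
    ring
  · rw [map_smul, h, smul_eq_mul, Finset.mul_sum]
    refine Finset.sum_congr rfl fun k _ => ?_
    rw [iterate_pderiv_smul, evalAt_smul]
    ring
  · rw [map_add, h1, h2, ← Finset.sum_add_distrib]
    refine Finset.sum_congr rfl fun k _ => ?_
    rw [iterate_pderiv_add, evalAt_add]
    ring
  · rw [map_zero]
    refine (Finset.sum_eq_zero fun k _ => ?_).symm
    rw [show (pderiv 0)^[k] (0 : MvPolynomial (Fin 2) ℂ) = 0 from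
      Function.iterate_fixed (map_zero _) k]
    simp

lemma isHomogeneous_X_sub_X_pow (M : ℕ) :
    ((X 0 - X 1 : MvPolynomial (Fin 2) ℂ) ^ M).IsHomogeneous M := by
  have := (((MvPolynomial.isHomogeneous_X ℂ (0 : Fin 2)).sub
    (MvPolynomial.isHomogeneous_X ℂ (1 : Fin 2)))).pow M
  rwa [one_mul] at this

/-- On the diagonal only the `M`-th derivative survives, leaving a constant that the remaining `N -
M` derivatives kill unless `N = M`; then `a_{N,N} = 1 / N!` cancels `N!`. -/
lemma trans_X_sub_X_pow (α β θ ϑ : ℝ) (N M : ℕ) :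
    trans α β θ ϑ N ((X 0 - X 1) ^ M) = if N = M then 1 else 0 := by
  rw [trans_eq_sum α β θ ϑ N (isHomogeneous_X_sub_X_pow M)]
  have hu : pderiv 0 (X 0 - X 1 : MvPolynomial (Fin 2) ℂ) = 1 := by
    rw [map_sub, MvPolynomial.pderiv_X_self, MvPolynomial.pderiv_X_of_ne (by simp), sub_zero]
  have hterm : ∀ k, evalAt ((pderiv 0)^[k] ((X 0 - X 1) ^ M)) (1, 1) =
      if k = M then (M.factorial : ℂ) else 0 := by
    intro k
    have := iterate_pderiv_zero_pow_mul hu MvPolynomial.pderiv_one M k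
      (v := 1)
    rw [mul_one, mul_one] at this
    rw [this, evalAt_smul, evalAt_pow, evalAt_sub, evalAt_X_zero, evalAt_X_one, sub_self]
    rcases lt_trichotomy k M with h | h | h
    · rw [zero_pow (by omega), mul_zero, if_neg (by omega)]
    · subst h; simp [Nat.descFactorial_self]
    · rw [Nat.descFactorial_of_lt h, if_neg (by omega)]; simp
  simp only [hterm]
  split_ifs with h
  · subst h
    rw [Finset.sum_eq_single N (fun k _ hk => by simp [hk]) (fun h => by simp at h)]
    simp only [coeff, Nat.sub_self, poch_zero]
    have : ((N.factorial : ℕ) : ℂ) ≠ 0 := by exact_mod_cast N.factorial_ne_zero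
    simp [this]
  · refine Finset.sum_eq_zero fun k hk => ?_
    rw [Finset.mem_range] at hk
    by_cases hkM : k = M
    · subst hkM
      rw [Nat.sub_self, Nat.descFactorial_of_lt (by omega)]
      simp
    · simp [hkM]

/-! ### The orthogonal basis of homogeneous polynomials -/

lemma pderiv_comm (p : MvPolynomial (Fin 2) ℂ) :
    pderiv 0 (pderiv 1 p) = pderiv 1 (pderiv 0 p) := by
  have h : ⁅(pderiv 0 : Derivation ℂ (MvPolynomial (Fin 2) ℂ) (MvPolynomial (Fin 2) ℂ)),
      (pderiv 1 : Derivation ℂ (MvPolynomial (Fin 2) ℂ) (MvPolynomial (Fin 2) ℂ))⁆ = 0 := by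
    refine MvPolynomial.derivation_ext fun i => ?_
    rw [Derivation.commutator_apply]
    fin_cases i <;> simp
  have := congrArg (fun D => D p) h
  simpa [Derivation.commutator_apply, sub_eq_zero] using this

/-- The `sl₂` relation: the commutator is twice the Euler operator plus `A + B`, and Euler's
identity evaluates it in degree `m`. -/
lemma lower_raise (A B : ℝ) {p : MvPolynomial (Fin 2) ℂ} {m : ℕ} (hp : p.IsHomogeneous m) :
    lower (raise A B p) = raise A B (lower p) + ((2 * m + (A + B) : ℝ) : ℂ) • p := by
  have hE := hp.sum_X_mul_pderiv
  rw [Fin.sum_univ_two, nsmul_eq_mul] at hE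
  simp only [lower_apply, raise_apply, map_add, MvPolynomial.pderiv_mul, MvPolynomial.pderiv_pow,
    MvPolynomial.pderiv_X_self, MvPolynomial.pderiv_X_of_ne (show (0 : Fin 2) ≠ 1 by simp),
    MvPolynomial.pderiv_X_of_ne (show (1 : Fin 2) ≠ 0 by simp), MvPolynomial.pderiv_C,
    pderiv_comm, MvPolynomial.smul_eq_C_mul, Complex.ofReal_add, Complex.ofReal_mul,
    Complex.ofReal_natCast, Complex.ofReal_ofNat, map_mul, map_natCast]
  have h2 : (C (2 : ℂ) : MvPolynomial (Fin 2) ℂ) = 2 := map_ofNat _ _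
  rw [h2]
  push_cast
  linear_combination 2 * hE

/-- The vectors obtained from a lowest weight vector by raising. -/
def basisPoly (A B : ℝ) (M n : ℕ) : MvPolynomial (Fin 2) ℂ :=
  (raise A B)^[n] ((X 0 - X 1) ^ M)

lemma basisPoly_succ (A B : ℝ) (M n : ℕ) :
    basisPoly A B M (n + 1) = raise A B (basisPoly A B M n) :=
  Function.iterate_succ_apply' _ _ _

lemma isHomogeneous_basisPoly (A B : ℝ) (M n : ℕ) :
    (basisPoly A B M n).IsHomogeneous (M + n) := by
  induction n with
  | zero => exact isHomogeneous_X_sub_X_pow M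
  | succ n ih => rw [basisPoly_succ]; exact isHomogeneous_raise A B ih

lemma lower_basisPoly_zero (A B : ℝ) (M : ℕ) : lower (basisPoly A B M 0) = 0 := by
  rw [basisPoly, Function.iterate_zero, id, lower_apply, MvPolynomial.pderiv_pow,
    MvPolynomial.pderiv_pow, map_sub, map_sub, MvPolynomial.pderiv_X_self,
    MvPolynomial.pderiv_X_self, MvPolynomial.pderiv_X_of_ne (show (0 : Fin 2) ≠ 1 by simp),
    MvPolynomial.pderiv_X_of_ne (show (1 : Fin 2) ≠ 0 by simp)]
  ring

/-- The scalar is the sum of the commutator values `2(M + j) + A + B` over `j ≤ n`. -/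
lemma lower_basisPoly_succ (A B : ℝ) (M n : ℕ) :
    lower (basisPoly A B M (n + 1)) =
      (((n + 1) * (A + B + 2 * M + n) : ℝ) : ℂ) • basisPoly A B M n := by
  induction n with
  | zero =>
    rw [basisPoly_succ, lower_raise A B (isHomogeneous_basisPoly A B M 0), lower_basisPoly_zero,
      map_zero, zero_add]
    congr 2
    push_cast
    ring
  | succ n ih =>
    rw [basisPoly_succ, lower_raise A B (isHomogeneous_basisPoly A B M (n + 1)), ih, map_smul,
      ← basisPoly_succ, ← add_smul]
    congr 1
    push_cast
    ring

/-- Up to Pochhammer factors, the functionals `trans N` are dual to the basis: each raising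
contributes `A + B + M + n + N`, the next factor of the symbol when `N = M`. -/
lemma trans_basisPoly {α β θ ϑ : ℝ} (hsum : 0 < α + β + 2 * θ + 2 * ϑ + 3) (N M n : ℕ) :
    trans α β θ ϑ N (basisPoly (α + θ + ϑ + 2) (β + θ + ϑ + 2) M n) =
      if N = M then ((poch (α + β + 2 * θ + 2 * ϑ + 2 * N + 4) n : ℝ) : ℂ) else 0 := by
  induction n with
  | zero =>
    rw [basisPoly, Function.iterate_zero, id, trans_X_sub_X_pow, poch_zero, Complex.ofReal_one]
  | succ n ih =>
    rw [basisPoly_succ, trans_raise hsum N (isHomogeneous_basisPoly _ _ M n), ih]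
    split_ifs with h
    · subst h
      rw [poch_succ, ← Complex.ofReal_mul]
      congr 1
      push_cast
      ring
    · rw [mul_zero]

/-! ### Orthogonality, norms and completeness of the basis -/

section Norms

variable {α β θ ϑ : ℝ}

lemma polyInner_self (μ : Measure (ℂ × ℂ)) (p : MvPolynomial (Fin 2) ℂ) :
    polyInner μ p p = ((∫⁻ z, ENNReal.ofReal (‖evalAt p z‖ ^ 2) ∂μ).toReal : ℂ) := by
  have h : ∀ z, evalAt p z * (starRingEnd ℂ) (evalAt p z) = ((‖evalAt p z‖ ^ 2 : ℝ) : ℂ) :=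
    fun z => (norm_sq_eq_ofReal _).symm
  have hm : AEStronglyMeasurable (fun z => ‖evalAt p z‖ ^ 2) μ :=
    ((continuous_evalAt p).norm.pow 2).aestronglyMeasurable
  simp_rw [polyInner, h]
  rw [integral_complex_ofReal, integral_eq_lintegral_of_nonneg_ae (Filter.Eventually.of_forall
    fun z => by positivity) hm]

lemma norm_sub_pow_mul_bidiskWeight (hθ : -1 < θ) (M : ℕ) (z : ℂ × ℂ) :
    ‖(z.1 - z.2) ^ M‖ ^ 2 * bidiskWeight θ ϑ z = bidiskWeight (θ + M) ϑ z := by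
  rw [bidiskWeight, bidiskWeight, mul_left_comm]
  congr 1
  rw [norm_pow, ← pow_mul, mul_comm M 2]
  rcases Nat.eq_zero_or_pos M with rfl | hM
  · simp
  have hM1 : (1 : ℝ) ≤ M := by exact_mod_cast hM
  -- On the diagonal both sides vanish: `M ≥ 1` and `θ > -1` make the exponent `2 (θ + M)` nonzero.
  rcases (norm_nonneg (z.1 - z.2)).eq_or_lt with h | h
  · rw [← h, zero_pow (by omega), zero_mul, Real.zero_rpow (by linarith)]
  · rw [← Real.rpow_natCast, ← Real.rpow_add h]
    congr 1
    push_cast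
    ring

/-- The factor `|z₁ - z₂|^(2M)` is absorbed into the weight, which leaves a total mass with `θ`
shifted by `M`. -/
lemma lintegral_normSq_basisPoly_zero (hα : -1 < α) (hβ : -1 < β) (hθ : -1 < θ)
    (hsum : 0 < α + β + 2 * θ + 2 * ϑ + 3) (A B : ℝ) (M : ℕ) :
    ∫⁻ z, ENNReal.ofReal (‖evalAt (basisPoly A B M 0) z‖ ^ 2) ∂bmeas α β θ ϑ =
      ENNReal.ofReal (1 / sigma α β (θ + M) ϑ) := by
  have hM : (0 : ℝ) ≤ M := M.cast_nonneg
  have hm : Measurable fun z => ENNReal.ofReal (‖evalAt (basisPoly A B M 0) z‖ ^ 2) :=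
    ((continuous_evalAt _).norm.pow 2).measurable.ennreal_ofReal
  rw [← bmeas_univ hα hβ (θ := θ + M) (by linarith) (by linarith), bmeas, bmeas,
    lintegral_withDensity_eq_lintegral_mul _ (measurable_wtd α β θ ϑ) hm,
    withDensity_apply _ MeasurableSet.univ, Measure.restrict_univ]
  refine lintegral_congr fun z => ?_
  rw [Pi.mul_apply, wtd, wtd, mul_assoc, ← ENNReal.ofReal_mul' (by positivity :
    0 ≤ ‖evalAt (basisPoly A B M 0) z‖ ^ 2), mul_comm _ (_ ^ 2), basisPoly, Function.iterate_zero, id, evalAt_pow, evalAt_sub, evalAt_X_zero, evalAt_X_one,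
    norm_sub_pow_mul_bidiskWeight hθ]

/-- Each `raise` crosses the inner product as `lower` and yields a factor `(n + 1)(A + B + 2M + n)`.
-/
lemma polyInner_basisPoly_self (hα : -1 < α) (hβ : -1 < β) (hθ : -1 < θ)
    (hsum : 0 < α + β + 2 * θ + 2 * ϑ + 3) (M n : ℕ) :
    polyInner (bmeas α β θ ϑ) (basisPoly (α + θ + ϑ + 2) (β + θ + ϑ + 2) M n)
        (basisPoly (α + θ + ϑ + 2) (β + θ + ϑ + 2) M n) =
      ((n.factorial * poch (α + β + 2 * θ + 2 * ϑ + 2 * M + 4) n *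
        (1 / sigma α β (θ + M) ϑ) : ℝ) : ℂ) := by
  have := isFiniteMeasure_bmeas hα hβ hθ hsum
  induction n with
  | zero =>
    have hM : (0 : ℝ) ≤ M := M.cast_nonneg
    rw [polyInner_self, lintegral_normSq_basisPoly_zero hα hβ hθ hsum, ENNReal.toReal_ofReal
      (one_div_nonneg.2 (sigma_pos hα hβ (by linarith) (by linarith)).le), poch_zero]
    simp
  | succ n ih =>
    conv_lhs => rw [basisPoly_succ]
    rw [polyInner_raise hα hβ (isHomogeneous_basisPoly _ _ M n)
      (by rw [← basisPoly_succ]; exact isHomogeneous_basisPoly _ _ M (n + 1)), ← basisPoly_succ,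
      lower_basisPoly_succ, polyInner_smul_right, ih, Complex.conj_ofReal, ← Complex.ofReal_mul,
      poch_succ, Nat.factorial_succ]
    congr 1
    push_cast
    ring

/-- Unequal degrees are orthogonal by rotation. In equal degrees, raisings are moved across as
lowerings until one lowest weight vector is reached and killed. -/
lemma polyInner_basisPoly_of_ne (hα : -1 < α) (hβ : -1 < β)
    [IsFiniteMeasure (bmeas α β θ ϑ)] {M M' : ℕ} (hM : M ≠ M') (n n' : ℕ) :
    polyInner (bmeas α β θ ϑ) (basisPoly (α + θ + ϑ + 2) (β + θ + ϑ + 2) M n)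
        (basisPoly (α + θ + ϑ + 2) (β + θ + ϑ + 2) M' n') = 0 := by
  induction n generalizing n' with
  | zero =>
    by_cases hdeg : M + 0 = M' + n'
    · obtain ⟨k, rfl⟩ : ∃ k, n' = k + 1 := ⟨n' - 1, by omega⟩
      rw [← polyInner_conj, basisPoly_succ, polyInner_raise hα hβ (m := M' + k)
        (isHomogeneous_basisPoly _ _ M' k)
        (by have := isHomogeneous_basisPoly (α + θ + ϑ + 2) (β + θ + ϑ + 2) M 0
            rwa [hdeg] at this), lower_basisPoly_zero]
      simp [polyInner]
    · exact polyInner_eq_zero_of_isHomogeneous (isHomogeneous_basisPoly _ _ M 0)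
        (isHomogeneous_basisPoly _ _ M' n') hdeg
  | succ n ih =>
    by_cases hdeg : M + (n + 1) = M' + n'
    · rw [basisPoly_succ, polyInner_raise hα hβ (m := M + n) (isHomogeneous_basisPoly _ _ M n)
        (by have := isHomogeneous_basisPoly (α + θ + ϑ + 2) (β + θ + ϑ + 2) M' n'
            rwa [← hdeg] at this)]
      rcases n' with _ | k
      · rw [lower_basisPoly_zero]; simp [polyInner]
      · rw [lower_basisPoly_succ, polyInner_smul_right, ih, mul_zero]
    · exact polyInner_eq_zero_of_isHomogeneous (isHomogeneous_basisPoly _ _ M (n + 1))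
        (isHomogeneous_basisPoly _ _ M' n') hdeg

lemma poch_ne_zero_of_sum (hsum : 0 < α + β + 2 * θ + 2 * ϑ + 3) (N n : ℕ) :
    0 < poch (α + β + 2 * θ + 2 * ϑ + 2 * N + 4) n := by
  have : (0 : ℝ) ≤ N := N.cast_nonneg
  exact poch_pos (by linarith) n

/-- Every homogeneous polynomial is a combination of the vectors `basisPoly`. -/
lemma exists_eq_sum_basisPoly (hsum : 0 < α + β + 2 * θ + 2 * ϑ + 3)
    {h : MvPolynomial (Fin 2) ℂ} {m : ℕ} (hh : h.IsHomogeneous m) :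
    ∃ b : Fin (m + 1) → ℂ, h = ∑ N : Fin (m + 1),
      b N • basisPoly (α + θ + ϑ + 2) (β + θ + ϑ + 2) N (m - N) := by
  set e : Fin (m + 1) → MvPolynomial (Fin 2) ℂ :=
    fun N => basisPoly (α + θ + ϑ + 2) (β + θ + ϑ + 2) N (m - N) with he
  set mon : Fin (m + 1) → MvPolynomial (Fin 2) ℂ :=
    fun i => X 0 ^ (i : ℕ) * X 1 ^ (m - i : ℕ) with hmon
  have hspan : ∀ p : MvPolynomial (Fin 2) ℂ, p.IsHomogeneous m →
      p ∈ Submodule.span ℂ (Set.range mon) := fun p hp =>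
    isHomogeneous_induction (P := fun p => p ∈ Submodule.span ℂ (Set.range mon))
      (fun i j hij => Submodule.subset_span
        ⟨⟨i, by omega⟩, by simp only [hmon]; congr 2; omega⟩)
      (fun c p hp => Submodule.smul_mem _ c hp) (fun p q => Submodule.add_mem _)
      (Submodule.zero_mem _) hp
  have hle : Submodule.span ℂ (Set.range e) ≤ Submodule.span ℂ (Set.range mon) := by
    rw [Submodule.span_le]
    rintro _ ⟨N, rfl⟩
    refine hspan _ ?_
    have := isHomogeneous_basisPoly (α + θ + ϑ + 2) (β + θ + ϑ + 2) N (m - N)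
    rwa [show (N : ℕ) + (m - N) = m by omega] at this
  -- Applying `trans N` isolates the `N`-th coefficient. Then `m + 1` independent vectors inside the
  -- span of `m + 1` monomials must fill it.
  have hli : LinearIndependent ℂ e := by
    rw [Fintype.linearIndependent_iff]
    intro g hg N
    have h1 := congrArg (trans α β θ ϑ N) hg
    rw [map_sum, map_zero, Finset.sum_eq_single N] at h1
    · rw [map_smul, smul_eq_mul, he, trans_basisPoly hsum, if_pos rfl] at h1
      refine (mul_eq_zero.1 h1).resolve_right ?_
      exact_mod_cast (poch_ne_zero_of_sum hsum _ _).ne'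
    · intro M _ hM
      rw [map_smul, he, trans_basisPoly hsum, if_neg (fun h => hM (Fin.ext h.symm)), smul_zero]
    · simp
  have heq : Submodule.span ℂ (Set.range e) = Submodule.span ℂ (Set.range mon) := by
    have hfin : FiniteDimensional ℂ (Submodule.span ℂ (Set.range mon)) :=
      FiniteDimensional.span_of_finite ℂ (Set.finite_range mon)
    refine Submodule.eq_of_le_of_finrank_le hle ?_
    rw [finrank_span_eq_card hli]
    exact finrank_range_le_card mon
  have hm := hspan h hh
  rw [← heq, Submodule.mem_span_range_iff_exists_fun] at hm
  obtain ⟨b, hb⟩ := hm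
  exact ⟨b, hb.symm⟩

lemma polyInner_sum_left [IsFiniteMeasure (bmeas α β θ ϑ)] {ι : Type*} (s : Finset ι)
    (p : ι → MvPolynomial (Fin 2) ℂ) (q : MvPolynomial (Fin 2) ℂ) :
    polyInner (bmeas α β θ ϑ) (∑ i ∈ s, p i) q = ∑ i ∈ s, polyInner (bmeas α β θ ϑ) (p i) q := by
  classical
  induction s using Finset.induction_on with
  | empty => simp [polyInner]
  | insert i s hi ih => rw [Finset.sum_insert hi, Finset.sum_insert hi, polyInner_add_left, ih]

/-- The norm formula for homogeneous polynomials. -/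
lemma lintegral_normSq_of_isHomogeneous (hα : -1 < α) (hβ : -1 < β) (hθ : -1 < θ)
    (hsum : 0 < α + β + 2 * θ + 2 * ϑ + 3) {h : MvPolynomial (Fin 2) ℂ} {m : ℕ}
    (hh : h.IsHomogeneous m) :
    ∫⁻ z, ENNReal.ofReal (‖evalAt h z‖ ^ 2) ∂bmeas α β θ ϑ =
      ∑ N ∈ Finset.range (m + 1), ENNReal.ofReal (1 / sigma α β (θ + N) ϑ) *
        (ENNReal.ofReal (‖trans α β θ ϑ N h‖ ^ 2) *
        ENNReal.ofReal ((m - N).factorial / poch (α + β + 2 * θ + 2 * ϑ + 2 * N + 4) (m - N))) := by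
  have := isFiniteMeasure_bmeas hα hβ hθ hsum
  obtain ⟨b, hb⟩ := exists_eq_sum_basisPoly hsum hh
  set e : Fin (m + 1) → MvPolynomial (Fin 2) ℂ :=
    fun N => basisPoly (α + θ + ϑ + 2) (β + θ + ϑ + 2) N (m - N) with he
  have hright : ∀ p, polyInner (bmeas α β θ ϑ) p h =
      ∑ N, (starRingEnd ℂ) (b N) * polyInner (bmeas α β θ ϑ) p (e N) := by
    intro p
    rw [← polyInner_conj, hb, polyInner_sum_left, map_sum]
    refine Finset.sum_congr rfl fun N _ => ?_
    rw [polyInner_smul_left, map_mul, polyInner_conj]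
  have hfinite : ∫⁻ z, ENNReal.ofReal (‖evalAt h z‖ ^ 2) ∂bmeas α β θ ϑ ≠ ⊤ := by
    have hc : Continuous fun z => ((‖evalAt h z‖ ^ 2 : ℝ) : ℂ) :=
      Complex.continuous_ofReal.comp ((continuous_evalAt h).norm.pow 2)
    exact (Integrable.lintegral_lt_top (f := fun z => ‖evalAt h z‖ ^ 2)
      (by exact (integrable_bmeas_of_continuous hc).re)).ne
  have hS : ∀ N : ℕ, 0 ≤ 1 / sigma α β (θ + N) ϑ := fun N => by
    have hN : (0 : ℝ) ≤ N := N.cast_nonneg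
    exact one_div_nonneg.2 (sigma_pos hα hβ (by linarith) (by linarith)).le
  -- Solving for `b N` places the Pochhammer symbol in the denominator once `|b N|²` is multiplied
  -- by the squared norm of the basis vector.
  have hτ : ∀ N : Fin (m + 1), trans α β θ ϑ N h =
      b N * ((poch (α + β + 2 * θ + 2 * ϑ + 2 * (N : ℕ) + 4) (m - N) : ℝ) : ℂ) := by
    intro N
    rw [hb, map_sum, Finset.sum_eq_single N]
    · rw [map_smul, smul_eq_mul, trans_basisPoly hsum, if_pos rfl]
    · intro M _ hM
      rw [map_smul, trans_basisPoly hsum, if_neg (fun h => hM (Fin.ext h.symm)), smul_zero]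
    · simp
  have hinner : polyInner (bmeas α β θ ϑ) h h = ((∑ N : Fin (m + 1),
      1 / sigma α β (θ + (N : ℕ)) ϑ * (‖trans α β θ ϑ N h‖ ^ 2 *
        ((m - N).factorial / poch (α + β + 2 * θ + 2 * ϑ + 2 * (N : ℕ) + 4) (m - N))) : ℝ) : ℂ) := by
    conv_lhs => rw [hb, polyInner_sum_left]
    rw [← hb, Complex.ofReal_sum]
    refine Finset.sum_congr rfl fun N _ => ?_
    rw [polyInner_smul_left, hright, Finset.sum_eq_single N]
    · have hp := (poch_ne_zero_of_sum hsum N (m - N)).ne'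
      rw [polyInner_basisPoly_self hα hβ hθ hsum, hτ, ← mul_assoc, Complex.mul_conj,
        Complex.normSq_eq_norm_sq, ← Complex.ofReal_mul, norm_mul, Complex.norm_real,
        mul_pow, Real.norm_eq_abs, sq_abs]
      congr 1
      field_simp
    · intro M _ hM
      rw [polyInner_basisPoly_of_ne hα hβ (fun h => hM (Fin.ext h.symm)), mul_zero]
    · simp
  rw [polyInner_self] at hinner
  have hreal := Complex.ofReal_injective hinner
  have hnn : ∀ N : ℕ, 0 ≤ ((m - N).factorial : ℝ) /
      poch (α + β + 2 * θ + 2 * ϑ + 2 * N + 4) (m - N) := fun N =>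
    div_nonneg (Nat.cast_nonneg _) (poch_ne_zero_of_sum hsum N _).le
  rw [← ENNReal.ofReal_toReal hfinite, hreal, ENNReal.ofReal_sum_of_nonneg
    (fun (N : Fin (m + 1)) _ => mul_nonneg (hS N) (mul_nonneg (by positivity) (hnn N))), Finset.sum_range]
  refine Finset.sum_congr rfl fun N _ => ?_
  rw [ENNReal.ofReal_mul (hS N), ENNReal.ofReal_mul (by positivity)]

end Norms

open scoped NNReal

/-! ### Power series in one variable -/

/-- The function `g` is the sum of the power series with coefficients `b` in the disk. -/
def HasSeries (b : ℕ → ℂ) (g : ℂ → ℂ) : Prop :=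
  ∀ z ∈ disk, HasSum (fun n => b n * z ^ n) (g z)

/-- Summability at each real point `r < 1` already forces the radius of convergence to be at least
one. -/
lemma HasSeries.hasFPowerSeriesOnBall {b : ℕ → ℂ} {g : ℂ → ℂ} (h : HasSeries b g) :
    HasFPowerSeriesOnBall g (FormalMultilinearSeries.ofScalars ℂ b) 0 1 where
  r_le := by
    refine ENNReal.le_of_forall_nnreal_lt fun r hr => ?_
    refine FormalMultilinearSeries.le_radius_of_summable _ ?_
    have hr' : ((r : ℝ) : ℂ) ∈ disk := by
      rw [mem_disk, Complex.norm_real, Real.norm_of_nonneg r.coe_nonneg]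
      exact_mod_cast hr
    have := (h _ hr').summable.norm
    simpa [FormalMultilinearSeries.ofScalars_norm] using this
  r_pos := one_pos
  hasSum := by
    intro y hy
    have hy' : y ∈ disk := by
      simpa [mem_disk, Metric.mem_eball, edist_zero_right, enorm_eq_nnnorm, ← NNReal.coe_lt_coe]
        using hy
    rw [zero_add]
    refine (h y hy').congr_fun fun n => ?_
    rw [FormalMultilinearSeries.ofScalars_apply_eq, smul_eq_mul]

lemma HasSeries.differentiableOn {b : ℕ → ℂ} {g : ℂ → ℂ} (h : HasSeries b g) :
    DifferentiableOn ℂ g disk := by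
  have := h.hasFPowerSeriesOnBall.differentiableOn
  rwa [← ENNReal.ofReal_one, Metric.eball_ofReal] at this

lemma HasSeries.iteratedDeriv_zero {b : ℕ → ℂ} {g : ℂ → ℂ} (h : HasSeries b g) (n : ℕ) :
    iteratedDeriv n g 0 = n.factorial * b n := by
  have := h.hasFPowerSeriesOnBall.factorial_smul 1 n
  rw [iteratedFDeriv_apply_eq_iteratedDeriv_mul_prod, Finset.prod_const_one, one_smul] at this
  rw [← this, FormalMultilinearSeries.ofScalars_apply_eq]
  simp

lemma hasSeries_of_differentiableOn {g : ℂ → ℂ} (hg : DifferentiableOn ℂ g disk) :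
    HasSeries (fun n => (n.factorial : ℂ)⁻¹ * iteratedDeriv n g 0) g := by
  intro z hz
  refine (Complex.hasSum_taylorSeries_on_ball hg hz).congr_fun fun n => ?_
  rw [sub_zero, smul_eq_mul, smul_eq_mul]
  ring

lemma iteratedDeriv_iteratedDeriv (m n : ℕ) (g : ℂ → ℂ) :
    iteratedDeriv m (iteratedDeriv n g) = iteratedDeriv (m + n) g := by
  rw [iteratedDeriv_eq_iterate, iteratedDeriv_eq_iterate, iteratedDeriv_eq_iterate,
    Function.iterate_add_apply]

lemma differentiableOn_iteratedDeriv {g : ℂ → ℂ} (hg : DifferentiableOn ℂ g disk) (k : ℕ) :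
    DifferentiableOn ℂ (iteratedDeriv k g) disk := by
  induction k with
  | zero => simpa using hg
  | succ k ih => rw [iteratedDeriv_succ]; exact ih.deriv isOpen_disk

/-- The derivative is holomorphic, so it has its own Taylor series; comparing coefficients at `0`
replaces termwise differentiation. -/
lemma HasSeries.iteratedDeriv_series {b : ℕ → ℂ} {g : ℂ → ℂ} (h : HasSeries b g) (k : ℕ) :
    HasSeries (fun n => ((n + k).descFactorial k : ℂ) * b (n + k)) (iteratedDeriv k g) := by
  intro z hz
  refine (hasSeries_of_differentiableOn (differentiableOn_iteratedDeriv h.differentiableOn k)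
    z hz).congr_fun fun n => ?_
  dsimp only
  rw [iteratedDeriv_iteratedDeriv, h.iteratedDeriv_zero]
  have h1 : ((n + k).factorial : ℂ) = n.factorial * (n + k).descFactorial k := by
    have := Nat.factorial_mul_descFactorial (n := n + k) (k := k) (by omega)
    rw [Nat.add_sub_cancel] at this
    exact_mod_cast this.symm
  have h2 : (n.factorial : ℂ) ≠ 0 := by exact_mod_cast n.factorial_ne_zero
  rw [h1]
  field_simp

/-! ### Double power series -/

/-- The function `f` is the sum of the double power series with coefficients `c` in the bidisk. -/
def HasDoubleSeries (c : ℕ × ℕ → ℂ) (f : ℂ × ℂ → ℂ) : Prop :=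
  ∀ z ∈ bidisk, HasSum (fun p : ℕ × ℕ => c p * (z.1 ^ p.1 * z.2 ^ p.2)) (f z)

lemma closedBall_subset_disk {r : ℝ} (hr : r < 1) : Metric.closedBall (0 : ℂ) r ⊆ disk :=
  Metric.closedBall_subset_ball hr

section Holomorphic

variable {f : ℂ × ℂ → ℂ} (hf : DifferentiableOn ℂ f bidisk)

include hf

lemma differentiableOn_slice_fst {w : ℂ} (hw : w ∈ disk) :
    DifferentiableOn ℂ (fun ζ => f (ζ, w)) disk :=
  hf.comp (by fun_prop) fun _ hζ => ⟨hζ, hw⟩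

lemma differentiableOn_slice_snd {ζ : ℂ} (hζ : ζ ∈ disk) :
    DifferentiableOn ℂ (fun w => f (ζ, w)) disk :=
  hf.comp (by fun_prop) fun _ hw => ⟨hζ, hw⟩

/-- The Taylor coefficients in the first variable are holomorphic in the second one. -/
lemma differentiableOn_iteratedDeriv_slice (j : ℕ) :
    DifferentiableOn ℂ (fun w => iteratedDeriv j (fun ζ => f (ζ, w)) 0) disk := by
  intro w₀ hw₀
  obtain ⟨r, hr₀, hr₁⟩ := exists_between (mem_disk.1 hw₀)
  have hr : 0 < r := (norm_nonneg _).trans_lt hr₀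
  set G : ℂ → ℂ := fun w => ∮ z in C(0, r), (1 / (z - 0) ^ (j + 1)) • f (z, w) with hG
  have hcm : ∀ φ : ℝ, circleMap 0 r φ ∈ disk := fun φ => by
    rw [mem_disk, norm_circleMap_zero, abs_of_pos hr]; exact hr₁
  have hne : ∀ φ : ℝ, circleMap 0 r φ ≠ 0 := fun φ => circleMap_ne_center hr.ne'
  have hcont : Continuous fun x : ℝ × ℝ => f (circleMap 0 r x.1, circleMap 0 r x.2) :=
    hf.continuousOn.comp_continuous (by fun_prop) fun x => ⟨hcm _, hcm _⟩
  have hGeq : ∀ w ∈ disk, G w = (2 * Real.pi * Complex.I / j.factorial) •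
      iteratedDeriv j (fun ζ => f (ζ, w)) 0 := by
    intro w hw
    have hd := differentiableOn_slice_fst hf hw
    exact Complex.circleIntegral_one_div_sub_center_pow_smul_of_differentiable_on_off_countable
      hr j Set.countable_empty (hd.continuousOn.mono (closedBall_subset_disk hr₁))
      fun z hz => hd.differentiableAt
        (isOpen_disk.mem_nhds (closedBall_subset_disk hr₁ (Metric.ball_subset_closedBall hz.1)))
  have hGint : CircleIntegrable G 0 r := by
    have : Continuous fun φ : ℝ => G (circleMap 0 r φ) := by
      simp only [hG, circleIntegral]
      refine intervalIntegral.continuous_parametric_intervalIntegral_of_continuous' ?_ _ _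
      simp only [deriv_circleMap, sub_zero, smul_eq_mul, Function.uncurry_def]
      have h1 : Continuous fun x : ℝ × ℝ => circleMap 0 r x.2 * Complex.I := by fun_prop
      have h2 : Continuous fun x : ℝ × ℝ => 1 / circleMap 0 r x.2 ^ (j + 1) :=
        continuous_const.div (by fun_prop) fun x => pow_ne_zero _ (hne _)
      have h3 := hcont.comp (continuous_snd.prodMk (continuous_fst (X := ℝ) (Y := ℝ)))
      exact h1.mul (h2.mul h3)
    exact this.intervalIntegrable _ _
  -- Cauchy's formula for `f` in the second variable and Fubini show that `G` is the Cauchy integral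
  -- of its own boundary values, hence holomorphic.
  have hcauchy : ∀ w ∈ Metric.ball (0 : ℂ) r,
      (2 * Real.pi * Complex.I : ℂ)⁻¹ • ∮ u in C(0, r), (u - w)⁻¹ • G u = G w := by
    intro w hw
    have hwr : ‖w‖ < r := by simpa using hw
    have hsub : ∀ φ : ℝ, circleMap 0 r φ - w ≠ 0 := by
      intro φ h
      have : ‖circleMap 0 r φ‖ = ‖w‖ := by rw [sub_eq_zero.1 h]
      rw [norm_circleMap_zero, abs_of_pos hr] at this
      linarith
    have h1 : ∀ z ∈ disk, f (z, w) =
        (2 * Real.pi * Complex.I : ℂ)⁻¹ • ∮ u in C(0, r), (u - w)⁻¹ • f (z, u) := by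
      intro z hz
      have hd := differentiableOn_slice_snd hf hz
      exact (Complex.two_pi_I_inv_smul_circleIntegral_sub_inv_smul_of_differentiable_on_off_countable
        Set.countable_empty hw (hd.continuousOn.mono (closedBall_subset_disk hr₁))
        fun u hu => hd.differentiableAt (isOpen_disk.mem_nhds
          (closedBall_subset_disk hr₁ (Metric.ball_subset_closedBall hu.1)))).symm
    have h2 : G w = ∮ z in C(0, r), (1 / (z - 0) ^ (j + 1)) •
        ((2 * Real.pi * Complex.I : ℂ)⁻¹ • ∮ u in C(0, r), (u - w)⁻¹ • f (z, u)) := by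
      refine circleIntegral.integral_congr hr.le fun z hz => ?_
      have hz' : z ∈ disk := closedBall_subset_disk hr₁ (Metric.sphere_subset_closedBall hz)
      rw [← h1 z hz']
    rw [h2]
    simp only [hG, circleIntegral, ← intervalIntegral.integral_smul]
    rw [intervalIntegral_intervalIntegral_swap]
    · refine intervalIntegral.integral_congr fun θ _ => intervalIntegral.integral_congr fun φ _ => ?_
      simp only [smul_eq_mul]
      ring
    · have : Continuous (Function.uncurry fun x y : ℝ =>
          (2 * (Real.pi : ℂ) * Complex.I)⁻¹ • deriv (circleMap 0 r) x •
            (circleMap 0 r x - w)⁻¹ • deriv (circleMap 0 r) y •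
            (1 / (circleMap 0 r y - 0) ^ (j + 1)) • f (circleMap 0 r y, circleMap 0 r x)) := by
        simp only [deriv_circleMap, sub_zero, smul_eq_mul, Function.uncurry_def]
        have h1 : Continuous fun x : ℝ × ℝ => circleMap 0 r x.1 * Complex.I := by fun_prop
        have h2 : Continuous fun x : ℝ × ℝ => (circleMap 0 r x.1 - w)⁻¹ :=
          Continuous.inv₀ (by fun_prop) fun x => hsub _
        have h3 : Continuous fun x : ℝ × ℝ => circleMap 0 r x.2 * Complex.I := by fun_prop
        have h4 : Continuous fun x : ℝ × ℝ => 1 / circleMap 0 r x.2 ^ (j + 1) :=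
          continuous_const.div (by fun_prop) fun x => pow_ne_zero _ (hne _)
        have h5 := hcont.comp (continuous_snd.prodMk (continuous_fst (X := ℝ) (Y := ℝ)))
        exact continuous_const.mul (h1.mul (h2.mul (h3.mul (h4.mul h5))))
      refine (this.continuousOn.integrableOn_compact
        (isCompact_uIcc.prod isCompact_uIcc)).mono_set
        (Set.prod_mono Set.uIoc_subset_uIcc Set.uIoc_subset_uIcc)
  have hGd : DifferentiableOn ℂ G (Metric.ball 0 r) := by
    have hps := (hasFPowerSeriesOn_cauchy_integral (R := Real.toNNReal r)
      (by rwa [Real.coe_toNNReal _ hr.le]) (Real.toNNReal_pos.2 hr)).differentiableOn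
    rw [Metric.eball_coe, Real.coe_toNNReal _ hr.le] at hps
    exact hps.congr fun w hw => (hcauchy w hw).symm
  have hw₀r : w₀ ∈ Metric.ball (0 : ℂ) r := by simpa using hr₀
  have hj : (j.factorial : ℂ) ≠ 0 := by exact_mod_cast j.factorial_ne_zero
  have hfin : DifferentiableOn ℂ (fun w => iteratedDeriv j (fun ζ => f (ζ, w)) 0)
      (Metric.ball 0 r) := by
    refine (hGd.const_smul (2 * Real.pi * Complex.I / j.factorial : ℂ)⁻¹).congr fun w hw => ?_
    have hwd : w ∈ disk := closedBall_subset_disk hr₁ (Metric.ball_subset_closedBall hw)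
    rw [Pi.smul_apply, hGeq w hwd, smul_smul, inv_mul_cancel₀, one_smul]
    exact div_ne_zero Complex.two_pi_I_ne_zero hj
  exact (hfin.differentiableAt (Metric.isOpen_ball.mem_nhds hw₀r)).differentiableWithinAt

end Holomorphic

/-! ### Operations on double power series -/

lemma summable_geometric_prod {x y : ℝ} (hx₀ : 0 ≤ x) (hx : x < 1) (hy₀ : 0 ≤ y) (hy : y < 1)
    (k : ℕ) :
    Summable fun p : ℕ × ℕ => ((p.1 + k).descFactorial k * x ^ p.1) * y ^ p.2 := by
  refine Summable.mul_of_nonneg (f := fun n : ℕ => ((n + k).descFactorial k * x ^ n : ℝ))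
    (g := fun n => y ^ n) ?_ (summable_geometric_of_lt_one hy₀ hy)
    (fun n => by positivity) (fun n => by positivity)
  exact summable_descFactorial_mul_geometric_of_norm_lt_one k
    (by rwa [Real.norm_of_nonneg hx₀])

/-- Comparison with a product of geometric series; `k` derivatives cost only a polynomial factor,
and `k = 0` is the series itself. -/
lemma summable_of_norm_le_geometric {a : ℕ × ℕ → ℂ} {M r : ℝ} (hr : 0 < r)
    (ha : ∀ p, ‖a p‖ * (r ^ p.1 * r ^ p.2) ≤ M) (k : ℕ) {z : ℂ × ℂ} (h₁ : ‖z.1‖ < r)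
    (h₂ : ‖z.2‖ < r) :
    Summable fun p : ℕ × ℕ =>
      (((p.1 + k).descFactorial k : ℂ) * a (p.1 + k, p.2)) * (z.1 ^ p.1 * z.2 ^ p.2) := by
  have hs := (summable_geometric_prod (x := ‖z.1‖ / r) (y := ‖z.2‖ / r) (by positivity)
    ((div_lt_one hr).2 h₁) (by positivity) ((div_lt_one hr).2 h₂) k).mul_left (M / r ^ k)
  refine Summable.of_norm_bounded hs fun p => ?_
  have h := ha (p.1 + k, p.2)
  have hb : ‖a (p.1 + k, p.2)‖ ≤ M / (r ^ (p.1 + k) * r ^ p.2) := by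
    rwa [le_div_iff₀ (by positivity)]
  rw [norm_mul, norm_mul, norm_mul, norm_pow, norm_pow, Complex.norm_natCast]
  calc _ ≤ ((p.1 + k).descFactorial k * (M / (r ^ (p.1 + k) * r ^ p.2)))
        * (‖z.1‖ ^ p.1 * ‖z.2‖ ^ p.2) := by gcongr
    _ = _ := by
      rw [div_pow, div_pow, pow_add]
      field_simp

lemma exists_radius {z : ℂ × ℂ} (hz : z ∈ bidisk) :
    ∃ r : ℝ, 0 < r ∧ r < 1 ∧ ‖z.1‖ < r ∧ ‖z.2‖ < r := by
  obtain ⟨r, h, h'⟩ := exists_between (max_lt (mem_disk.1 hz.1) (mem_disk.1 hz.2))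
  exact ⟨r, ((norm_nonneg _).trans (le_max_left _ _)).trans_lt h, h',
    (le_max_left _ _).trans_lt h, (le_max_right _ _).trans_lt h⟩

/-- A holomorphic function in the bidisk is the sum of a double power series. -/
lemma exists_hasDoubleSeries {f : ℂ × ℂ → ℂ} (hf : DifferentiableOn ℂ f bidisk) :
    ∃ c, HasDoubleSeries c f := by
  set g : ℕ → ℂ → ℂ := fun i w => iteratedDeriv i (fun ζ => f (ζ, w)) 0 with hg
  refine ⟨fun p => (p.1.factorial : ℂ)⁻¹ * ((p.2.factorial : ℂ)⁻¹ * iteratedDeriv p.2 (g p.1) 0),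
    fun z hz => ?_⟩
  obtain ⟨r, hr, hr₁, hz₁, hz₂⟩ := exists_radius hz
  have hsub := closedBall_subset_disk hr₁
  obtain ⟨M, hM⟩ := ((isCompact_closedBall (0 : ℂ) r).prod
    (isCompact_closedBall (0 : ℂ) r)).exists_bound_of_continuousOn
    (hf.continuousOn.mono (Set.prod_mono hsub hsub))
  have hdc : ∀ {φ : ℂ → ℂ}, DifferentiableOn ℂ φ disk →
      DiffContOnCl ℂ φ (Metric.ball 0 r) := fun h => by
    refine DifferentiableOn.diffContOnCl ?_
    rw [closure_ball _ hr.ne']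
    exact h.mono hsub
  have hg_le : ∀ i, ∀ w ∈ Metric.closedBall (0 : ℂ) r, ‖g i w‖ ≤ i.factorial * M / r ^ i :=
    fun i w hw => Complex.norm_iteratedDeriv_le_of_forall_mem_sphere_norm_le i hr
      (hdc (differentiableOn_slice_fst hf (hsub hw)))
      fun ζ hζ => hM (ζ, w) ⟨Metric.sphere_subset_closedBall hζ, hw⟩
  -- Cauchy's estimate, once in each variable, bounds the double coefficients geometrically.
  have hg_der : ∀ i j, ‖iteratedDeriv j (g i) 0‖ ≤
      j.factorial * (i.factorial * M / r ^ i) / r ^ j :=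
    fun i j => Complex.norm_iteratedDeriv_le_of_forall_mem_sphere_norm_le j hr
      (hdc (differentiableOn_iteratedDeriv_slice hf i))
      fun ζ hζ => hg_le i ζ (Metric.sphere_subset_closedBall hζ)
  have hs := (summable_of_norm_le_geometric (M := M)
    (a := fun p => (p.1.factorial : ℂ)⁻¹ * ((p.2.factorial : ℂ)⁻¹ * iteratedDeriv p.2 (g p.1) 0))
    hr (fun p => by
      rw [norm_mul, norm_mul, norm_inv, norm_inv, Complex.norm_natCast, Complex.norm_natCast]
      have h1 : (0 : ℝ) < p.1.factorial := by exact_mod_cast p.1.factorial_pos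
      have h2 : (0 : ℝ) < p.2.factorial := by exact_mod_cast p.2.factorial_pos
      calc _ ≤ ((p.1.factorial : ℝ)⁻¹ * ((p.2.factorial : ℝ)⁻¹ *
            (p.2.factorial * (p.1.factorial * M / r ^ p.1) / r ^ p.2))) *
            (r ^ p.1 * r ^ p.2) := by
            gcongr
            exact hg_der _ _
        _ = M := by field_simp) 0 hz₁ hz₂)
  simp only [add_zero, Nat.descFactorial_zero, Nat.cast_one, one_mul] at hs
  have h1 : ∀ i, HasSum (fun j => ((i.factorial : ℂ)⁻¹ * ((j.factorial : ℂ)⁻¹ *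
      iteratedDeriv j (g i) 0)) * (z.1 ^ i * z.2 ^ j))
      ((i.factorial : ℂ)⁻¹ * g i z.2 * z.1 ^ i) := fun i => by
    have := (hasSeries_of_differentiableOn (differentiableOn_iteratedDeriv_slice hf i) z.2
      hz.2).mul_left ((i.factorial : ℂ)⁻¹ * z.1 ^ i)
    rw [mul_right_comm] at this
    refine this.congr_fun fun j => ?_
    dsimp only
    ring
  -- Absolute summability identifies the double sum with the iterated Taylor expansion, whose value
  -- is `f z`.
  have h2 := hs.hasSum.prod_fiberwise h1
  have h3 := hasSeries_of_differentiableOn (differentiableOn_slice_fst hf hz.2) z.1 hz.1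
  exact (h2.unique h3) ▸ hs.hasSum

section

variable {c : ℕ × ℕ → ℂ} {f : ℂ × ℂ → ℂ}

lemma HasDoubleSeries.exists_bound (h : HasDoubleSeries c f) {r : ℝ} (hr : 0 < r) (hr₁ : r < 1) :
    ∃ M, ∀ p : ℕ × ℕ, ‖c p‖ * (r ^ p.1 * r ^ p.2) ≤ M := by
  have hmem : ((r : ℂ), (r : ℂ)) ∈ bidisk := by
    constructor <;> rw [mem_disk, Complex.norm_real, Real.norm_of_nonneg hr.le] <;> exact hr₁
  have hs := (h _ hmem).summable.norm
  refine ⟨∑' p : ℕ × ℕ, ‖c p * ((r : ℂ) ^ p.1 * (r : ℂ) ^ p.2)‖, fun p => ?_⟩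
  refine le_trans (le_of_eq ?_) (hs.le_tsum p fun _ _ => norm_nonneg _)
  rw [norm_mul, norm_mul, norm_pow, norm_pow, Complex.norm_real, Real.norm_of_nonneg hr.le]

/-- Partial differentiation of a double power series. -/
lemma HasDoubleSeries.partialFst (h : HasDoubleSeries c f) (k : ℕ) :
    HasDoubleSeries (fun p => ((p.1 + k).descFactorial k : ℂ) * c (p.1 + k, p.2))
      (partialFst k f) := by
  intro z hz
  obtain ⟨r, hr, hr₁, hz₁, hz₂⟩ := exists_radius hz
  obtain ⟨M, hM⟩ := h.exists_bound hr hr₁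
  have hs := summable_of_norm_le_geometric hr hM k hz₁ hz₂
  have hfib : ∀ i, Summable fun j => c (i, j) * z.2 ^ j := fun i => by
    -- The first coordinate must be nonzero so that its power can be divided out; `z.1` may vanish.
    have hhalf : ((1 / 2 : ℂ), z.2) ∈ bidisk := ⟨by rw [mem_disk]; norm_num, hz.2⟩
    have := ((h _ hhalf).summable.prod_factor i).mul_left ((2 : ℂ) ^ i)
    refine this.congr fun j => ?_
    have h2 : (2 : ℂ) ^ i * (1 / 2) ^ i = 1 := by rw [← mul_pow]; norm_num
    linear_combination (c (i, j) * z.2 ^ j) * h2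
  have hser : HasSeries (fun i => ∑' j, c (i, j) * z.2 ^ j) (fun ζ => f (ζ, z.2)) := by
    intro ζ hζ
    refine (h (ζ, z.2) ⟨hζ, hz.2⟩).prod_fiberwise fun i => ?_
    refine ((hfib i).hasSum.mul_right (ζ ^ i)).congr_fun fun j => ?_
    dsimp only
    ring
  have h1 := hser.iteratedDeriv_series k z.1 hz.1
  have h2 := hs.hasSum.prod_fiberwise fun i =>
    (((hfib (i + k)).hasSum.mul_left ((i + k).descFactorial k : ℂ)).mul_right
      (z.1 ^ i)).congr_fun fun j => by dsimp only; ring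
  have h3 : _ = BidiskBergman.partialFst k f z := h2.unique h1
  exact h3 ▸ hs.hasSum

lemma hasSum_antidiagonal {F : ℕ × ℕ → ℂ} {S : ℂ} (h : HasSum F S) :
    HasSum (fun n => ∑ p ∈ Finset.HasAntidiagonal.antidiagonal n, F p) S := by
  have := (Finset.HasAntidiagonal.sigmaAntidiagonalEquivProd (A := ℕ)).hasSum_iff.2 h
  refine this.sigma fun n => ?_
  have h2 := hasSum_fintype fun p : Finset.HasAntidiagonal.antidiagonal n => F p
  rwa [Finset.sum_coe_sort (Finset.HasAntidiagonal.antidiagonal n) F] at h2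

lemma HasDoubleSeries.diagRestrict (h : HasDoubleSeries c f) :
    HasSeries (fun n => ∑ p ∈ Finset.HasAntidiagonal.antidiagonal n, c p) (diagRestrict f) := by
  intro z hz
  refine (hasSum_antidiagonal (h (z, z) ⟨hz, hz⟩)).congr_fun fun n => ?_
  rw [Finset.sum_mul]
  refine Finset.sum_congr rfl fun p hp => ?_
  rw [← Finset.HasAntidiagonal.mem_antidiagonal.1 hp, pow_add]

/-- The homogeneous component of degree `m` of a double power series. -/
def homComponent (c : ℕ × ℕ → ℂ) (m : ℕ) : MvPolynomial (Fin 2) ℂ :=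
  ∑ p ∈ Finset.HasAntidiagonal.antidiagonal m, c p • (X 0 ^ p.1 * X 1 ^ p.2)

lemma isHomogeneous_homComponent (c : ℕ × ℕ → ℂ) (m : ℕ) :
    (homComponent c m).IsHomogeneous m := by
  refine MvPolynomial.IsHomogeneous.sum _ _ _ fun p hp => ?_
  rw [← Finset.HasAntidiagonal.mem_antidiagonal.1 hp, MvPolynomial.smul_eq_C_mul]
  have := ((MvPolynomial.isHomogeneous_X ℂ (0 : Fin 2)).pow p.1).mul
    ((MvPolynomial.isHomogeneous_X ℂ (1 : Fin 2)).pow p.2)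
  simpa using this.C_mul (c p)

lemma HasDoubleSeries.hasSum_homComponent (h : HasDoubleSeries c f) {z : ℂ × ℂ}
    (hz : z ∈ bidisk) : HasSum (fun m => evalAt (homComponent c m) z) (f z) := by
  refine (hasSum_antidiagonal (h z hz)).congr_fun fun m => ?_
  simp [homComponent, evalAt_sum]

lemma sum_antidiagonal_add {F : ℕ × ℕ → ℂ} (k m : ℕ) (hF : ∀ p, p.1 < k → F p = 0) :
    ∑ p ∈ Finset.HasAntidiagonal.antidiagonal (m + k), F p =
      ∑ p ∈ Finset.HasAntidiagonal.antidiagonal m, F (p.1 + k, p.2) := by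
  induction k generalizing F with
  | zero => rfl
  | succ k ih =>
    rw [← add_assoc, Finset.Nat.sum_antidiagonal_succ, hF _ (Nat.succ_pos k), zero_add,
      ih (F := fun p => F (p.1 + 1, p.2)) fun p hp => hF _ (Nat.succ_lt_succ hp)]
    simp only [add_assoc]

lemma trans_homComponent (α β θ ϑ : ℝ) (N m : ℕ) :
    trans α β θ ϑ N (homComponent c m) =
      ∑ p ∈ Finset.HasAntidiagonal.antidiagonal m, c p * (transMonomial α β θ ϑ N p.1 p.2 : ℂ) := by
  simp [homComponent, trans_X_pow_mul]

/-- The power series of the diagonal terms. -/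
lemma HasDoubleSeries.diagTerm (h : HasDoubleSeries c f) (α β θ ϑ : ℝ) (N : ℕ) :
    HasSeries (fun n => trans α β θ ϑ N (homComponent c (n + N))) (diagTerm α β θ ϑ N f) := by
  intro z hz
  have h1 := hasSum_sum (s := Finset.range (N + 1)) fun k _ =>
    (((h.partialFst k).diagRestrict.iteratedDeriv_series (N - k) z hz).mul_left
      (coeff α β θ ϑ k N : ℂ))
  refine h1.congr_fun fun n => ?_
  dsimp only
  rw [trans_homComponent, Finset.sum_mul]
  simp only [transMonomial, Complex.ofReal_sum, Finset.mul_sum, Finset.sum_mul]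
  rw [Finset.sum_comm]
  refine Finset.sum_congr rfl fun k hk => ?_
  have hkN : k ≤ N := Nat.lt_succ_iff.1 (Finset.mem_range.1 hk)
  obtain ⟨d, rfl⟩ := Nat.exists_eq_add_of_le hkN
  -- Monomials whose first exponent is below `k` are killed by `∂₁^k`, so the index shift loses
  -- nothing.
  rw [show n + (k + d) = (n + d) + k by ring, sum_antidiagonal_add k (n + d)]
  · rw [Nat.add_sub_cancel_left]
    refine Finset.sum_congr rfl fun p hp => ?_
    have hp' : p.1 + k + p.2 - k = n + d := by
      have := Finset.HasAntidiagonal.mem_antidiagonal.1 hp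
      omega
    rw [hp']
    push_cast
    ring
  · intro p hp
    simp [Nat.descFactorial_of_lt hp]

end

/-! ### The norm formula -/

lemma HasSeries.lintegral_diskMeasure {b : ℕ → ℂ} {g : ℂ → ℂ} (h : HasSeries b g) {a : ℝ}
    (ha : -1 < a) :
    ∫⁻ z, ENNReal.ofReal (‖g z‖ ^ 2) ∂(diskMeasure a) =
      ∑' n, ENNReal.ofReal (‖b n‖ ^ 2) * ENNReal.ofReal (n.factorial / poch (a + 2) n) := by
  rw [(rotationInvariant_diskMeasure a).lintegral_normSq_eq_tsum measurableSet_disk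
    (a := fun n z => b n * z ^ n)
    ((withDensity_absolutelyContinuous _ _).ae_le (ae_restrict_mem measurableSet_disk))
    (fun z hz t => (rot_mem_disk t).2 hz) (fun n => by fun_prop)
    (fun n z _ t => by rw [smul_eq_mul, mul_pow]; ring) h]
  refine tsum_congr fun n => ?_
  rw [← lintegral_diskMeasure_pow ha, ← lintegral_const_mul _ (by fun_prop)]
  refine lintegral_congr fun z => ?_
  rw [norm_mul, mul_pow, ENNReal.ofReal_mul (by positivity)]

/-- Tonelli along antidiagonals: summation by total degree `m` becomes summation by order `N` and
remaining degree `n = m - N`. -/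
lemma tsum_sum_range_succ (F : ℕ → ℕ → ℝ≥0∞) :
    ∑' m, ∑ N ∈ Finset.range (m + 1), F N (m - N) = ∑' N, ∑' n, F N n := by
  rw [← ENNReal.tsum_prod, ← (Finset.HasAntidiagonal.sigmaAntidiagonalEquivProd (A := ℕ)).tsum_eq,
    ENNReal.tsum_sigma']
  refine tsum_congr fun m => ?_
  rw [← Finset.Nat.sum_antidiagonal_eq_sum_range_succ F, tsum_fintype,
    ← Finset.sum_coe_sort]
  rfl

section

variable {α β θ ϑ : ℝ} (hα : -1 < α) (hβ : -1 < β) (hθ : -1 < θ)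
  (hsum : 0 < α + β + 2 * θ + 2 * ϑ + 3)

include hα hβ hθ hsum

/-- The norm formula for the sum of a double power series, with values in `[0, ∞]`. -/
lemma HasDoubleSeries.lintegral_normSq {c : ℕ × ℕ → ℂ} {f : ℂ × ℂ → ℂ}
    (h : HasDoubleSeries c f) :
    ∫⁻ z, ENNReal.ofReal (‖f z‖ ^ 2) ∂(bmeas α β θ ϑ) =
      ∑' N : ℕ, ENNReal.ofReal (1 / sigma α β (θ + N) ϑ) *
        ∫⁻ z, ENNReal.ofReal (‖BidiskBergman.diagTerm α β θ ϑ N f z‖ ^ 2)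
          ∂(diskMeasure (α + β + 2 * θ + 2 * ϑ + 2 * N + 2)) := by
  rw [(rotationInvariant_bmeas α β θ ϑ).lintegral_normSq_eq_tsum measurableSet_bidisk
    (a := fun m z => evalAt (homComponent c m) z) (ae_bmeas_mem_bidisk α β θ ϑ)
    (fun z hz t => ⟨(rot_mem_disk t).2 hz.1, (rot_mem_disk t).2 hz.2⟩)
    (fun m => (continuous_evalAt _).measurable)
    (fun m z _ t => evalAt_smul_of_isHomogeneous (isHomogeneous_homComponent c m) _ _)
    fun z hz => h.hasSum_homComponent hz]
  have hN : ∀ N : ℕ, -1 < α + β + 2 * θ + 2 * ϑ + 2 * N + 2 := fun N => by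
    have : (0 : ℝ) ≤ N := N.cast_nonneg
    linarith
  simp only [(h.diagTerm α β θ ϑ _).lintegral_diskMeasure (hN _), ← ENNReal.tsum_mul_left]
  rw [← tsum_sum_range_succ]
  refine tsum_congr fun m => ?_
  rw [lintegral_normSq_of_isHomogeneous hα hβ hθ hsum (isHomogeneous_homComponent c m)]
  refine Finset.sum_congr rfl fun N hNm => ?_
  have hNm' : m - N + N = m := Nat.sub_add_cancel (Nat.lt_succ_iff.1 (Finset.mem_range.1 hNm))
  rw [hNm', show α + β + 2 * θ + 2 * ϑ + 2 * (N : ℝ) + 2 + 2 =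
    α + β + 2 * θ + 2 * ϑ + 2 * N + 4 by ring]

end

/-! ### From integrals in `[0, ∞]` to real norms -/

lemma integrable_diskMeasure_of_lintegral_ne_top {a : ℝ} {g : ℂ → ℂ}
    (hg : DifferentiableOn ℂ g disk)
    (h : ∫⁻ z, ENNReal.ofReal (‖g z‖ ^ 2) ∂(diskMeasure a) ≠ ∞) :
    Integrable (fun z => ‖g z‖ ^ 2) (diskMeasure a) := by
  refine ⟨((hg.continuousOn.norm.pow 2).aestronglyMeasurable measurableSet_disk).mono_ac
    (withDensity_absolutelyContinuous _ _), ?_⟩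
  rw [hasFiniteIntegral_iff_ofReal (Filter.Eventually.of_forall fun z => by positivity)]
  exact h.lt_top

lemma bidiskWeight_nonneg (θ ϑ : ℝ) (z : ℂ × ℂ) : 0 ≤ bidiskWeight θ ϑ z := by
  unfold bidiskWeight
  positivity

lemma lintegral_bmeas_normSq (α β θ ϑ : ℝ) (f : ℂ × ℂ → ℂ) :
    ∫⁻ z, ENNReal.ofReal (‖f z‖ ^ 2 * bidiskWeight θ ϑ z)
        ∂((diskMeasure α).prod (diskMeasure β)) =
      ∫⁻ z, ENNReal.ofReal (‖f z‖ ^ 2) ∂(bmeas α β θ ϑ) := by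
  rw [← diskMeasure_prod_withDensity, lintegral_withDensity_eq_lintegral_mul_non_measurable _
    (measurable_bidiskWeight θ ϑ).ennreal_ofReal
    (Filter.Eventually.of_forall fun _ => ENNReal.ofReal_lt_top)]
  refine lintegral_congr fun z => ?_
  rw [ENNReal.ofReal_mul (by positivity), mul_comm, Pi.mul_apply]

end BidiskBergman

end

theorem mainTheorem1 (α β θ ϑ : ℝ) (hα : -1 < α) (hβ : -1 < β) (hθ : -1 < θ) (hϑ : -1 < ϑ)
    (hsum : 0 < α + β + 2 * θ + 2 * ϑ + 3) :
    (∀ N : ℕ,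
      Summable (BidiskBergman.hyp32Term ((θ + N) + 1) (α + (θ + N) + ϑ + 2)
        (α + (θ + N) + ϑ + 2) (α + (θ + N) + 2) (α + β + 2 * (θ + N) + 2 * ϑ + 4) 1) ∧
      0 < BidiskBergman.sigma α β (θ + N) ϑ) ∧
    ∀ f ∈ BidiskBergman.bidiskBergman α β θ ϑ,
      (∀ N : ℕ, BidiskBergman.diagTerm α β θ ϑ N f ∈
        BidiskBergman.diskBergman (α + β + 2 * θ + 2 * ϑ + 2 * N + 2)) ∧
      HasSum (fun N : ℕ => 1 / BidiskBergman.sigma α β (θ + N) ϑ *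
          BidiskBergman.diskNormSq (α + β + 2 * θ + 2 * ϑ + 2 * N + 2)
            (BidiskBergman.diagTerm α β θ ϑ N f))
        (BidiskBergman.bidiskNormSq α β θ ϑ f) := by
  open BidiskBergman in
  have hN : ∀ N : ℕ, (0 : ℝ) ≤ N := fun N => N.cast_nonneg
  have hσ : ∀ N : ℕ, 0 < sigma α β (θ + N) ϑ := fun N =>
    sigma_pos hα hβ (by linarith [hN N]) (by linarith [hN N])
  refine ⟨fun N => ⟨summable_sigma hα hβ (by linarith [hN N]) (by linarith [hN N]), hσ N⟩, ?_⟩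
  rintro f ⟨hf, hint⟩
  obtain ⟨c, hc⟩ := exists_hasDoubleSeries hf
  have hnorm := hc.lintegral_normSq (ϑ := ϑ) hα hβ hθ hsum
  have hW : ∀ z, 0 ≤ ‖f z‖ ^ 2 * bidiskWeight θ ϑ z := fun z =>
    mul_nonneg (by positivity) (bidiskWeight_nonneg θ ϑ z)
  have hfin := (hasFiniteIntegral_iff_ofReal (Filter.Eventually.of_forall hW)).1 hint.2
  have hvalue : bidiskNormSq α β θ ϑ f =
      (∫⁻ z, ENNReal.ofReal (‖f z‖ ^ 2) ∂(bmeas α β θ ϑ)).toReal := by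
    rw [bidiskNormSq, integral_eq_lintegral_of_nonneg_ae (Filter.Eventually.of_forall hW) hint.1,
      lintegral_bmeas_normSq]
  rw [lintegral_bmeas_normSq, hnorm] at hfin
  have hterm : ∀ N : ℕ, diagTerm α β θ ϑ N f ∈
      diskBergman (α + β + 2 * θ + 2 * ϑ + 2 * N + 2) := fun N => by
    have hd := (hc.diagTerm α β θ ϑ N).differentiableOn
    refine ⟨hd, integrable_diskMeasure_of_lintegral_ne_top hd fun htop => ?_⟩
    -- A finite total makes every term finite; since `1 / σ > 0`, an infinite norm could not be
    -- hidden by a zero factor.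
    have := ENNReal.ne_top_of_tsum_ne_top hfin.ne N
    rw [htop, ENNReal.mul_top] at this
    · exact this rfl
    · exact (ENNReal.ofReal_pos.2 (one_div_pos.2 (hσ N))).ne'
  refine ⟨hterm, ?_⟩
  have hsum' := ENNReal.hasSum_toReal hfin.ne
  rw [← ENNReal.tsum_toReal_eq fun N => ENNReal.ne_top_of_tsum_ne_top hfin.ne N, ← hnorm,
    ← hvalue] at hsum'
  refine hsum'.congr_fun fun N => ?_
  rw [ENNReal.toReal_mul, ENNReal.toReal_ofReal (one_div_pos.2 (hσ N)).le, diskNormSq,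
    integral_eq_lintegral_of_nonneg_ae (Filter.Eventually.of_forall fun z => by positivity)
      (hterm N).2.1]
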